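/- Let $r\ge 2$ and $n\ge r+1$ be integers, let $\alpha\in\mathbf R_{>0}^n$, and let $D=p_1+\dots+p_n$ be a divisor of $n$ distinct points on $\mathbf P^1$, with $z$ an affine coordinate on $\mathbf P^1$ in which all $p_i$ are finite. Hyperpolygon space. For an $r\times n$ complex matrix $x$ with columns $x_1,\dots,x_n$ and an $n\times r$ complex matrix $y$ with rows $y_1,\dots,y_n$, put $$\mu_r(x,y)=\bigl((xx^*-y^*y)_0,\ |x_1|^2-|y_1|^2,\dots,|x_n|^2-|y_n|^2\bigr),\qquad \mu_c(x,y)=\bigl((xy)_0,\ y_1x_1,\dots,y_nx_n\bigr),$$ where $(\cdot)_0$ is the trace-free part. The hyperpolygon space is $\mathcal X^r_n(\alpha)=\{(x,y):\mu_r(x,y)=(0,\alpha),\ \mu_c(x,y)=0\}/P(U(r)\times(S^1)^n)$, where $(u,t)$ acts by $x_i\mapsto t_i^{-1}ux_i$, $y_i\mapsto t_iy_iu^{-1}$, with the quotient topology. Parabolic Higgs bundles. A (minimal) parabolic Higgs bundle with trivial underlying bundle $E=\mathbf C^r\times\mathbf P^1$ consists of a line $L_i\subset E_{p_i}$ for each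 $i$ and a Higgs field $\phi\in H^0(\mathbf P^1,\mathrm{End}(E)\otimes K(D))$ whose residue $\phi_i$ at $p_i$ satisfies $\phi_i(E_{p_i})\subseteq L_i$ and $\phi_i(L_i)=0$ for each $i$. An isomorphism is a holomorphic bundle isomorphism carrying lines to lines and Higgs field to Higgs field. For a subspace $W\subseteq\mathbf C^r$ put $\alpha(W)=\sum_{i:\,L_i\subseteq W}\alpha_i$. Call $(E,L,\phi)$ $\alpha$-polystable if every $W$ for which $W\times\mathbf P^1$ is $\phi$-invariant satisfies $r\,\alpha(W)\le\dim W\cdot\sum_i\alpha_i$ and, in case of equality, has a complement $W'$ in $\mathbf C^r$ such that $W'\times\mathbf P^1$ is $\phi$-invariant and each $L_i$ lies in $W$ or in $W'$. Let $\mathcal M$ be the set of isomorphism classes of $\alpha$-polystable parabolic Higgs bundles $(E,L,\phi)$ with $E=\mathbf C^r\times\mathbf P^1$, with the topology induced as a quotient of a subspace of $(\mathbf P^{r-1})^n\times H^0(\mathbf P^1,\mathrm{End}(E)\otimes K(D))$. Theorem. All residues $\phi_i$ of such parabolic Higgs bundles lie in the closure of the minimal nilpotent orbit of $\mathfrak{sl}_r$,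 and there is a homeomorphism $\mathcal X^r_n(\alpha)\to\mathcal M$ that sends $[x,y]$ to the class of $(\mathbf C^r\times\mathbf P^1,L,\phi)$ with $L_i=\mathrm{span}\{x_i\}$ and $$\phi(z)=\sum_{i=1}^n\frac{x_iy_i\,dz}{z-p_i}.$$ -/

import Mathlib

open Filter Topology
open scoped Matrix LinearAlgebra.Projectivization

noncomputable section

/-! ### Hyperpolygon spaces as hyperkähler quotients -/

/-- The cotangent space `T^* Rep(Q)` of the representation space of the star quiver with dimension
vector `(r, 1, …, 1)`: pairs `(x, y)`, where the columns of `x` are `x_1, …, x_n` and the rows of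
`y` are `y_1, …, y_n`. -/
abbrev DoubledRep (r n : ℕ) : Type :=
  Matrix (Fin r) (Fin n) ℂ × Matrix (Fin n) (Fin r) ℂ

/-- The trace-free part `A ↦ A_0` of a square matrix. -/
def traceFree {r : ℕ} (A : Matrix (Fin r) (Fin r) ℂ) : Matrix (Fin r) (Fin r) ℂ :=
  A - (A.trace / (r : ℂ)) • (1 : Matrix (Fin r) (Fin r) ℂ)

/-- The real moment map
`((x x^* - y^* y)_0, |x_1|^2 - |y_1|^2, …, |x_n|^2 - |y_n|^2)`. -/
def realMoment {r n : ℕ} (v : DoubledRep r n) : Matrix (Fin r) (Fin r) ℂ × (Fin n → ℝ) :=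
  (traceFree (v.1 * v.1ᴴ - v.2ᴴ * v.2),
    fun i => ∑ a, ‖v.1 a i‖ ^ 2 - ∑ a, ‖v.2 i a‖ ^ 2)

/-- The complex moment map `((x y)_0, y_1 x_1, …, y_n x_n)`. -/
def complexMoment {r n : ℕ} (v : DoubledRep r n) : Matrix (Fin r) (Fin r) ℂ × (Fin n → ℂ) :=
  (traceFree (v.1 * v.2), fun i => ∑ a, v.2 i a * v.1 a i)

/-- The common level set `μ_r⁻¹(α) ∩ μ_c⁻¹(0)`, where `α` is the central element with components
`(0; α_1, …, α_n)`. -/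
abbrev HyperLevel (r n : ℕ) (α : Fin n → ℝ) : Type :=
  {v : DoubledRep r n // realMoment v = (0, α) ∧ complexMoment v = 0}

/-- The action of `(u, t)` in `U(r) × (S^1)^n` by
`x ↦ u x diag(t)⁻¹`, `y ↦ diag(t) y u⁻¹`. -/
def unitaryAct {r n : ℕ} (u : Matrix.unitaryGroup (Fin r) ℂ) (t : Fin n → Circle)
    (v : DoubledRep r n) : DoubledRep r n :=
  ((u : Matrix (Fin r) (Fin r) ℂ) * v.1 * Matrix.diagonal (fun i => (((t i)⁻¹ : Circle) : ℂ)),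
    Matrix.diagonal (fun i => ((t i : Circle) : ℂ)) * v.2 *
      ((u⁻¹ : Matrix.unitaryGroup (Fin r) ℂ) : Matrix (Fin r) (Fin r) ℂ))

lemma unitaryAct_one {r n : ℕ} (v : DoubledRep r n) : unitaryAct 1 1 v = v := by
  simp [unitaryAct]

lemma unitaryAct_mul {r n : ℕ} (u u' : Matrix.unitaryGroup (Fin r) ℂ) (t t' : Fin n → Circle)
    (v : DoubledRep r n) :
    unitaryAct (u * u') (t * t') v = unitaryAct u t (unitaryAct u' t' v) := by
  have h1 : (Matrix.diagonal (fun i => ((((t * t') i)⁻¹ : Circle) : ℂ))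
      : Matrix (Fin n) (Fin n) ℂ)
      = Matrix.diagonal (fun i => (((t' i)⁻¹ : Circle) : ℂ)) *
        Matrix.diagonal (fun i => (((t i)⁻¹ : Circle) : ℂ)) := by
    rw [Matrix.diagonal_mul_diagonal]; congr 1; funext i; simp [mul_comm]
  have h2 : (Matrix.diagonal (fun i => (((t * t') i : Circle) : ℂ)) : Matrix (Fin n) (Fin n) ℂ)
      = Matrix.diagonal (fun i => ((t i : Circle) : ℂ)) *
        Matrix.diagonal (fun i => ((t' i : Circle) : ℂ)) := by
    rw [Matrix.diagonal_mul_diagonal]; congr 1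
  simp only [unitaryAct, h1, h2, mul_inv_rev, Submonoid.coe_mul, Matrix.mul_assoc]

/-- Two points of the level set are equivalent when they lie in the same orbit of
`P(U(r) × (S^1)^n)`; the diagonal scalars act trivially, so these are the orbits of
`U(r) × (S^1)^n`. -/
instance hyperSetoid (r n : ℕ) (α : Fin n → ℝ) : Setoid (HyperLevel r n α) where
  r v w := ∃ (u : Matrix.unitaryGroup (Fin r) ℂ) (t : Fin n → Circle), w.1 = unitaryAct u t v.1
  iseqv :=
    { refl := fun v => ⟨1, 1, (unitaryAct_one v.1).symm⟩
      symm := by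
        rintro v w ⟨u, t, h⟩
        exact ⟨u⁻¹, t⁻¹, by
          rw [h, ← unitaryAct_mul, inv_mul_cancel, inv_mul_cancel, unitaryAct_one]⟩
      trans := by
        rintro v w z ⟨u, t, h⟩ ⟨u', t', h'⟩
        exact ⟨u' * u, t' * t, by rw [h', h, unitaryAct_mul]⟩ }

/-- The hyperpolygon space `X^r_n(α)`: the hyperkähler quotient of `T^* Rep(Q)` at level `(α, 0)`,
with the quotient topology. -/
abbrev HyperpolygonSpace (r n : ℕ) (α : Fin n → ℝ) : Type :=
  Quotient (hyperSetoid r n α)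

/-! ### The minimal nilpotent orbit -/

/-- The minimal nilpotent orbit of `sl_r` (`r ≥ 2`): the conjugacy class of the elementary matrix
with entry `1` in the first row and second column. -/
def minNilpotentOrbit (r : ℕ) : Set (Matrix (Fin r) (Fin r) ℂ) :=
  {A | ∃ g : GL (Fin r) ℂ,
    A = (g : Matrix (Fin r) (Fin r) ℂ) *
      Matrix.of (fun a b : Fin r => if (a : ℕ) = 0 ∧ (b : ℕ) = 1 then (1 : ℂ) else 0) *
      ((g⁻¹ : GL (Fin r) ℂ) : Matrix (Fin r) (Fin r) ℂ)}

/-! ### Parabolic Higgs bundles on the projective line with trivial underlying bundle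

The projective line is `OnePoint ℂ = ℂ ∪ {∞}` with affine coordinate `z`, and `w = 1 / z` is the
coordinate at `∞`. -/

/-- Holomorphic functions on the projective line: holomorphic in both standard charts. -/
def HolomorphicOnP1 (f : OnePoint ℂ → ℂ) : Prop :=
  Differentiable ℂ (fun z : ℂ => f (z : OnePoint ℂ)) ∧
  Differentiable ℂ (fun w : ℂ => f (if w = 0 then OnePoint.infty else ((w⁻¹ : ℂ) : OnePoint ℂ)))

/-- A minimal parabolic Higgs bundle on the projective line whose underlying bundle is the trivial
bundle `E = ℂ^r × P^1`, with respect to the divisor `D = p_1 + ⋯ + p_n`, `p_i ∈ ℂ ⊆ P^1`. -/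
structure ParabolicHiggs (r n : ℕ) (p : Fin n → ℂ) where
  /-- The parabolic structure: a line `L_i` in the fibre `E_{p_i} = ℂ^r`. -/
  line : Fin n → ℙ ℂ (Fin r → ℂ)
  /-- The Higgs field is `φ = form(z) dz`. Only the values off `D` are meaningful. -/
  form : ℂ → Matrix (Fin r) (Fin r) ℂ
  /-- At the points of `D` the function `form` has the conventional value `0`. -/
  form_at : ∀ i, form (p i) = 0
  /-- `φ` is holomorphic on `ℂ ∖ D`. -/
  holo : ∀ a b, DifferentiableOn ℂ (fun z => form z a b) (Set.range p)ᶜ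
  /-- `φ` has at most simple poles at the points of `D`. -/
  pole : ∀ i a b, MeromorphicAt (fun z => form z a b) (p i) ∧
    -1 ≤ meromorphicOrderAt (fun z => form z a b) (p i)
  /-- `φ` is holomorphic at `∞`, where `dz = - w⁻² dw`. -/
  holo_infty : ∀ a b, MeromorphicAt (fun w : ℂ => -(w ^ 2)⁻¹ * form w⁻¹ a b) 0 ∧
    0 ≤ meromorphicOrderAt (fun w : ℂ => -(w ^ 2)⁻¹ * form w⁻¹ a b) 0
  /-- The residue at `p_i`, the matrix of the limits of `(z - p_i) form(z)`. -/
  residue : Fin n → Matrix (Fin r) (Fin r) ℂ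
  tendsto_residue : ∀ i, Tendsto (fun z => (z - p i) • form z) (𝓝[≠] (p i)) (𝓝 (residue i))
  /-- The residue at `p_i` is strictly triangular: it maps `E_{p_i}` into `L_i` ... -/
  residue_mem : ∀ i (v : Fin r → ℂ), residue i *ᵥ v ∈ (line i).submodule
  /-- ... and it kills `L_i`. -/
  residue_line : ∀ i, ∀ v ∈ (line i).submodule, residue i *ᵥ v = 0

namespace ParabolicHiggs

variable {r n : ℕ} {p : Fin n → ℂ}

/-- `B.IsoVia B' g h` says that `g` is an isomorphism `B ≅ B'` with inverse `h`: `g` and `h` are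
mutually inverse holomorphic endomorphisms of the trivial bundle, `g` carries the lines of `B` to
those of `B'` and it intertwines the Higgs fields. -/
structure IsoVia (B B' : ParabolicHiggs r n p)
    (g h : OnePoint ℂ → Matrix (Fin r) (Fin r) ℂ) : Prop where
  holo : ∀ a b, HolomorphicOnP1 (fun q => g q a b)
  holo_inv : ∀ a b, HolomorphicOnP1 (fun q => h q a b)
  mul_inv : ∀ q, g q * h q = 1
  inv_mul : ∀ q, h q * g q = 1
  map_line : ∀ i, (B.line i).submodule.map (Matrix.toLin' (g (p i : ℂ))) = (B'.line i).submodule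
  map_form : ∀ z : ℂ, z ∉ Set.range p → g z * B.form z = B'.form z * g z

/-- Isomorphism of parabolic Higgs bundles. -/
def Iso (B B' : ParabolicHiggs r n p) : Prop := ∃ g h, IsoVia B B' g h

lemma holomorphicOnP1_mul {g h : OnePoint ℂ → Matrix (Fin r) (Fin r) ℂ}
    (hg : ∀ a b, HolomorphicOnP1 (fun q => g q a b))
    (hh : ∀ a b, HolomorphicOnP1 (fun q => h q a b)) (a b : Fin r) :
    HolomorphicOnP1 (fun q => (g q * h q) a b) := by
  simp only [Matrix.mul_apply]
  exact ⟨Differentiable.fun_sum fun c _ => (hg a c).1.mul (hh c b).1,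
    Differentiable.fun_sum fun c _ => (hg a c).2.mul (hh c b).2⟩

lemma Iso.refl (B : ParabolicHiggs r n p) : Iso B B :=
  ⟨fun _ => 1, fun _ => 1, fun _ _ => ⟨differentiable_const _, differentiable_const _⟩,
    fun _ _ => ⟨differentiable_const _, differentiable_const _⟩, fun _ => one_mul 1,
    fun _ => one_mul 1, fun _ => by simp [Matrix.toLin'_one], fun _ _ => by simp⟩

lemma Iso.symm {B B' : ParabolicHiggs r n p} : Iso B B' → Iso B' B := by
  rintro ⟨g, h, H⟩
  refine ⟨h, g, H.holo_inv, H.holo, H.inv_mul, H.mul_inv, fun i => ?_, fun z hz => ?_⟩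
  · rw [← H.map_line i, ← Submodule.map_comp, ← Matrix.toLin'_mul, H.inv_mul, Matrix.toLin'_one,
      Submodule.map_id]
  · calc h z * B'.form z = h z * (B'.form z * g z) * h z := by
          rw [Matrix.mul_assoc, Matrix.mul_assoc, H.mul_inv, Matrix.mul_one]
      _ = (h z * g z) * B.form z * h z := by rw [← H.map_form z hz]; simp only [Matrix.mul_assoc]
      _ = B.form z * h z := by rw [H.inv_mul, Matrix.one_mul]

lemma Iso.trans {B B' B'' : ParabolicHiggs r n p} : Iso B B' → Iso B' B'' → Iso B B'' := by
  rintro ⟨g, h, H⟩ ⟨g', h', H'⟩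
  refine ⟨fun q => g' q * g q, fun q => h q * h' q, holomorphicOnP1_mul H'.holo H.holo,
    holomorphicOnP1_mul H.holo_inv H'.holo_inv, fun q => ?_, fun q => ?_, fun i => ?_,
    fun z hz => ?_⟩
  · rw [Matrix.mul_assoc, ← Matrix.mul_assoc (g q), H.mul_inv, Matrix.one_mul, H'.mul_inv]
  · rw [Matrix.mul_assoc, ← Matrix.mul_assoc (h' q), H'.inv_mul, Matrix.one_mul, H.inv_mul]
  · rw [Matrix.toLin'_mul, Submodule.map_comp, H.map_line, H'.map_line]
  · rw [Matrix.mul_assoc, H.map_form z hz, ← Matrix.mul_assoc, H'.map_form z hz, Matrix.mul_assoc]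

/-- The trivial subbundle `W × P^1 ⊆ E` is preserved by the Higgs field. -/
def Invariant (B : ParabolicHiggs r n p) (W : Submodule ℂ (Fin r → ℂ)) : Prop :=
  ∀ z : ℂ, z ∉ Set.range p → ∀ v ∈ W, B.form z *ᵥ v ∈ W

open Classical in
/-- The parabolic weight of `W × P^1`: the sum of the weights `α_i` over the `i` with `L_i ⊆ W`. -/
def weight (B : ParabolicHiggs r n p) (α : Fin n → ℝ) (W : Submodule ℂ (Fin r → ℂ)) : ℝ :=
  ∑ i, if (B.line i).submodule ≤ W then α i else 0

/-- `α`-polystability. Every Higgs-invariant trivial subbundle `W × P^1` satisfies the slope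
inequality `weight(W) / dim W ≤ (∑ α_i) / r` (with denominators cleared), and if equality holds
then `W × P^1` has a complement that is compatible with the Higgs field and with the lines. -/
def Polystable (B : ParabolicHiggs r n p) (α : Fin n → ℝ) : Prop :=
  ∀ W : Submodule ℂ (Fin r → ℂ), B.Invariant W →
    (r : ℝ) * B.weight α W ≤ (Module.finrank ℂ W : ℝ) * ∑ i, α i ∧
    ((r : ℝ) * B.weight α W = (Module.finrank ℂ W : ℝ) * ∑ i, α i →
      ∃ W' : Submodule ℂ (Fin r → ℂ), IsCompl W W' ∧ B.Invariant W' ∧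
        ∀ i, (B.line i).submodule ≤ W ∨ (B.line i).submodule ≤ W')

end ParabolicHiggs

/-- The usual topology of the projective space of `ℂ^r`, the quotient topology. -/
instance projTopology (r : ℕ) : TopologicalSpace (ℙ ℂ (Fin r → ℂ)) :=
  TopologicalSpace.coinduced
    (fun v : {v : Fin r → ℂ // v ≠ 0} => Projectivization.mk ℂ v.1 v.2) inferInstance

/-- The topology of the space of parabolic Higgs bundles on `ℂ^r × P^1`: that of the lines in
`(P^{r-1})^n` and of pointwise convergence for the Higgs field (the usual topology on the
finite-dimensional space of sections of `End(E) ⊗ K(D)`). -/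
instance parabolicHiggsTopology (r n : ℕ) (p : Fin n → ℂ) :
    TopologicalSpace (ParabolicHiggs r n p) :=
  TopologicalSpace.induced (fun B => (B.line, B.form)) inferInstance

/-- Isomorphism of `α`-polystable parabolic Higgs bundles. -/
instance higgsSetoid (r n : ℕ) (α : Fin n → ℝ) (p : Fin n → ℂ) :
    Setoid {B : ParabolicHiggs r n p // B.Polystable α} where
  r B B' := B.1.Iso B'.1
  iseqv := ⟨fun B => ParabolicHiggs.Iso.refl B.1, ParabolicHiggs.Iso.symm,
    ParabolicHiggs.Iso.trans⟩

/-- The moduli space of `α`-polystable minimal parabolic Higgs bundles on the projective line with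
trivial underlying bundle of rank `r`: isomorphism classes, with the quotient topology. -/
abbrev HiggsModuli (r n : ℕ) (α : Fin n → ℝ) (p : Fin n → ℂ) : Type :=
  Quotient (higgsSetoid r n α p)

end

set_option linter.unusedSectionVars false

universe u

-- The bridge between the two sides is linear algebra together with Liouville's theorem. A Higgs
-- field with simple poles on the trivial bundle is determined by its residues, and holomorphy at
-- infinity says that these sum to zero (`eq_polarSum`). Since the residue at `p_i` has image in
-- `L_i` and kills `L_i`, it equals `x_i y_i` with `x_i` spanning `L_i` and `y_i x_i = 0`; it is
-- therefore zero or conjugate to an elementary matrix off the diagonal, which gives the statement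
-- on the minimal nilpotent orbit. The pair `(x_i, y_i)` is unique up to `(t_i⁻¹ x_i, t_i y_i)`, and
-- bundle isomorphisms are constant matrices. So isomorphism classes are orbits of `GL_r × (ℂ^*)^n`
-- on the zeros of the complex moment map with all `x_i` nonzero (`iso_iff`), and polystability
-- becomes polystability of a representation of the doubled star quiver with slope constant `c = (∑
-- α_i) / r` (`polystable_iff`).
--
-- What remains is a Kempf–Ness theorem for this quiver: an orbit is polystable exactly when it
-- meets the level set of the real moment map, and then in a single orbit of the unitary group. That
-- balanced points are polystable follows on tracing the central equation against an orthogonal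
-- projection (`IsBalanced.starPolystable`). For the converse, the Hilbert–Mumford criterion makes
-- the Kempf–Ness function of a stable point proper modulo scalars, and its minimum is balanced
-- (`MatrixStable.exists_balanced`); polystable points are handled by splitting off summands
-- (`StarPolystable.exists_balancedBasis`).
--
-- Uniqueness and continuity of the inverse map have one common source, `IsBalanced.tendsto_scale`:
-- convexity of the Kempf–Ness function bounds the distance between the moduli of the entries of two
-- balanced points by a quantity that does not involve the group element relating them, so that this
-- element may diverge. With the Cartan decomposition and compactness of the unitary group this
-- becomes `IsBalanced.exists_tendsto_unitary`. A constant family gives uniqueness; a family read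
-- off in a chart of the space of Higgs bundles gives continuity.

noncomputable section

-- Convexity estimates on real torus orbits.

section Balanced

variable {κ ι : Type*} [Fintype κ] [Fintype ι] [DecidableEq κ] [DecidableEq ι]

/-- The real moment map equations for a representation of the doubled star quiver, with central
value `c` at the central vertex and values `α` at the legs. -/
structure IsBalanced (c : ℝ) (α : ι → ℝ) (x : Matrix κ ι ℂ) (y : Matrix ι κ ℂ) : Prop where
  center : x * xᴴ - yᴴ * y = (c : ℂ) • (1 : Matrix κ κ ℂ)
  leg : ∀ i, ∑ a, ‖x a i‖ ^ 2 - ∑ a, ‖y i a‖ ^ 2 = α i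

/-- The action of the real torus on the arrows out of the legs. -/
def scaleIn (l : κ → ℝ) (t : ι → ℝ) (x : Matrix κ ι ℂ) : Matrix κ ι ℂ :=
  Matrix.of fun a i => (Real.exp (l a - t i) : ℂ) * x a i

/-- The action of the real torus on the arrows into the legs. -/
def scaleOut (l : κ → ℝ) (t : ι → ℝ) (y : Matrix ι κ ℂ) : Matrix ι κ ℂ :=
  Matrix.of fun i a => (Real.exp (-(l a - t i)) : ℂ) * y i a

lemma norm_scaleIn (l : κ → ℝ) (t : ι → ℝ) (x : Matrix κ ι ℂ) (a : κ) (i : ι) :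
    ‖scaleIn l t x a i‖ = Real.exp (l a - t i) * ‖x a i‖ := by
  simp only [scaleIn, Matrix.of_apply, norm_mul, Complex.norm_real, Real.norm_eq_abs, Real.abs_exp]

lemma norm_scaleOut (l : κ → ℝ) (t : ι → ℝ) (y : Matrix ι κ ℂ) (a : κ) (i : ι) :
    ‖scaleOut l t y i a‖ = Real.exp (-(l a - t i)) * ‖y i a‖ := by
  simp only [scaleOut, Matrix.of_apply, norm_mul, Complex.norm_real, Real.norm_eq_abs, Real.abs_exp]

lemma mul_conjTranspose_diag {κ ι : Type*} [Fintype ι] (x : Matrix κ ι ℂ) (a : κ) :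
    (x * xᴴ) a a = ((∑ i, ‖x a i‖ ^ 2 : ℝ) : ℂ) := by
  simp [Matrix.mul_apply, Complex.mul_conj, Complex.normSq_eq_norm_sq]

lemma conjTranspose_mul_diag {κ ι : Type*} [Fintype ι] (y : Matrix ι κ ℂ) (a : κ) :
    (yᴴ * y) a a = ((∑ i, ‖y i a‖ ^ 2 : ℝ) : ℂ) := by
  simp [Matrix.mul_apply, Complex.conj_mul']

lemma IsBalanced.center_diag {c : ℝ} {α : ι → ℝ} {x : Matrix κ ι ℂ} {y : Matrix ι κ ℂ}
    (h : IsBalanced c α x y) (a : κ) : ∑ i, ‖x a i‖ ^ 2 - ∑ i, ‖y i a‖ ^ 2 = c := by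
  have := congrFun (congrFun h.center a) a
  rw [Matrix.sub_apply, mul_conjTranspose_diag, conjTranspose_mul_diag] at this
  simp only [Matrix.smul_apply, Matrix.one_apply_eq, smul_eq_mul, mul_one] at this
  exact_mod_cast this

/-- This is the moment map paired with a direction `(l, t)` of the real torus. The right-hand side
depends only on the level and the direction, so it is the same for all balanced points. -/
lemma IsBalanced.pairing {c : ℝ} {α : ι → ℝ} {x : Matrix κ ι ℂ} {y : Matrix ι κ ℂ}
    (h : IsBalanced c α x y) (l : κ → ℝ) (t : ι → ℝ) :
    ∑ a, ∑ i, (l a - t i) * (‖x a i‖ ^ 2 - ‖y i a‖ ^ 2) = c * ∑ a, l a - ∑ i, α i * t i := by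
  have h1 : ∀ a, ∑ i, l a * (‖x a i‖ ^ 2 - ‖y i a‖ ^ 2) = l a * c := fun a => by
    rw [← Finset.mul_sum, Finset.sum_sub_distrib, h.center_diag]
  have h2 : ∀ i, ∑ a, t i * (‖x a i‖ ^ 2 - ‖y i a‖ ^ 2) = t i * α i := fun i => by
    rw [← Finset.mul_sum, Finset.sum_sub_distrib, h.leg]
  simp only [sub_mul, Finset.sum_sub_distrib]
  simp only [h1]
  rw [Finset.sum_comm (f := fun a i => t i * (‖x a i‖ ^ 2 - ‖y i a‖ ^ 2))]
  simp only [h2]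
  rw [← Finset.sum_mul, mul_comm]
  simp only [mul_comm]

/-- With `p = exp d * P` the right-hand side is `p² - Q² - 2 Q² log (p / Q)`, and `log u ≤ u - 1` at
`u = p / Q` bounds it below by `(p - Q)²`. It is written so that the last bracket is free of `d`. -/
lemma sq_sub_le_kempfNess {P Q : ℝ} (hQ : 0 ≤ Q) (hPQ : 0 < P ∨ Q = 0) (d : ℝ) :
    (Real.exp d * P - Q) ^ 2 ≤ (Real.exp d * P) ^ 2 - 2 * d * Q ^ 2 - P ^ 2 +
      (P ^ 2 - Q ^ 2 - 2 * Q ^ 2 * Real.log (P / Q)) := by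
  rcases hQ.eq_or_lt with rfl | hQ'
  · simp
  have hP : 0 < P := hPQ.resolve_right hQ'.ne'
  have h1 := Real.log_le_sub_one_of_pos (x := Real.exp d * P / Q) (by positivity)
  rw [mul_div_assoc, Real.log_mul (Real.exp_ne_zero _) (by positivity), Real.log_exp] at h1
  have h2 := mul_le_mul_of_nonneg_left h1 (show 0 ≤ 2 * Q ^ 2 by positivity)
  have h3 : 2 * Q ^ 2 * (Real.exp d * (P / Q) - 1) = 2 * Q * (Real.exp d * P) - 2 * Q ^ 2 := by
    field_simp
  rw [h3] at h2
  nlinarith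

/-- The `d`-free bracket of `sq_sub_le_kempfNess` is negligible near the limit; for `Q = 0` the
logarithm has coefficient zero, so its singularity is harmless. -/
lemma tendsto_kempfNess_error {X : Type*} {F : Filter X} {f : X → ℝ} {Q : ℝ}
    (hf : Tendsto f F (𝓝 Q)) :
    Tendsto (fun b => f b ^ 2 - Q ^ 2 - 2 * Q ^ 2 * Real.log (f b / Q)) F (𝓝 0) := by
  rcases eq_or_ne Q 0 with rfl | hQ
  · simpa using hf.pow 2
  have h1 : Tendsto (fun b => Real.log (f b / Q)) F (𝓝 0) := by
    have := (hf.div_const Q).log (by rw [div_self hQ]; exact one_ne_zero)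
    rwa [div_self hQ, Real.log_one] at this
  have h2 := ((hf.pow 2).sub_const (Q ^ 2)).sub (h1.const_mul (2 * Q ^ 2))
  rwa [sub_self, mul_zero, sub_zero] at h2

/-- The Kempf–Ness inequality: balanced points minimise the Kempf–Ness function on torus orbits. -/
lemma IsBalanced.scale_excess_nonpos {c : ℝ} {α : ι → ℝ} {x₀ x : Matrix κ ι ℂ}
    {y₀ y : Matrix ι κ ℂ} (h₀ : IsBalanced c α x₀ y₀) {l : κ → ℝ} {t : ι → ℝ}
    (h : IsBalanced c α (scaleIn l t x) (scaleOut l t y)) :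
    ∑ a, ∑ i, (((Real.exp (l a - t i) * ‖x a i‖) ^ 2 - 2 * (l a - t i) * ‖x₀ a i‖ ^ 2
        - ‖x a i‖ ^ 2) + ((Real.exp (-(l a - t i)) * ‖y i a‖) ^ 2
        - 2 * (-(l a - t i)) * ‖y₀ i a‖ ^ 2 - ‖y i a‖ ^ 2)) ≤ 0 := by
  have h1 := h₀.pairing l t
  have h2 := h.pairing l t
  simp only [norm_scaleIn, norm_scaleOut] at h2
  -- Convexity of `s ↦ exp (2 s d) P²`: its increment over `[0, 1]` is at most the slope at the
  -- endpoint `1`.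
  have key : ∀ d P : ℝ, (Real.exp d * P) ^ 2 - P ^ 2 ≤ 2 * d * (Real.exp d * P) ^ 2 := fun d P => by
    have h3 := Real.add_one_le_exp (-(2 * d))
    have h4 : P ^ 2 = Real.exp (-(2 * d)) * (Real.exp d * P) ^ 2 := by
      rw [mul_pow, ← mul_assoc, ← Real.exp_nat_mul, ← Real.exp_add]
      push_cast
      rw [neg_add_cancel, Real.exp_zero, one_mul]
    rw [h4]
    nlinarith [sq_nonneg (Real.exp d * P)]
  calc _ ≤ ∑ a, ∑ i, (2 * ((l a - t i) * ((Real.exp (l a - t i) * ‖x a i‖) ^ 2 -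
            (Real.exp (-(l a - t i)) * ‖y i a‖) ^ 2)) -
            2 * ((l a - t i) * (‖x₀ a i‖ ^ 2 - ‖y₀ i a‖ ^ 2))) := by
        refine Finset.sum_le_sum fun a _ => Finset.sum_le_sum fun i _ => ?_
        have h3 := key (l a - t i) ‖x a i‖
        have h4 := key (-(l a - t i)) ‖y i a‖
        linarith
    _ = 0 := by
        -- Both endpoint slopes are pairings of balanced points of the same level with the same
        -- direction, so they cancel.
        simp only [Finset.sum_sub_distrib, ← Finset.mul_sum]
        rw [h1, h2, sub_self]

/-- Positive factors leave arguments unchanged, so only moduli need control: for `z ≠ 0` the factors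
tend to one, and for `z = 0` the modulus is all there is. -/
lemma tendsto_of_norm_of_pos_smul {X : Type*} {F : Filter X} {f : X → ℂ} {z : ℂ} {e : X → ℝ}
    (hf : Tendsto f F (𝓝 z)) (he : ∀ b, 0 < e b) (hn : Tendsto (fun b => e b * ‖f b‖) F (𝓝 ‖z‖)) :
    Tendsto (fun b => (e b : ℂ) * f b) F (𝓝 z) := by
  rcases eq_or_ne z 0 with rfl | hz
  · rw [norm_zero] at hn
    rw [tendsto_zero_iff_norm_tendsto_zero]
    refine hn.congr fun b => ?_
    rw [norm_mul, Complex.norm_real, Real.norm_of_nonneg (he b).le]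
  · have h1 : Tendsto e F (𝓝 1) := by
      have h2 := hn.div hf.norm (norm_ne_zero_iff.2 hz)
      rw [div_self (norm_ne_zero_iff.2 hz)] at h2
      refine h2.congr' ?_
      filter_upwards [hf.eventually_ne hz] with b hb
      exact mul_div_cancel_right₀ _ (norm_ne_zero_iff.2 hb)
    have h3 := ((Complex.continuous_ofReal.tendsto 1).comp h1).mul hf
    simpa using h3

lemma single_le_sum_sum {f : κ → ι → ℝ} (hf : ∀ a i, 0 ≤ f a i) (a : κ) (i : ι) :
    f a i ≤ ∑ a, ∑ i, f a i :=
  (Finset.single_le_sum (fun i _ => hf a i) (Finset.mem_univ i)).trans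
    (Finset.single_le_sum (f := fun a => ∑ i, f a i)
      (fun a _ => Finset.sum_nonneg fun i _ => hf a i) (Finset.mem_univ a))

/-- Balanced points on nearby torus orbits are near. -/
theorem IsBalanced.tendsto_scale {X : Type*} {F : Filter X} {c : ℝ} {α : ι → ℝ} {x₀ : Matrix κ ι ℂ}
    {y₀ : Matrix ι κ ℂ} (h₀ : IsBalanced c α x₀ y₀) {x : X → Matrix κ ι ℂ} {y : X → Matrix ι κ ℂ}
    (hx : Tendsto x F (𝓝 x₀)) (hy : Tendsto y F (𝓝 y₀)) {l : X → κ → ℝ} {t : X → ι → ℝ}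
    (h : ∀ᶠ b in F, IsBalanced c α (scaleIn (l b) (t b) (x b)) (scaleOut (l b) (t b) (y b))) :
    Tendsto (fun b => scaleIn (l b) (t b) (x b)) F (𝓝 x₀) ∧
      Tendsto (fun b => scaleOut (l b) (t b) (y b)) F (𝓝 y₀) := by
  have hx' : ∀ a i, Tendsto (fun b => x b a i) F (𝓝 (x₀ a i)) := fun a i =>
    tendsto_pi_nhds.1 (tendsto_pi_nhds.1 hx a) i
  have hy' : ∀ a i, Tendsto (fun b => y b i a) F (𝓝 (y₀ i a)) := fun a i =>
    tendsto_pi_nhds.1 (tendsto_pi_nhds.1 hy i) a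
  -- This error sees only the convergent family `(x b, y b)`, not the torus elements `(l b, t b)`,
  -- for which no bound is available.
  set E : X → ℝ := fun b => ∑ a, ∑ i,
    ((‖x b a i‖ ^ 2 - ‖x₀ a i‖ ^ 2 - 2 * ‖x₀ a i‖ ^ 2 * Real.log (‖x b a i‖ / ‖x₀ a i‖)) +
     (‖y b i a‖ ^ 2 - ‖y₀ i a‖ ^ 2 - 2 * ‖y₀ i a‖ ^ 2 * Real.log (‖y b i a‖ / ‖y₀ i a‖))) with hE
  have hE0 : Tendsto E F (𝓝 0) := by
    have := tendsto_finsetSum (f := fun a b => ∑ i,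
      ((‖x b a i‖ ^ 2 - ‖x₀ a i‖ ^ 2 - 2 * ‖x₀ a i‖ ^ 2 * Real.log (‖x b a i‖ / ‖x₀ a i‖)) +
      (‖y b i a‖ ^ 2 - ‖y₀ i a‖ ^ 2 - 2 * ‖y₀ i a‖ ^ 2 * Real.log (‖y b i a‖ / ‖y₀ i a‖))))
      (a := fun _ => (0 : ℝ)) (x := F) Finset.univ fun a _ => by
        have := tendsto_finsetSum (f := fun i b =>
          ((‖x b a i‖ ^ 2 - ‖x₀ a i‖ ^ 2 - 2 * ‖x₀ a i‖ ^ 2 * Real.log (‖x b a i‖ / ‖x₀ a i‖)) +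
          (‖y b i a‖ ^ 2 - ‖y₀ i a‖ ^ 2 - 2 * ‖y₀ i a‖ ^ 2 * Real.log (‖y b i a‖ / ‖y₀ i a‖))))
          (a := fun _ => (0 : ℝ)) (x := F) Finset.univ fun i _ => by
            simpa using (tendsto_kempfNess_error (hx' a i).norm).add
              (tendsto_kempfNess_error (hy' a i).norm)
        simpa using this
    simpa using this
  have hpos : ∀ {f : X → ℂ} {z : ℂ}, Tendsto f F (𝓝 z) → ∀ᶠ b in F, 0 < ‖f b‖ ∨ ‖z‖ = 0 := by
    intro f z hf
    rcases eq_or_ne z 0 with rfl | hz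
    · exact Eventually.of_forall fun _ => Or.inr norm_zero
    · filter_upwards [hf.eventually_ne hz] with b hb using Or.inl (norm_pos_iff.2 hb)
  have hev : ∀ᶠ b in F, ∀ a i, (0 < ‖x b a i‖ ∨ ‖x₀ a i‖ = 0) ∧ (0 < ‖y b i a‖ ∨ ‖y₀ i a‖ = 0) := by
    simp only [eventually_all, eventually_and]
    exact fun a i => ⟨hpos (hx' a i), hpos (hy' a i)⟩
  have hbound : ∀ᶠ b in F, ∑ a, ∑ i,
      ((Real.exp (l b a - t b i) * ‖x b a i‖ - ‖x₀ a i‖) ^ 2 +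
       (Real.exp (-(l b a - t b i)) * ‖y b i a‖ - ‖y₀ i a‖) ^ 2) ≤ E b := by
    filter_upwards [hev, h] with b hb hbal
    refine le_trans ?_ (add_le_of_nonpos_left (h₀.scale_excess_nonpos hbal))
    rw [hE]
    simp only [← Finset.sum_add_distrib]
    refine Finset.sum_le_sum fun a _ => Finset.sum_le_sum fun i _ => ?_
    have h1 := sq_sub_le_kempfNess (norm_nonneg _) (hb a i).1 (l b a - t b i)
    have h2 := sq_sub_le_kempfNess (norm_nonneg _) (hb a i).2 (-(l b a - t b i))
    linarith
  have hterm : ∀ a i, Tendsto (fun b =>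
      (Real.exp (l b a - t b i) * ‖x b a i‖ - ‖x₀ a i‖) ^ 2 +
       (Real.exp (-(l b a - t b i)) * ‖y b i a‖ - ‖y₀ i a‖) ^ 2) F (𝓝 0) := fun a i => by
    refine tendsto_of_tendsto_of_tendsto_of_le_of_le' tendsto_const_nhds hE0
      (Eventually.of_forall fun b => by positivity) ?_
    filter_upwards [hbound] with b hb
    exact (single_le_sum_sum (f := fun a i =>
      (Real.exp (l b a - t b i) * ‖x b a i‖ - ‖x₀ a i‖) ^ 2 +
        (Real.exp (-(l b a - t b i)) * ‖y b i a‖ - ‖y₀ i a‖) ^ 2)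
      (fun a i => by positivity) a i).trans hb
  have hsq : ∀ {f g : X → ℝ} {q : ℝ}, Tendsto (fun b => (f b - q) ^ 2 + g b ^ 2) F (𝓝 0) →
      Tendsto f F (𝓝 q) := by
    intro f g q hfg
    have h1 : Tendsto (fun b => (f b - q) ^ 2) F (𝓝 0) :=
      squeeze_zero (fun b => sq_nonneg _) (fun b => le_add_of_nonneg_right (sq_nonneg _)) hfg
    have h2 := h1.sqrt
    simp only [Real.sqrt_sq_eq_abs, Real.sqrt_zero] at h2
    exact tendsto_sub_nhds_zero_iff.1 ((tendsto_zero_iff_abs_tendsto_zero _).2 h2)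
  refine ⟨tendsto_pi_nhds.2 fun a => tendsto_pi_nhds.2 fun i => ?_,
    tendsto_pi_nhds.2 fun i => tendsto_pi_nhds.2 fun a => ?_⟩
  · exact tendsto_of_norm_of_pos_smul (hx' a i) (fun b => Real.exp_pos _) (hsq (hterm a i))
  · exact tendsto_of_norm_of_pos_smul (hy' a i) (fun b => Real.exp_pos _)
      (hsq ((hterm a i).congr fun b => add_comm _ _))

end Balanced

-- Cartan decomposition, and uniqueness of balanced points in complex orbits.

section Polar

variable {κ ι : Type*} [Fintype κ] [Fintype ι] [DecidableEq κ] [DecidableEq ι]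

lemma exists_unitary_diagonal {M : Matrix κ κ ℂ} (hM : M.IsHermitian) :
    ∃ k ∈ Matrix.unitaryGroup κ ℂ, ∃ d : κ → ℝ,
      M = kᴴ * Matrix.diagonal (fun a => (d a : ℂ)) * k := by
  refine ⟨star (hM.eigenvectorUnitary : Matrix κ κ ℂ), ?_, hM.eigenvalues, ?_⟩
  · exact Unitary.star_mem hM.eigenvectorUnitary.2
  · conv_lhs => rw [hM.spectral_theorem, Unitary.conjStarAlgAut_apply]
    rw [Matrix.star_eq_conjTranspose, Matrix.conjTranspose_conjTranspose]
    rfl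

open scoped ComplexOrder in
/-- The Cartan decomposition of `GL`. -/
lemma exists_cartan {g h : Matrix κ κ ℂ} (hgh : g * h = 1) :
    ∃ k ∈ Matrix.unitaryGroup κ ℂ, ∃ u ∈ Matrix.unitaryGroup κ ℂ, ∃ l : κ → ℝ,
      g = k * Matrix.diagonal (fun a => (Real.exp (l a) : ℂ)) * u ∧
      h = uᴴ * Matrix.diagonal (fun a => (Real.exp (-l a) : ℂ)) * kᴴ := by
  have hhg : h * g = 1 := mul_eq_one_comm.1 hgh
  have hinj : Function.Injective g.mulVec := fun v w hvw => by
    have := congrArg h.mulVec hvw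
    simpa [Matrix.mulVec_mulVec, hhg] using this
  have hpos : (gᴴ * g).PosDef := Matrix.PosDef.conjTranspose_mul_self g hinj
  obtain ⟨u, hu, d, hd⟩ : ∃ u ∈ Matrix.unitaryGroup κ ℂ, ∃ d : κ → ℝ, (∀ a, 0 < d a) ∧
      gᴴ * g = uᴴ * Matrix.diagonal (fun a => (d a : ℂ)) * u := by
    refine ⟨star (hpos.1.eigenvectorUnitary : Matrix κ κ ℂ), ?_, hpos.1.eigenvalues,
      fun a => hpos.eigenvalues_pos a, ?_⟩
    · exact Unitary.star_mem hpos.1.eigenvectorUnitary.2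
    · conv_lhs => rw [hpos.1.spectral_theorem, Unitary.conjStarAlgAut_apply]
      rw [Matrix.star_eq_conjTranspose, Matrix.conjTranspose_conjTranspose]
      rfl
  obtain ⟨hd0, hd⟩ := hd
  have huu : u * uᴴ = 1 := Matrix.mem_unitaryGroup_iff.1 hu
  have huu' : uᴴ * u = 1 := Matrix.mem_unitaryGroup_iff'.1 hu
  -- The `d a` are eigenvalues of `gᴴ g`, hence squares of singular values; halving the logarithm
  -- makes `exp (l a)` the singular value itself.
  set l : κ → ℝ := fun a => Real.log (d a) / 2 with hl
  set D := Matrix.diagonal (fun a => (Real.exp (l a) : ℂ)) with hD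
  set D' := Matrix.diagonal (fun a => (Real.exp (-l a) : ℂ)) with hD'
  have hDD' : D * D' = 1 := by
    rw [hD, hD', Matrix.diagonal_mul_diagonal, ← Matrix.diagonal_one]
    congr 1; funext a
    rw [← Complex.ofReal_mul, ← Real.exp_add, add_neg_cancel, Real.exp_zero, Complex.ofReal_one]
  have hD'D : D' * D = 1 := mul_eq_one_comm.1 hDD'
  have hDsq : Matrix.diagonal (fun a => (d a : ℂ)) = D * D := by
    rw [hD, Matrix.diagonal_mul_diagonal]
    congr 1; funext a
    rw [← Complex.ofReal_mul, ← Real.exp_add, hl, add_halves, Real.exp_log (hd0 a)]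
  have hD'star : D'ᴴ = D' := by
    rw [hD', Matrix.diagonal_conjTranspose]
    congr 1; funext a
    exact Complex.conj_ofReal _
  have hk : (g * uᴴ * D')ᴴ * (g * uᴴ * D') = 1 := by
    calc (g * uᴴ * D')ᴴ * (g * uᴴ * D') = D' * u * (gᴴ * g) * uᴴ * D' := by
          simp only [Matrix.conjTranspose_mul, Matrix.conjTranspose_conjTranspose, hD'star,
            Matrix.mul_assoc]
      _ = D' * (u * uᴴ) * D * D * (u * uᴴ) * D' := by
          rw [hd, hDsq]; simp only [Matrix.mul_assoc]
      _ = (D' * D) * (D * D') := by rw [huu]; simp only [Matrix.mul_one, Matrix.mul_assoc]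
      _ = 1 := by rw [hDD', hD'D, Matrix.mul_one]
  have hg : g = g * uᴴ * D' * D * u := by
    rw [Matrix.mul_assoc _ D' D, hD'D, Matrix.mul_one, Matrix.mul_assoc, huu', Matrix.mul_one]
  refine ⟨g * uᴴ * D', Matrix.mem_unitaryGroup_iff'.2 hk, u, hu, l, hg, ?_⟩
  have h1 : g * (uᴴ * D' * (g * uᴴ * D')ᴴ) = 1 := by
    rw [← Matrix.mul_assoc, ← Matrix.mul_assoc]
    exact mul_eq_one_comm.1 hk
  calc h = h * (g * (uᴴ * D' * (g * uᴴ * D')ᴴ)) := by rw [h1, Matrix.mul_one]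
    _ = _ := by rw [← Matrix.mul_assoc, hhg, Matrix.one_mul]

lemma scaleIn_eq (l : κ → ℝ) (t : ι → ℝ) (x : Matrix κ ι ℂ) :
    scaleIn l t x = Matrix.diagonal (fun a => (Real.exp (l a) : ℂ)) * x *
      Matrix.diagonal (fun i => (Real.exp (-t i) : ℂ)) := by
  ext a i
  rw [Matrix.mul_diagonal, Matrix.diagonal_mul, scaleIn, Matrix.of_apply, sub_eq_add_neg,
    Real.exp_add, Complex.ofReal_mul]
  ring

lemma scaleOut_eq (l : κ → ℝ) (t : ι → ℝ) (y : Matrix ι κ ℂ) :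
    scaleOut l t y = Matrix.diagonal (fun i => (Real.exp (t i) : ℂ)) * y *
      Matrix.diagonal (fun a => (Real.exp (-l a) : ℂ)) := by
  ext a i
  rw [Matrix.mul_diagonal, Matrix.diagonal_mul, scaleOut, Matrix.of_apply, neg_sub, sub_eq_add_neg,
    Real.exp_add, Complex.ofReal_mul]
  ring

/-- Two representations of the doubled star quiver lie in the same orbit of the complex group. -/
def ComplexEquiv (x : Matrix κ ι ℂ) (y : Matrix ι κ ℂ) (x' : Matrix κ ι ℂ) (y' : Matrix ι κ ℂ) :
    Prop :=
  ∃ (g h : Matrix κ κ ℂ) (t : ι → ℂ), g * h = 1 ∧ (∀ i, t i ≠ 0) ∧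
    x' = g * x * Matrix.diagonal (fun i => (t i)⁻¹) ∧ y' = Matrix.diagonal t * y * h

lemma ComplexEquiv.symm {x x' : Matrix κ ι ℂ} {y y' : Matrix ι κ ℂ}
    (H : ComplexEquiv x y x' y') : ComplexEquiv x' y' x y := by
  obtain ⟨g, h, t, hgh, ht, rfl, rfl⟩ := H
  have hhg : h * g = 1 := mul_eq_one_comm.1 hgh
  refine ⟨h, g, fun i => (t i)⁻¹, hhg, fun i => inv_ne_zero (ht i), ?_, ?_⟩
  · rw [Matrix.mul_assoc, Matrix.mul_assoc, Matrix.diagonal_mul_diagonal]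
    simp only [inv_inv, inv_mul_cancel₀ (ht _), Matrix.diagonal_one, Matrix.mul_one]
    rw [← Matrix.mul_assoc, hhg, Matrix.one_mul]
  · rw [Matrix.mul_assoc, Matrix.mul_assoc, hhg, Matrix.mul_one, ← Matrix.mul_assoc,
      Matrix.diagonal_mul_diagonal]
    simp only [inv_mul_cancel₀ (ht _), Matrix.diagonal_one, Matrix.one_mul]

lemma ComplexEquiv.trans {x x' x'' : Matrix κ ι ℂ} {y y' y'' : Matrix ι κ ℂ}
    (H : ComplexEquiv x y x' y') (H' : ComplexEquiv x' y' x'' y'') :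
    ComplexEquiv x y x'' y'' := by
  obtain ⟨g, h, t, hgh, ht, rfl, rfl⟩ := H
  obtain ⟨g', h', t', hgh', ht', rfl, rfl⟩ := H'
  refine ⟨g' * g, h * h', fun i => t' i * t i, ?_, fun i => mul_ne_zero (ht' i) (ht i), ?_, ?_⟩
  · rw [Matrix.mul_assoc, ← Matrix.mul_assoc g, hgh, Matrix.one_mul, hgh']
  · have : (Matrix.diagonal fun i => (t' i * t i)⁻¹) =
        Matrix.diagonal (fun i => (t i)⁻¹) * Matrix.diagonal (fun i => (t' i)⁻¹) := by
      rw [Matrix.diagonal_mul_diagonal]; congr 1; funext i; rw [mul_inv, mul_comm]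
    rw [this]
    simp only [Matrix.mul_assoc]
  · rw [← Matrix.diagonal_mul_diagonal]
    simp only [Matrix.mul_assoc]

/-- The central factor is split by the Cartan decomposition and each `t i` into modulus and phase.
Between two unitary elements only a real torus element remains, to which the convexity estimates
apply. -/
lemma ComplexEquiv.exists_cartan {x x' : Matrix κ ι ℂ} {y y' : Matrix ι κ ℂ}
    (H : ComplexEquiv x y x' y') :
    ∃ k ∈ Matrix.unitaryGroup κ ℂ, ∃ u ∈ Matrix.unitaryGroup κ ℂ, ∃ (l : κ → ℝ) (t : ι → ℝ)
      (θ : ι → Circle),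
      x' = k * scaleIn l t (u * x) * Matrix.diagonal (fun i => ((θ i)⁻¹ : ℂ)) ∧
      y' = Matrix.diagonal (fun i => (θ i : ℂ)) * scaleOut l t (y * uᴴ) * kᴴ := by
  obtain ⟨g, h, t, hgh, ht, rfl, rfl⟩ := H
  obtain ⟨k, hk, u, hu, l, hg, hh⟩ := _root_.exists_cartan hgh
  have hn : ∀ i, (‖t i‖ : ℂ) ≠ 0 := fun i => Complex.ofReal_ne_zero.2 (norm_ne_zero_iff.2 (ht i))
  have hexp : ∀ i, Real.exp (Real.log ‖t i‖) = ‖t i‖ := fun i =>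
    Real.exp_log (norm_pos_iff.2 (ht i))
  refine ⟨k, hk, u, hu, l, fun i => Real.log ‖t i‖,
    fun i => ⟨t i / ‖t i‖, ?_⟩, ?_, ?_⟩
  · refine mem_sphere_zero_iff_norm.2 ?_
    rw [norm_div, Complex.norm_real, norm_norm,
      div_self (norm_ne_zero_iff.2 (ht i))]
  · rw [scaleIn_eq, hg]
    have : (Matrix.diagonal fun i => (t i)⁻¹) = Matrix.diagonal
        (fun i => (Real.exp (-Real.log ‖t i‖) : ℂ)) *
        Matrix.diagonal (fun i => (t i / ‖t i‖ : ℂ)⁻¹) := by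
      rw [Matrix.diagonal_mul_diagonal]; congr 1; funext i
      rw [Real.exp_neg, hexp, Complex.ofReal_inv, inv_div, inv_mul_eq_div, div_div_cancel_left' (hn i)]
    rw [this]
    simp only [Matrix.mul_assoc]
  · rw [scaleOut_eq, hh]
    have : (Matrix.diagonal t) = Matrix.diagonal (fun i => (t i / ‖t i‖ : ℂ)) * Matrix.diagonal
        (fun i => (Real.exp (Real.log ‖t i‖) : ℂ)) := by
      rw [Matrix.diagonal_mul_diagonal]; congr 1; funext i
      rw [hexp, div_mul_cancel₀ _ (hn i)]
    rw [this]
    simp only [Matrix.mul_assoc]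

lemma diagonal_circle_mul_inv (θ : ι → Circle) :
    Matrix.diagonal (fun i => (θ i : ℂ)) * Matrix.diagonal (fun i => ((θ i)⁻¹ : ℂ)) = 1 := by
  rw [Matrix.diagonal_mul_diagonal, ← Matrix.diagonal_one]
  congr 1; funext i
  exact mul_inv_cancel₀ (Circle.coe_ne_zero _)

/-- The real moment map is equivariant and its level is central. -/
lemma IsBalanced.unitary {c : ℝ} {α : ι → ℝ} {x : Matrix κ ι ℂ} {y : Matrix ι κ ℂ}
    (h : IsBalanced c α x y) {k : Matrix κ κ ℂ} (hk : k ∈ Matrix.unitaryGroup κ ℂ)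
    (θ : ι → Circle) :
    IsBalanced c α (k * x * Matrix.diagonal (fun i => ((θ i)⁻¹ : ℂ)))
      (Matrix.diagonal (fun i => (θ i : ℂ)) * y * kᴴ) := by
  have hkk : k * kᴴ = 1 := Matrix.mem_unitaryGroup_iff.1 hk
  have hkk' : kᴴ * k = 1 := Matrix.mem_unitaryGroup_iff'.1 hk
  have hs : (Matrix.diagonal (fun i => (θ i : ℂ)))ᴴ = Matrix.diagonal (fun i => ((θ i)⁻¹ : ℂ)) := by
    rw [Matrix.diagonal_conjTranspose]
    congr 1; funext i
    simp [← Circle.coe_inv, Circle.coe_inv_eq_conj]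
  have hs' : (Matrix.diagonal (fun i => ((θ i)⁻¹ : ℂ)))ᴴ = Matrix.diagonal (fun i => (θ i : ℂ)) := by
    rw [← hs, Matrix.conjTranspose_conjTranspose]
  have h1 := diagonal_circle_mul_inv θ
  have h2 := mul_eq_one_comm.1 h1
  refine ⟨?_, fun i => ?_⟩
  · have e1 : k * x * Matrix.diagonal (fun i => ((θ i)⁻¹ : ℂ)) *
        (k * x * Matrix.diagonal (fun i => ((θ i)⁻¹ : ℂ)))ᴴ = k * (x * xᴴ) * kᴴ := by
      rw [Matrix.conjTranspose_mul, hs', ← Matrix.mul_assoc, Matrix.mul_assoc (k * x), h2,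
        Matrix.mul_one, Matrix.conjTranspose_mul]
      simp only [Matrix.mul_assoc]
    have e2 : (Matrix.diagonal (fun i => (θ i : ℂ)) * y * kᴴ)ᴴ *
        (Matrix.diagonal (fun i => (θ i : ℂ)) * y * kᴴ) = k * (yᴴ * y) * kᴴ := by
      rw [Matrix.conjTranspose_mul, Matrix.conjTranspose_mul, hs, Matrix.conjTranspose_conjTranspose,
        Matrix.mul_assoc, Matrix.mul_assoc yᴴ, Matrix.mul_assoc _ y, ← Matrix.mul_assoc _ _ (y * kᴴ),
        h2, Matrix.one_mul]
      simp only [Matrix.mul_assoc]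
    rw [e1, e2, ← Matrix.sub_mul, ← Matrix.mul_sub, h.center, Matrix.mul_smul, Matrix.mul_one,
      Matrix.smul_mul, hkk]
  · have e1 : ∑ a, ‖(k * x * Matrix.diagonal (fun i => ((θ i)⁻¹ : ℂ))) a i‖ ^ 2 =
        ∑ a, ‖x a i‖ ^ 2 := by
      have : (k * x)ᴴ * (k * x) = xᴴ * x := by
        rw [Matrix.conjTranspose_mul, Matrix.mul_assoc, ← Matrix.mul_assoc kᴴ, hkk', Matrix.one_mul]
      have := congrFun (congrFun this i) i
      rw [conjTranspose_mul_diag, conjTranspose_mul_diag] at this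
      rw [← Complex.ofReal_injective this]
      refine Finset.sum_congr rfl fun a _ => ?_
      rw [Matrix.mul_diagonal, norm_mul, norm_inv, Circle.norm_coe, inv_one, mul_one]
    have e2 : ∑ a, ‖(Matrix.diagonal (fun i => (θ i : ℂ)) * y * kᴴ) i a‖ ^ 2 =
        ∑ a, ‖y i a‖ ^ 2 := by
      have : (y * kᴴ) * (y * kᴴ)ᴴ = y * yᴴ := by
        rw [Matrix.conjTranspose_mul, Matrix.conjTranspose_conjTranspose, Matrix.mul_assoc,
          ← Matrix.mul_assoc kᴴ, hkk', Matrix.one_mul]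
      have := congrFun (congrFun this i) i
      rw [mul_conjTranspose_diag, mul_conjTranspose_diag] at this
      rw [← Complex.ofReal_injective this]
      refine Finset.sum_congr rfl fun a _ => ?_
      rw [Matrix.mul_assoc, Matrix.diagonal_mul, norm_mul, Circle.norm_coe, one_mul]
    rw [e1, e2, h.leg]

lemma isCompact_unitaryGroup : IsCompact {u : Matrix κ κ ℂ | u ∈ Matrix.unitaryGroup κ ℂ} := by
  have h1 : IsCompact (Set.univ.pi fun _ : κ => Set.univ.pi fun _ : κ =>
      Metric.closedBall (0 : ℂ) 1) :=
    isCompact_univ_pi fun _ => isCompact_univ_pi fun _ => isCompact_closedBall _ _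
  refine h1.of_isClosed_subset ?_ ?_
  · simp only [Matrix.mem_unitaryGroup_iff]
    exact isClosed_eq (continuous_id.matrix_mul continuous_star) continuous_const
  · intro u hu a _ b _
    rw [mem_closedBall_zero_iff]
    exact entry_norm_bound_of_unitary hu a b

lemma tendsto_matrix_mul {X m n p : Type*} [Fintype n] {F : Filter X} {f : X → Matrix m n ℂ}
    {g : X → Matrix n p ℂ} {A : Matrix m n ℂ} {B : Matrix n p ℂ} (hf : Tendsto f F (𝓝 A))
    (hg : Tendsto g F (𝓝 B)) : Tendsto (fun b => f b * g b) F (𝓝 (A * B)) :=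
  tendsto_pi_nhds.2 fun a => tendsto_pi_nhds.2 fun b => by
    simp only [Matrix.mul_apply]
    exact tendsto_finsetSum _ fun c _ => (tendsto_pi_nhds.1 (tendsto_pi_nhds.1 hf a) c).mul
      (tendsto_pi_nhds.1 (tendsto_pi_nhds.1 hg c) b)

/-- If a family of balanced points is complex equivalent to a family converging to a balanced
point, then unitary translates of the former converge to that point. -/
theorem IsBalanced.exists_tendsto_unitary {X : Type*} (F : Ultrafilter X) {c : ℝ} {α : ι → ℝ}
    {x₀ : Matrix κ ι ℂ} {y₀ : Matrix ι κ ℂ} (h₀ : IsBalanced c α x₀ y₀)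
    {x x' : X → Matrix κ ι ℂ} {y y' : X → Matrix ι κ ℂ} (hx : Tendsto x F (𝓝 x₀))
    (hy : Tendsto y F (𝓝 y₀)) (hb : ∀ b, IsBalanced c α (x' b) (y' b))
    (he : ∀ᶠ b in F, ComplexEquiv (x b) (y b) (x' b) (y' b)) :
    ∃ (k : X → Matrix κ κ ℂ) (θ : X → ι → Circle), (∀ b, k b ∈ Matrix.unitaryGroup κ ℂ) ∧
      Tendsto (fun b => k b * x' b * Matrix.diagonal (fun i => ((θ b i)⁻¹ : ℂ))) F (𝓝 x₀) ∧
      Tendsto (fun b => Matrix.diagonal (fun i => (θ b i : ℂ)) * y' b * (k b)ᴴ) F (𝓝 y₀) := by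
  have hch : ∀ b, ∃ (k u : Matrix κ κ ℂ) (l : κ → ℝ) (t : ι → ℝ) (θ : ι → Circle),
      k ∈ Matrix.unitaryGroup κ ℂ ∧ u ∈ Matrix.unitaryGroup κ ℂ ∧
      (ComplexEquiv (x b) (y b) (x' b) (y' b) →
      x' b = k * scaleIn l t (u * x b) * Matrix.diagonal (fun i => ((θ i)⁻¹ : ℂ)) ∧
      y' b = Matrix.diagonal (fun i => (θ i : ℂ)) * scaleOut l t (y b * uᴴ) * kᴴ) := by
    intro b
    by_cases h : ComplexEquiv (x b) (y b) (x' b) (y' b)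
    · obtain ⟨k, hk, u, hu, l, t, θ, h1, h2⟩ := h.exists_cartan
      exact ⟨k, u, l, t, θ, hk, hu, fun _ => ⟨h1, h2⟩⟩
    -- Equivalence holds only eventually; elsewhere trivial data keep the chosen matrices unitary.
    · exact ⟨1, 1, 0, 0, 1, one_mem _, one_mem _, fun h' => absurd h' h⟩
  choose k u l t θ hk hu hku using hch
  -- The inner unitary factors converge along the ultrafilter, so after rotation by them the family
  -- still converges to a balanced point, namely the rotation of `(x₀, y₀)` by `v`, and only the
  -- real torus factor is uncontrolled.
  obtain ⟨v, hv, hlim⟩ := isCompact_unitaryGroup.ultrafilter_le_nhds' (F.map u)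
    (Ultrafilter.mem_map.2 (Filter.univ_mem' hu))
  have hlim : Tendsto u F (𝓝 v) := hlim
  have hlim' : Tendsto (fun b => (u b)ᴴ) F (𝓝 vᴴ) := (continuous_star.tendsto v).comp hlim
  have hv' : vᴴ * v = 1 := Matrix.mem_unitaryGroup_iff'.1 hv
  have h₁ : IsBalanced c α (v * x₀) (y₀ * vᴴ) := by
    simpa using h₀.unitary hv 1
  have hinv : ∀ b, x' b = k b * scaleIn (l b) (t b) (u b * x b) *
        Matrix.diagonal (fun i => ((θ b i)⁻¹ : ℂ)) →
      (k b)ᴴ * x' b * Matrix.diagonal (fun i => (((θ b)⁻¹ i : Circle) : ℂ)⁻¹) =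
        scaleIn (l b) (t b) (u b * x b) := by
    intro b h
    have h1 : (k b)ᴴ * k b = 1 := Matrix.mem_unitaryGroup_iff'.1 (hk b)
    have h2 := mul_eq_one_comm.1 (diagonal_circle_mul_inv (θ b))
    rw [h]
    simp only [Pi.inv_apply, Circle.coe_inv, inv_inv]
    rw [Matrix.mul_assoc (k b), ← Matrix.mul_assoc (k b)ᴴ, h1, Matrix.one_mul, Matrix.mul_assoc, h2,
      Matrix.mul_one]
  have hinv' : ∀ b, y' b = Matrix.diagonal (fun i => (θ b i : ℂ)) *
        scaleOut (l b) (t b) (y b * (u b)ᴴ) * (k b)ᴴ →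
      Matrix.diagonal (fun i => (((θ b)⁻¹ i : Circle) : ℂ)) * y' b * (k b)ᴴᴴ =
        scaleOut (l b) (t b) (y b * (u b)ᴴ) := by
    intro b h
    have h1 : (k b)ᴴ * k b = 1 := Matrix.mem_unitaryGroup_iff'.1 (hk b)
    have h2 := mul_eq_one_comm.1 (diagonal_circle_mul_inv (θ b))
    rw [h, Matrix.conjTranspose_conjTranspose]
    simp only [Pi.inv_apply, Circle.coe_inv]
    rw [Matrix.mul_assoc, Matrix.mul_assoc _ _ (k b), h1, Matrix.mul_one, ← Matrix.mul_assoc, h2,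
      Matrix.one_mul]
  have hsc : ∀ᶠ b in F, IsBalanced c α (scaleIn (l b) (t b) (u b * x b))
      (scaleOut (l b) (t b) (y b * (u b)ᴴ)) := by
    filter_upwards [he] with b hbe
    obtain ⟨e1, e2⟩ := hku b hbe
    rw [← hinv b e1, ← hinv' b e2]
    exact (hb b).unitary (Unitary.star_mem (hk b)) _
  obtain ⟨c1, c2⟩ := h₁.tendsto_scale (tendsto_matrix_mul hlim hx) (tendsto_matrix_mul hy hlim') hsc
  -- Undoing the outer factors `k b` and `θ b` exposes the torus part, which converges to the point
  -- rotated by `v`; undoing `u b` removes `v` in the limit.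
  refine ⟨fun b => (u b)ᴴ * (k b)ᴴ, fun b => (θ b)⁻¹,
    fun b => mul_mem (Unitary.star_mem (hu b)) (Unitary.star_mem (hk b)), ?_, ?_⟩
  · have h1 := tendsto_matrix_mul hlim' c1
    rw [← Matrix.mul_assoc, hv', Matrix.one_mul] at h1
    refine h1.congr' ?_
    filter_upwards [he] with b hbe
    rw [← hinv b (hku b hbe).1]
    simp only [Matrix.mul_assoc]
  · have h1 := tendsto_matrix_mul c2 hlim
    rw [Matrix.mul_assoc, hv', Matrix.mul_one] at h1
    refine h1.congr' ?_
    filter_upwards [he] with b hbe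
    rw [← hinv' b (hku b hbe).2]
    simp only [Matrix.conjTranspose_mul, Matrix.conjTranspose_conjTranspose, Matrix.mul_assoc]

/-- The uniqueness part of the Kempf–Ness theorem. -/
theorem IsBalanced.exists_unitary_of_complexEquiv {c : ℝ} {α : ι → ℝ}
    {x x' : Matrix κ ι ℂ} {y y' : Matrix ι κ ℂ} (h : IsBalanced c α x y)
    (h' : IsBalanced c α x' y') (he : ComplexEquiv x y x' y') :
    ∃ k ∈ Matrix.unitaryGroup κ ℂ, ∃ θ : ι → Circle,
      k * x' * Matrix.diagonal (fun i => ((θ i)⁻¹ : ℂ)) = x ∧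
      Matrix.diagonal (fun i => (θ i : ℂ)) * y' * kᴴ = y := by
  -- Along a principal ultrafilter the convergence of the translates is equality.
  obtain ⟨k, θ, hk, h1, h2⟩ := h.exists_tendsto_unitary (pure () : Ultrafilter Unit)
    (x := fun _ => x) (y := fun _ => y) (x' := fun _ => x') (y' := fun _ => y')
    tendsto_const_nhds tendsto_const_nhds (fun _ => h') (Eventually.of_forall fun _ => he)
  refine ⟨k (), hk (), θ (), ?_, ?_⟩
  · exact tendsto_nhds_unique ((tendsto_pure_nhds _ ()).mono_left le_rfl) h1
  · exact tendsto_nhds_unique ((tendsto_pure_nhds _ ()).mono_left le_rfl) h2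

end Polar

-- The Hilbert–Mumford criterion in coordinates.

section Stable

/-- The sum is the integral over `θ < M` of the partial sums `∑ k j` over `w j ≤ θ`. This is a
right-continuous step function, so nonnegativity passes to the integral, and a zero integral forces
it to vanish. The induction removes an element of largest weight, which is one step of that
function. -/
lemma layerCake_nonneg {J : Type*} [DecidableEq J] (k w : J → ℝ) (s : Finset J) :
    ∀ M, (∀ j ∈ s, w j ≤ M) → (∀ θ < M, 0 ≤ ∑ j ∈ s with w j ≤ θ, k j) →
      0 ≤ ∑ j ∈ s, k j * (M - w j) ∧
      (∑ j ∈ s, k j * (M - w j) = 0 → ∀ θ < M, ∑ j ∈ s with w j ≤ θ, k j = 0) := by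
  induction s using Finset.induction_on_max_value w with
  | empty => simp
  | insert a s ha hmax ih =>
    intro M hM hP
    have hlow : ∀ θ < w a, ∑ j ∈ insert a s with w j ≤ θ, k j = ∑ j ∈ s with w j ≤ θ, k j :=
      fun θ hθ => by rw [Finset.filter_insert, if_neg (not_le.2 hθ)]
    have hhigh : ∀ θ, w a ≤ θ → ∑ j ∈ insert a s with w j ≤ θ, k j = ∑ j ∈ insert a s, k j :=
      fun θ hθ => by
        rw [Finset.filter_true_of_mem]
        intro j hj
        rcases Finset.mem_insert.1 hj with rfl | hj
        · exact hθ
        · exact (hmax j hj).trans hθ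
    have haM : w a ≤ M := hM a (Finset.mem_insert_self _ _)
    obtain ⟨ih1, ih2⟩ := ih (w a) hmax fun θ hθ => by
      rw [← hlow θ hθ]; exact hP θ (hθ.trans_le haM)
    have hsum : ∑ j ∈ insert a s, k j * (M - w j) =
        ∑ j ∈ s, k j * (w a - w j) + (M - w a) * ∑ j ∈ insert a s, k j := by
      rw [Finset.sum_insert ha, Finset.sum_insert ha, mul_add, Finset.mul_sum, add_left_comm,
        ← Finset.sum_add_distrib]
      congr 1
      · ring
      · exact Finset.sum_congr rfl fun j _ => by ring
    rcases haM.eq_or_lt with h | h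
    · rw [hsum, h, sub_self, zero_mul, add_zero, ← h]
      exact ⟨ih1, fun h0 θ hθ => by rw [hlow θ hθ]; exact ih2 h0 θ hθ⟩
    · have h1 : 0 ≤ ∑ j ∈ insert a s, k j := by rw [← hhigh _ le_rfl]; exact hP _ h
      have h2 : 0 ≤ (M - w a) * ∑ j ∈ insert a s, k j := mul_nonneg (sub_nonneg.2 haM) h1
      rw [hsum]
      refine ⟨add_nonneg ih1 h2, fun h0 θ hθ => ?_⟩
      rcases lt_or_ge θ (w a) with hθa | hθa
      · rw [hlow θ hθa]; exact ih2 (by linarith) θ hθa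
      · rw [hhigh θ hθa]
        have h3 : (M - w a) * ∑ j ∈ insert a s, k j = 0 := by linarith
        exact (mul_eq_zero.1 h3).resolve_left (sub_pos.2 h).ne'

variable {κ ι : Type*} [Fintype κ] [Fintype ι] [DecidableEq κ] [DecidableEq ι]

open Classical in
/-- Stability of a representation of the doubled star quiver, in coordinates. -/
def MatrixStable (c : ℝ) (α : ι → ℝ) (x : Matrix κ ι ℂ) (y : Matrix ι κ ℂ) : Prop :=
  ∀ W : Submodule ℂ (κ → ℂ), (∀ i, xᵀ i ∈ W ∨ ∀ v ∈ W, y i ⬝ᵥ v = 0) →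
    (∑ i with xᵀ i ∈ W, α i) ≤ c * Module.finrank ℂ W ∧
    ((∑ i with xᵀ i ∈ W, α i) = c * Module.finrank ℂ W → W = ⊥ ∨ W = ⊤)

/-- The step of the weight filtration attached to a unitary frame and weights. -/
def weightSub (v : Matrix κ κ ℂ) (l : κ → ℝ) (θ : ℝ) : Submodule ℂ (κ → ℂ) :=
  (Submodule.pi {a | θ < l a} fun _ => ⊥).comap v.mulVecLin

lemma mem_weightSub {v : Matrix κ κ ℂ} {l : κ → ℝ} {θ : ℝ} {z : κ → ℂ} :
    z ∈ weightSub v l θ ↔ ∀ a, θ < l a → (v *ᵥ z) a = 0 := by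
  simp [weightSub, Submodule.mem_pi]

/-- In the frame `v`, a vector of this subspace is known from its coordinates of weight at most `θ`.
Only this bound is needed, because `c` is nonnegative. -/
lemma finrank_weightSub_le {v : Matrix κ κ ℂ} (hv : v ∈ Matrix.unitaryGroup κ ℂ) (l : κ → ℝ)
    (θ : ℝ) : Module.finrank ℂ (weightSub v l θ) ≤ (Finset.univ.filter fun a => l a ≤ θ).card := by
  let f : weightSub v l θ →ₗ[ℂ] ({a // l a ≤ θ} → ℂ) :=
    (LinearMap.funLeft ℂ ℂ (Subtype.val : {a // l a ≤ θ} → κ)).comp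
      (v.mulVecLin.comp (weightSub v l θ).subtype)
  have hf : Function.Injective f := by
    rw [injective_iff_map_eq_zero]
    rintro ⟨z, hz⟩ h
    have h1 : v *ᵥ z = 0 := by
      funext a
      by_cases ha : l a ≤ θ
      · exact congrFun h ⟨a, ha⟩
      · exact mem_weightSub.1 hz a (not_le.1 ha)
    have h2 : vᴴ * v = 1 := Matrix.mem_unitaryGroup_iff'.1 hv
    have h3 := congrArg (vᴴ *ᵥ ·) h1
    simp only [Matrix.mulVec_mulVec, h2, Matrix.one_mulVec, Matrix.mulVec_zero] at h3
    exact Subtype.ext h3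
  have := LinearMap.finrank_le_finrank_of_injective hf
  rwa [Module.finrank_fintype_fun_eq_card, Fintype.card_subtype] at this

/-- The Hilbert–Mumford criterion: a one-parameter subgroup with a limit and nonnegative weight at
a stable point is trivial. -/
lemma MatrixStable.weights_eq_zero {c : ℝ} {α : ι → ℝ} {x : Matrix κ ι ℂ} {y : Matrix ι κ ℂ}
    (hst : MatrixStable c α x y) (hc : 0 ≤ c) (hα : ∀ i, 0 < α i)
    (hcα : c * Fintype.card κ = ∑ i, α i) {v : Matrix κ κ ℂ} (hv : v ∈ Matrix.unitaryGroup κ ℂ)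
    {l : κ → ℝ} {t : ι → ℝ} (hl : ∑ a, l a = 0) (hx : ∀ a i, (v * x) a i ≠ 0 → l a ≤ t i)
    (hy : ∀ a i, (y * vᴴ) i a ≠ 0 → t i ≤ l a) (hN : 0 ≤ c * ∑ a, l a - ∑ i, α i * t i) :
    l = 0 ∧ t = 0 := by
  classical
  have hvv : v * vᴴ = 1 := Matrix.mem_unitaryGroup_iff.1 hv
  have hvv' : vᴴ * v = 1 := Matrix.mem_unitaryGroup_iff'.1 hv
  have hxW : ∀ θ i, t i ≤ θ → xᵀ i ∈ weightSub v l θ := fun θ i hi =>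
    mem_weightSub.2 fun a ha => by
      by_contra h
      exact absurd (hx a i h) (not_le.2 (hi.trans_lt ha))
  -- Existence of the limit makes the weight filtration a filtration by subrepresentations: the leg
  -- `i` enters at `θ = t i`, and before that `y i` has no component of weight at most `θ`.
  have hinv : ∀ θ i, xᵀ i ∈ weightSub v l θ ∨ ∀ z ∈ weightSub v l θ, y i ⬝ᵥ z = 0 := by
    intro θ i
    rcases le_or_gt (t i) θ with hi | hi
    · exact Or.inl (hxW θ i hi)
    · refine Or.inr fun z hz => ?_
      have h1 : y i ⬝ᵥ z = (y * vᴴ) i ⬝ᵥ (v *ᵥ z) := by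
        rw [Matrix.dotProduct_mulVec, Matrix.mul_apply_eq_vecMul, Matrix.vecMul_vecMul, hvv',
          Matrix.vecMul_one]
      rw [h1]
      refine Finset.sum_eq_zero fun a _ => ?_
      rcases le_or_gt (l a) θ with ha | ha
      · have : (y * vᴴ) i a = 0 := by
          by_contra h
          exact absurd (hy a i h) (not_le.2 (ha.trans_lt hi))
        rw [this, zero_mul]
      · rw [mem_weightSub.1 hz a ha, mul_zero]
  have hchain : ∀ θ, (∑ i with t i ≤ θ, α i) ≤ (∑ i with xᵀ i ∈ weightSub v l θ, α i) ∧
      c * Module.finrank ℂ (weightSub v l θ) ≤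
        c * (Finset.univ.filter fun a => l a ≤ θ).card := fun θ =>
    ⟨Finset.sum_le_sum_of_subset_of_nonneg
      (fun i hi => by
        rw [Finset.mem_filter] at hi ⊢
        exact ⟨hi.1, hxW θ i hi.2⟩) fun i _ _ => (hα i).le,
     mul_le_mul_of_nonneg_left (Nat.cast_le.2 (finrank_weightSub_le hv l θ)) hc⟩
  obtain ⟨M, hM⟩ := (Set.finite_range (Sum.elim l t)).bddAbove
  -- The cutoff exceeds strictly all weights and also `0`, since the equality case concerns only `θ
  -- < M'` and is used at each `l b`, at each `t i` and at `0`.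
  set M' := max M 0 + 1 with hM'
  have hMl : ∀ a, l a < M' := fun a =>
    ((hM ⟨Sum.inl a, rfl⟩).trans (le_max_left M 0)).trans_lt (lt_add_one _)
  have hMt : ∀ i, t i < M' := fun i =>
    ((hM ⟨Sum.inr i, rfl⟩).trans (le_max_left M 0)).trans_lt (lt_add_one _)
  have hM0 : 0 < M' := (le_max_right M 0).trans_lt (lt_add_one _)
  have hfilter : ∀ θ, ∑ j with Sum.elim l t j ≤ θ, Sum.elim (fun _ => c) (fun i => -α i) j =
      c * (Finset.univ.filter fun a => l a ≤ θ).card - ∑ i with t i ≤ θ, α i := fun θ => by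
    rw [Finset.sum_filter, Fintype.sum_sum_type]
    change (∑ a, if l a ≤ θ then c else 0) + (∑ i, if t i ≤ θ then -α i else 0) = _
    rw [← Finset.sum_filter, ← Finset.sum_filter, Finset.sum_const, nsmul_eq_mul, mul_comm,
      Finset.sum_neg_distrib, sub_eq_add_neg]
  obtain ⟨h1, h2⟩ := layerCake_nonneg (Sum.elim (fun _ => c) (fun i => -α i)) (Sum.elim l t)
    Finset.univ M' (by
      rintro (a | i) _
      · exact (hMl a).le
      · exact (hMt i).le) (fun θ _ => by
      rw [hfilter]
      linarith [(hchain θ).1, (hchain θ).2, (hst _ (hinv θ)).1])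
  -- The terms in `M'` cancel because `c` times the rank is the total weight. As the left side is
  -- nonnegative and `hN` bounds the right side above by zero, every inequality of the filtration is
  -- an equality.
  have h3 : ∑ j, Sum.elim (fun _ => c) (fun i => -α i) j * (M' - Sum.elim l t j) =
      -(c * ∑ a, l a - ∑ i, α i * t i) := by
    rw [Fintype.sum_sum_type]
    simp only [Sum.elim_inl, Sum.elim_inr, mul_sub, neg_mul, Finset.sum_sub_distrib,
      Finset.sum_neg_distrib, ← Finset.mul_sum, ← Finset.sum_mul, ← hcα]
    simp only [Finset.sum_const, Finset.card_univ, nsmul_eq_mul]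
    ring
  have h4 : ∀ θ < M', c * (Finset.univ.filter fun a => l a ≤ θ).card = ∑ i with t i ≤ θ, α i :=
    fun θ hθ => by
      have := h2 (le_antisymm (by rw [h3]; linarith) h1) θ hθ
      rw [hfilter] at this
      linarith
  -- If `l b < l a`, the step at `θ = l b` contains the frame vector of `b` but not that of `a`. It
  -- is then proper and nonzero with equality of weights, against stability.
  have h5 : ∀ a b, l a ≤ l b := by
    intro a b
    by_contra! hab
    have h6 := hst _ (hinv (l b))
    rcases h6.2 (le_antisymm h6.1 (by linarith [hchain (l b), h4 _ (hMl b)])) with hW | hW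
    · have : vᴴ *ᵥ Pi.single b 1 ∈ weightSub v l (l b) := mem_weightSub.2 fun a' ha' => by
        rw [Matrix.mulVec_mulVec, hvv, Matrix.one_mulVec]
        exact Pi.single_eq_of_ne (fun h => absurd ha' (by rw [h]; exact lt_irrefl _)) _
      rw [hW, Submodule.mem_bot] at this
      have := congrArg (v *ᵥ ·) this
      simp only [Matrix.mulVec_mulVec, hvv, Matrix.one_mulVec, Matrix.mulVec_zero] at this
      simpa using congrFun this b
    · have : vᴴ *ᵥ Pi.single a 1 ∈ weightSub v l (l b) := hW ▸ Submodule.mem_top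
      have := mem_weightSub.1 this a hab
      rw [Matrix.mulVec_mulVec, hvv, Matrix.one_mulVec] at this
      simp at this
  have hl0 : l = 0 := by
    funext a
    have h6 : ∑ b, l b = Fintype.card κ * l a := by
      rw [Finset.sum_congr rfl fun b _ => le_antisymm (h5 b a) (h5 a b), Finset.sum_const,
        Finset.card_univ, nsmul_eq_mul]
    rw [hl] at h6
    have : (Fintype.card κ : ℝ) ≠ 0 := Nat.cast_ne_zero.2 (Fintype.card_pos_iff.2 ⟨a⟩).ne'
    exact (mul_eq_zero.1 h6.symm).resolve_left this
  refine ⟨hl0, funext fun i => ?_⟩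
  subst hl0
  rcases lt_trichotomy (t i) 0 with hi | hi | hi
  · have := h4 _ (hMt i)
    rw [Finset.filter_false_of_mem (fun a _ => by simpa using hi), Finset.card_empty,
      Nat.cast_zero, mul_zero] at this
    have h6 : 0 < ∑ j with t j ≤ t i, α j :=
      Finset.sum_pos (fun j _ => hα j) ⟨i, by simp⟩
    exact absurd this h6.ne
  · exact hi
  · have := h4 _ hM0
    rw [Finset.filter_true_of_mem (fun a _ => by simp), Finset.card_univ, hcα,
      ← Finset.sum_filter_add_sum_filter_not Finset.univ (fun j => t j ≤ 0)] at this
    have h6 : 0 < ∑ j with ¬ t j ≤ 0, α j :=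
      Finset.sum_pos (fun j _ => hα j) ⟨i, by simpa using hi⟩
    linarith

end Stable

-- Minimising the Kempf–Ness function of a stable point.

section Minimise

variable {κ ι : Type*} [Fintype κ] [Fintype ι] [DecidableEq κ] [DecidableEq ι]

/-- The squared norm of a representation of the doubled star quiver. -/
def energy (x : Matrix κ ι ℂ) (y : Matrix ι κ ℂ) : ℝ :=
  ∑ a, ∑ i, (‖x a i‖ ^ 2 + ‖y i a‖ ^ 2)

lemma energy_unitary {k : Matrix κ κ ℂ} (hk : k ∈ Matrix.unitaryGroup κ ℂ) (x : Matrix κ ι ℂ)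
    (y : Matrix ι κ ℂ) : energy (k * x) (y * kᴴ) = energy x y := by
  have hkk' : kᴴ * k = 1 := Matrix.mem_unitaryGroup_iff'.1 hk
  have h1 : ∀ i, ∑ a, ‖(k * x) a i‖ ^ 2 = ∑ a, ‖x a i‖ ^ 2 := fun i => by
    have : (k * x)ᴴ * (k * x) = xᴴ * x := by
      rw [Matrix.conjTranspose_mul, Matrix.mul_assoc, ← Matrix.mul_assoc kᴴ, hkk', Matrix.one_mul]
    have := congrFun (congrFun this i) i
    rw [conjTranspose_mul_diag, conjTranspose_mul_diag] at this
    exact Complex.ofReal_injective this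
  have h2 : ∀ i, ∑ a, ‖(y * kᴴ) i a‖ ^ 2 = ∑ a, ‖y i a‖ ^ 2 := fun i => by
    have : (y * kᴴ) * (y * kᴴ)ᴴ = y * yᴴ := by
      rw [Matrix.conjTranspose_mul, Matrix.conjTranspose_conjTranspose, Matrix.mul_assoc,
        ← Matrix.mul_assoc kᴴ, hkk', Matrix.one_mul]
    have := congrFun (congrFun this i) i
    rw [mul_conjTranspose_diag, mul_conjTranspose_diag] at this
    exact Complex.ofReal_injective this
  simp only [energy]
  rw [Finset.sum_comm, Finset.sum_comm (f := fun a i => ‖x a i‖ ^ 2 + ‖y i a‖ ^ 2)]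
  simp only [Finset.sum_add_distrib, h1, h2]

lemma energy_nonneg (x : Matrix κ ι ℂ) (y : Matrix ι κ ℂ) : 0 ≤ energy x y :=
  Finset.sum_nonneg fun _ _ => Finset.sum_nonneg fun _ _ => by positivity

lemma sq_norm_le_energy (x : Matrix κ ι ℂ) (y : Matrix ι κ ℂ) (a : κ) (i : ι) :
    ‖x a i‖ ^ 2 ≤ energy x y ∧ ‖y i a‖ ^ 2 ≤ energy x y := by
  have := single_le_sum_sum (f := fun a i => ‖x a i‖ ^ 2 + ‖y i a‖ ^ 2)
    (fun a i => by positivity) a i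
  exact ⟨le_trans (le_add_of_nonneg_right (sq_nonneg _)) this,
    le_trans (le_add_of_nonneg_left (sq_nonneg _)) this⟩

/-- The logarithm of the character of the complex group defined by the moment map level. -/
def charWeight (c : ℝ) (α : ι → ℝ) (l : κ → ℝ) (t : ι → ℝ) : ℝ :=
  c * ∑ a, l a - ∑ i, α i * t i

/-- The Kempf–Ness function, in Cartan coordinates. -/
def kempfNess (c : ℝ) (α : ι → ℝ) (x : Matrix κ ι ℂ) (y : Matrix ι κ ℂ) (u : Matrix κ κ ℂ)
    (l : κ → ℝ) (t : ι → ℝ) : ℝ :=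
  energy (scaleIn l t (u * x)) (scaleOut l t (y * uᴴ)) - 2 * charWeight c α l t

lemma charWeight_smul (c : ℝ) (α : ι → ℝ) (s : ℝ) (l : κ → ℝ) (t : ι → ℝ) :
    charWeight c α (s • l) (s • t) = s * charWeight c α l t := by
  simp only [charWeight, Pi.smul_apply, smul_eq_mul, mul_sub, Finset.mul_sum]
  congr 1 <;> exact Finset.sum_congr rfl fun _ _ => by ring

lemma continuous_charWeight (c : ℝ) (α : ι → ℝ) :
    Continuous fun w : (κ → ℝ) × (ι → ℝ) => charWeight c α w.1 w.2 := by
  unfold charWeight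
  fun_prop

lemma continuous_kempfNess (c : ℝ) (α : ι → ℝ) (x : Matrix κ ι ℂ) (y : Matrix ι κ ℂ) :
    Continuous fun w : Matrix κ κ ℂ × (κ → ℝ) × (ι → ℝ) =>
      kempfNess c α x y w.1 w.2.1 w.2.2 := by
  unfold kempfNess energy
  simp only [norm_scaleIn, norm_scaleOut, Matrix.mul_apply, Matrix.conjTranspose_apply]
  refine Continuous.sub ?_ (continuous_const.mul ((continuous_charWeight c α).comp continuous_snd))
  have h : ∀ a b, Continuous fun w : Matrix κ κ ℂ × (κ → ℝ) × (ι → ℝ) => w.1 a b := fun a b =>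
    (continuous_apply_apply a b).comp continuous_fst
  have hl : ∀ a, Continuous fun w : Matrix κ κ ℂ × (κ → ℝ) × (ι → ℝ) => w.2.1 a := fun a =>
    (continuous_apply a).comp (continuous_fst.comp continuous_snd)
  have ht : ∀ i, Continuous fun w : Matrix κ κ ℂ × (κ → ℝ) × (ι → ℝ) => w.2.2 i := fun i =>
    (continuous_apply i).comp (continuous_snd.comp continuous_snd)
  refine continuous_finsetSum _ fun a _ => continuous_finsetSum _ fun i _ => ?_
  refine Continuous.add (Continuous.pow (Continuous.mul ?_ (Continuous.norm ?_)) 2)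
    (Continuous.pow (Continuous.mul ?_ (Continuous.norm ?_)) 2)
  · exact Real.continuous_exp.comp ((hl a).sub (ht i))
  · exact continuous_finsetSum _ fun b _ => (h a b).mul continuous_const
  · exact Real.continuous_exp.comp ((hl a).sub (ht i)).neg
  · exact continuous_finsetSum _ fun b _ => continuous_const.mul (h a b).star

/-- Sublevel sets of the Kempf–Ness function of a stable point are bounded modulo scalars. -/
lemma MatrixStable.kempfNess_bounded {c : ℝ} {α : ι → ℝ} {x : Matrix κ ι ℂ} {y : Matrix ι κ ℂ}
    (hst : MatrixStable c α x y) (hc : 0 ≤ c) (hα : ∀ i, 0 < α i)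
    (hcα : c * Fintype.card κ = ∑ i, α i) (C : ℝ) :
    ∃ R : ℝ, ∀ u ∈ Matrix.unitaryGroup κ ℂ, ∀ (l : κ → ℝ) (t : ι → ℝ), ∑ a, l a = 0 →
      kempfNess c α x y u l t ≤ C → ‖(l, t)‖ ≤ R := by
  by_contra! hcon
  choose u hu l t hl hC hR using fun m : ℕ => hcon m
  set F : Ultrafilter ℕ := hyperfilter ℕ
  set ρ : ℕ → ℝ := fun m => ‖(l m, t m)‖ with hρ
  have hρ0 : ∀ m, 0 < ρ m := fun m => (Nat.cast_nonneg m).trans_lt (hR m)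
  have hρF : Tendsto ρ F atTop := by
    refine Tendsto.mono_left ?_ Nat.hyperfilter_le_atTop
    exact tendsto_atTop_mono (fun m => (hR m).le) tendsto_natCast_atTop_atTop
  have hinv : Tendsto (fun m => (ρ m)⁻¹) F (𝓝 0) := tendsto_inv_atTop_zero.comp hρF
  obtain ⟨v, hv, hlim⟩ := isCompact_unitaryGroup.ultrafilter_le_nhds' (F.map u)
    (Ultrafilter.mem_map.2 (Filter.univ_mem' hu))
  have hlim : Tendsto u F (𝓝 v) := hlim
  -- The escaping exponents are normalised; their limit direction `w` will be a one-parameter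
  -- subgroup excluded by `MatrixStable.weights_eq_zero`.
  obtain ⟨w, hw, hwlim⟩ := (isCompact_sphere (0 : (κ → ℝ) × (ι → ℝ)) 1).ultrafilter_le_nhds'
    (F.map fun m => (ρ m)⁻¹ • (l m, t m)) (Ultrafilter.mem_map.2 (Filter.univ_mem' fun m => by
      simp only [Set.mem_preimage, mem_sphere_zero_iff_norm, norm_smul, norm_inv, Real.norm_eq_abs]
      rw [abs_of_pos (hρ0 m), inv_mul_cancel₀ (hρ0 m).ne']))
  have hwlim : Tendsto (fun m => (ρ m)⁻¹ • (l m, t m)) F (𝓝 w) := hwlim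
  have hwl : ∀ a, Tendsto (fun m => (ρ m)⁻¹ * l m a) F (𝓝 (w.1 a)) := fun a =>
    ((continuous_apply a).tendsto _).comp ((continuous_fst.tendsto w).comp hwlim)
  have hwt : ∀ i, Tendsto (fun m => (ρ m)⁻¹ * t m i) F (𝓝 (w.2 i)) := fun i =>
    ((continuous_apply i).tendsto _).comp ((continuous_snd.tendsto w).comp hwlim)
  have hN : Tendsto (fun m => (ρ m)⁻¹ * charWeight c α (l m) (t m)) F
      (𝓝 (charWeight c α w.1 w.2)) := by
    refine (((continuous_charWeight c α).tendsto w).comp hwlim).congr fun m => ?_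
    exact charWeight_smul c α _ _ _
  have hsum : ∑ a, w.1 a = 0 := by
    refine tendsto_nhds_unique (tendsto_finsetSum _ fun a _ => hwl a) ?_
    refine tendsto_const_nhds.congr fun m => ?_
    rw [← Finset.mul_sum, hl, mul_zero]
  have hE : ∀ m, energy (scaleIn (l m) (t m) (u m * x)) (scaleOut (l m) (t m) (y * (u m)ᴴ)) ≤
      C + 2 * charWeight c α (l m) (t m) := fun m => by
    have := hC m
    rw [kempfNess] at this
    linarith
  have hNnn : 0 ≤ charWeight c α w.1 w.2 := by
    have h1 : Tendsto (fun m => (ρ m)⁻¹ * C + 2 * ((ρ m)⁻¹ * charWeight c α (l m) (t m))) F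
        (𝓝 (0 * C + 2 * charWeight c α w.1 w.2)) := (hinv.mul_const C).add (hN.const_mul 2)
    have h2 := ge_of_tendsto' h1 (b := 0) fun m => by
      have h3 := mul_nonneg (inv_nonneg.2 (hρ0 m).le) ((energy_nonneg _ _).trans (hE m))
      linarith
    linarith
  -- The energy is bounded by an expression at most linear in `ρ`, which is negligible after
  -- division by `ρ²`. So the crude bound `max z 0 ≤ exp z` suffices: it already forces quadratic
  -- growth along any nonzero entry of positive weight.
  have hlarge : Tendsto (fun m => (ρ m)⁻¹ * ((ρ m)⁻¹ * C + 2 * ((ρ m)⁻¹ *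
      charWeight c α (l m) (t m)))) F (𝓝 0) := by
    have := hinv.mul ((hinv.mul_const C).add (hN.const_mul 2))
    rwa [zero_mul] at this
  have hexp : ∀ z : ℝ, max z 0 ≤ Real.exp z := fun z =>
    max_le ((le_add_of_nonneg_right zero_le_one).trans (Real.add_one_le_exp z)) (Real.exp_pos z).le
  have key : ∀ (f : ℕ → ℂ) (z : ℂ) (d : ℕ → ℝ) (δ : ℝ), Tendsto f F (𝓝 z) →
      Tendsto (fun m => (ρ m)⁻¹ * d m) F (𝓝 δ) →
      (∀ m, (Real.exp (d m) * ‖f m‖) ^ 2 ≤ C + 2 * charWeight c α (l m) (t m)) → z ≠ 0 →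
      δ ≤ 0 := by
    intro f z d δ hf hd hfd hz
    have h1 : Tendsto (fun m => (max ((ρ m)⁻¹ * d m) 0 * ‖f m‖) ^ 2) F
        (𝓝 ((max δ 0 * ‖z‖) ^ 2)) := ((hd.max tendsto_const_nhds).mul hf.norm).pow 2
    have h2 := le_of_tendsto_of_tendsto' h1 hlarge fun m => by
      have h3 : max ((ρ m)⁻¹ * d m) 0 = (ρ m)⁻¹ * max (d m) 0 := by
        rw [mul_max_of_nonneg _ _ (inv_nonneg.2 (hρ0 m).le), mul_zero]
      have h4 : (max (d m) 0 * ‖f m‖) ^ 2 ≤ (Real.exp (d m) * ‖f m‖) ^ 2 :=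
        pow_le_pow_left₀ (by positivity) (mul_le_mul_of_nonneg_right (hexp _) (norm_nonneg _)) 2
      rw [h3]
      calc ((ρ m)⁻¹ * max (d m) 0 * ‖f m‖) ^ 2
          = (ρ m)⁻¹ * ((ρ m)⁻¹ * (max (d m) 0 * ‖f m‖) ^ 2) := by ring
        _ ≤ (ρ m)⁻¹ * ((ρ m)⁻¹ * (C + 2 * charWeight c α (l m) (t m))) := by
            have := inv_nonneg.2 (hρ0 m).le
            exact mul_le_mul_of_nonneg_left
              (mul_le_mul_of_nonneg_left (h4.trans (hfd m)) this) this
        _ = _ := by ring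
    have h5 : max δ 0 * ‖z‖ = 0 := by
      have := sq_nonneg (max δ 0 * ‖z‖)
      exact pow_eq_zero_iff two_ne_zero |>.1 (le_antisymm h2 this)
    have h6 := (mul_eq_zero.1 h5).resolve_right (norm_ne_zero_iff.2 hz)
    exact (le_max_left δ 0).trans h6.le
  have hlim' : Tendsto (fun m => (u m)ᴴ) F (𝓝 vᴴ) := (continuous_star.tendsto v).comp hlim
  have hux : ∀ a i, Tendsto (fun m => (u m * x) a i) F (𝓝 ((v * x) a i)) := fun a i =>
    tendsto_pi_nhds.1 (tendsto_pi_nhds.1 (tendsto_matrix_mul hlim tendsto_const_nhds) a) i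
  have huy : ∀ a i, Tendsto (fun m => (y * (u m)ᴴ) i a) F (𝓝 ((y * vᴴ) i a)) := fun a i =>
    tendsto_pi_nhds.1 (tendsto_pi_nhds.1 (tendsto_matrix_mul tendsto_const_nhds hlim') i) a
  have hdiff : ∀ a i, Tendsto (fun m => (ρ m)⁻¹ * (l m a - t m i)) F (𝓝 (w.1 a - w.2 i)) :=
    fun a i => ((hwl a).sub (hwt i)).congr fun m => (mul_sub _ _ _).symm
  obtain ⟨z1, z2⟩ := hst.weights_eq_zero hc hα hcα hv hsum
    (fun a i hne => by
      have := key _ _ _ _ (hux a i) (hdiff a i) (fun m => by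
        rw [← norm_scaleIn]
        exact (sq_norm_le_energy _ _ a i).1.trans (hE m)) hne
      linarith)
    (fun a i hne => by
      have := key _ _ (fun m => -(l m a - t m i)) _ (huy a i)
        ((hdiff a i).neg.congr fun m => by ring) (fun m => by
        rw [← norm_scaleOut]
        exact (sq_norm_le_energy _ _ a i).2.trans (hE m)) hne
      linarith) hNnn
  have hw0 : w = 0 := Prod.ext z1 z2
  rw [hw0, mem_sphere_zero_iff_norm, norm_zero] at hw
  exact zero_ne_one hw

/-- Diagonal scalars act trivially, and `hcα` makes the character trivial on them. This permits the
normalisation `∑ l = 0`, without which sublevel sets are unbounded. -/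
lemma kempfNess_shift {c : ℝ} {α : ι → ℝ} (hcα : c * Fintype.card κ = ∑ i, α i)
    (x : Matrix κ ι ℂ) (y : Matrix ι κ ℂ) (u : Matrix κ κ ℂ) (l : κ → ℝ) (t : ι → ℝ) (s : ℝ) :
    kempfNess c α x y u (fun a => l a + s) (fun i => t i + s) = kempfNess c α x y u l t := by
  have h1 : charWeight c α (fun a => l a + s) (fun i => t i + s) = charWeight c α l t := by
    simp only [charWeight, Finset.sum_add_distrib, mul_add, Finset.sum_const, Finset.card_univ,
      nsmul_eq_mul, ← Finset.sum_mul, ← hcα]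
    ring
  simp only [kempfNess, h1, scaleIn, scaleOut, add_sub_add_right_eq_sub]

/-- The Kempf–Ness function of a stable point attains its minimum. -/
lemma MatrixStable.exists_min {c : ℝ} {α : ι → ℝ} {x : Matrix κ ι ℂ} {y : Matrix ι κ ℂ}
    (hst : MatrixStable c α x y) (hc : 0 ≤ c) (hα : ∀ i, 0 < α i)
    (hcα : c * Fintype.card κ = ∑ i, α i) :
    ∃ u ∈ Matrix.unitaryGroup κ ℂ, ∃ (l : κ → ℝ) (t : ι → ℝ),
      ∀ u' ∈ Matrix.unitaryGroup κ ℂ, ∀ (l' : κ → ℝ) (t' : ι → ℝ),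
        kempfNess c α x y u l t ≤ kempfNess c α x y u' l' t' := by
  obtain ⟨R, hR⟩ := hst.kempfNess_bounded hc hα hcα (kempfNess c α x y 1 0 0)
  set K : Set (Matrix κ κ ℂ × (κ → ℝ) × (ι → ℝ)) :=
    {w | w.1 ∈ Matrix.unitaryGroup κ ℂ ∧ ∑ a, w.2.1 a = 0 ∧
      kempfNess c α x y w.1 w.2.1 w.2.2 ≤ kempfNess c α x y 1 0 0} with hK
  have hcont := continuous_kempfNess c α x y
  have hKc : IsCompact K := by
    refine (isCompact_unitaryGroup.prod (isCompact_closedBall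
      (0 : (κ → ℝ) × (ι → ℝ)) R)).of_isClosed_subset ?_ ?_
    · refine (isCompact_unitaryGroup.isClosed.preimage continuous_fst).inter
        (IsClosed.inter ?_ (isClosed_le hcont continuous_const))
      exact isClosed_eq (continuous_finsetSum _ fun a _ =>
        (continuous_apply a).comp (continuous_fst.comp continuous_snd)) continuous_const
    · rintro ⟨u, l, t⟩ ⟨h1, h2, h3⟩
      exact ⟨h1, mem_closedBall_zero_iff.2 (hR u h1 l t h2 h3)⟩
  have h0 : ((1, 0, 0) : Matrix κ κ ℂ × (κ → ℝ) × (ι → ℝ)) ∈ K :=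
    ⟨one_mem _, by simp, le_rfl⟩
  obtain ⟨⟨u, l, t⟩, ⟨hu, hl, -⟩, hmin⟩ := hKc.exists_isMinOn ⟨_, h0⟩ hcont.continuousOn
  have hmin : ∀ w ∈ K, kempfNess c α x y u l t ≤ kempfNess c α x y w.1 w.2.1 w.2.2 :=
    fun w hw => hmin hw
  refine ⟨u, hu, l, t, fun u' hu' l' t' => ?_⟩
  -- A competitor is moved by a scalar into the normalised slice; if it lies above the value at the
  -- identity, there is nothing to compare.
  obtain ⟨s, hs⟩ : ∃ s : ℝ, ∑ a, (l' a + s) = 0 := by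
    rcases isEmpty_or_nonempty κ with h | h
    · exact ⟨0, by simp⟩
    · refine ⟨-(∑ a, l' a) / Fintype.card κ, ?_⟩
      rw [Finset.sum_add_distrib, Finset.sum_const, Finset.card_univ, nsmul_eq_mul,
        mul_div_cancel₀ _ (Nat.cast_ne_zero.2 Fintype.card_ne_zero), add_neg_cancel]
  rw [← kempfNess_shift hcα x y u' l' t' s]
  by_cases hle : kempfNess c α x y u' (fun a => l' a + s) (fun i => t' i + s) ≤
      kempfNess c α x y 1 0 0
  · exact hmin (u', (fun a => l' a + s), fun i => t' i + s) ⟨hu', hs, hle⟩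
  · exact (hmin _ h0).trans (not_le.1 hle).le

/-- The right-hand side is minimal at `s = 0`, where its derivative is `2 A - 2 B - 2 m`. This is
the Euler–Lagrange equation of a one-parameter variation. -/
lemma eq_of_exp_variation {A B m : ℝ}
    (h : ∀ s : ℝ, A + B ≤ A * Real.exp (2 * s) + B * Real.exp (-(2 * s)) - 2 * m * s) :
    A - B = m := by
  have hd : HasDerivAt (fun s : ℝ => A * Real.exp (2 * s) + B * Real.exp (-(2 * s)) - 2 * m * s)
      (2 * A - 2 * B - 2 * m) 0 := by
    have h1 : HasDerivAt (fun s : ℝ => 2 * s) 2 0 := by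
      simpa using (hasDerivAt_id (0 : ℝ)).const_mul 2
    have h2 := ((h1.exp.const_mul A).add (h1.fun_neg.exp.const_mul B)).sub
      ((hasDerivAt_id' (0 : ℝ)).const_mul (2 * m))
    refine h2.congr_deriv ?_
    rw [mul_zero, neg_zero, Real.exp_zero]
    ring
  have hmin : IsLocalMin (fun s : ℝ => A * Real.exp (2 * s) + B * Real.exp (-(2 * s)) - 2 * m * s)
      0 := Eventually.of_forall fun s => by simpa using h s
  have := hmin.hasDerivAt_eq_zero hd
  linarith

lemma scaleIn_scaleIn (l l' : κ → ℝ) (t t' : ι → ℝ) (x : Matrix κ ι ℂ) :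
    scaleIn l' t' (scaleIn l t x) = scaleIn (l + l') (t + t') x := by
  ext a i
  simp only [scaleIn, Matrix.of_apply, Pi.add_apply]
  rw [← mul_assoc, ← Complex.ofReal_mul, ← Real.exp_add]
  congr 3; ring

lemma scaleOut_scaleOut (l l' : κ → ℝ) (t t' : ι → ℝ) (y : Matrix ι κ ℂ) :
    scaleOut l' t' (scaleOut l t y) = scaleOut (l + l') (t + t') y := by
  ext a i
  simp only [scaleOut, Matrix.of_apply, Pi.add_apply]
  rw [← mul_assoc, ← Complex.ofReal_mul, ← Real.exp_add]
  congr 3; ring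

lemma energy_scale_leg (x : Matrix κ ι ℂ) (y : Matrix ι κ ℂ) (i : ι) (s : ℝ) :
    energy (scaleIn 0 (Pi.single i s) x) (scaleOut 0 (Pi.single i s) y) = energy x y +
      ((∑ a, ‖y i a‖ ^ 2) * Real.exp (2 * s) + (∑ a, ‖x a i‖ ^ 2) * Real.exp (-(2 * s)) -
        ((∑ a, ‖y i a‖ ^ 2) + ∑ a, ‖x a i‖ ^ 2)) := by
  rw [← sub_eq_iff_eq_add']
  simp only [energy, ← Finset.sum_sub_distrib]
  rw [Finset.sum_comm, Finset.sum_eq_single i, Finset.sum_mul, Finset.sum_mul,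
    ← Finset.sum_add_distrib, ← Finset.sum_add_distrib, ← Finset.sum_sub_distrib]
  · refine Finset.sum_congr rfl fun a _ => ?_
    rw [norm_scaleIn, norm_scaleOut, mul_pow, mul_pow, ← Real.exp_nat_mul, ← Real.exp_nat_mul]
    simp only [Pi.zero_apply, Pi.single_eq_same, zero_sub, neg_neg, Nat.cast_ofNat, mul_neg]
    ring
  · intro j _ hj
    refine Finset.sum_eq_zero fun a _ => ?_
    rw [norm_scaleIn, norm_scaleOut]
    simp [Pi.single_eq_of_ne hj]
  · simp

lemma energy_scale_center (x : Matrix κ ι ℂ) (y : Matrix ι κ ℂ) (a : κ) (s : ℝ) :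
    energy (scaleIn (Pi.single a s) 0 x) (scaleOut (Pi.single a s) 0 y) = energy x y +
      ((∑ i, ‖x a i‖ ^ 2) * Real.exp (2 * s) + (∑ i, ‖y i a‖ ^ 2) * Real.exp (-(2 * s)) -
        ((∑ i, ‖x a i‖ ^ 2) + ∑ i, ‖y i a‖ ^ 2)) := by
  rw [← sub_eq_iff_eq_add']
  simp only [energy, ← Finset.sum_sub_distrib]
  rw [Finset.sum_eq_single a, Finset.sum_mul, Finset.sum_mul,
    ← Finset.sum_add_distrib, ← Finset.sum_add_distrib, ← Finset.sum_sub_distrib]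
  · refine Finset.sum_congr rfl fun i _ => ?_
    rw [norm_scaleIn, norm_scaleOut, mul_pow, mul_pow, ← Real.exp_nat_mul, ← Real.exp_nat_mul]
    simp only [Pi.zero_apply, Pi.single_eq_same, sub_zero, Nat.cast_ofNat, mul_neg]
    ring
  · intro j _ hj
    refine Finset.sum_eq_zero fun i _ => ?_
    rw [norm_scaleIn, norm_scaleOut]
    simp [Pi.single_eq_of_ne hj]
  · simp

lemma norm_det_unitary {u : Matrix κ κ ℂ} (hu : u ∈ Matrix.unitaryGroup κ ℂ) : ‖u.det‖ = 1 := by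
  have h := congrArg Matrix.det (show u * uᴴ = 1 from Matrix.mem_unitaryGroup_iff.1 hu)
  rw [Matrix.det_mul, Matrix.det_conjTranspose, Matrix.det_one] at h
  have h2 := congrArg norm h
  rw [norm_mul, norm_star, norm_one] at h2
  nlinarith [norm_nonneg u.det]

lemma norm_det_diagonal_exp (l : κ → ℝ) :
    ‖(Matrix.diagonal fun a => (Real.exp (l a) : ℂ)).det‖ = Real.exp (∑ a, l a) := by
  rw [Matrix.det_diagonal, ← Complex.ofReal_prod, ← Real.exp_sum, Complex.norm_real,
    Real.norm_eq_abs, Real.abs_exp]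

lemma diagonal_exp_mul_neg (l : κ → ℝ) : (Matrix.diagonal fun a => (Real.exp (l a) : ℂ)) *
    (Matrix.diagonal fun a => (Real.exp (-l a) : ℂ)) = 1 := by
  rw [Matrix.diagonal_mul_diagonal, ← Matrix.diagonal_one]
  congr 1; funext a
  rw [← Complex.ofReal_mul, ← Real.exp_add, add_neg_cancel, Real.exp_zero, Complex.ofReal_one]

/-- Minimality is known only in Cartan coordinates, so a further motion by `exp m * k` has to be
decomposed anew. The new left unitary factor does not change the energy, and comparing absolute
values of determinants gives the new `∑ l'`, hence the change `c * ∑ m` of the character. -/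
lemma le_energy_of_min {c : ℝ} {α : ι → ℝ} {x : Matrix κ ι ℂ} {y : Matrix ι κ ℂ}
    {u : Matrix κ κ ℂ} (hu : u ∈ Matrix.unitaryGroup κ ℂ) {l : κ → ℝ} {t : ι → ℝ}
    (hmin : ∀ u' ∈ Matrix.unitaryGroup κ ℂ, ∀ (l' : κ → ℝ) (t' : ι → ℝ),
      kempfNess c α x y u l t ≤ kempfNess c α x y u' l' t')
    {k : Matrix κ κ ℂ} (hk : k ∈ Matrix.unitaryGroup κ ℂ) (m : κ → ℝ) :
    energy (scaleIn l t (u * x)) (scaleOut l t (y * uᴴ)) + 2 * (c * ∑ a, m a) ≤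
      energy (scaleIn m 0 (k * scaleIn l t (u * x))) (scaleOut m 0 (scaleOut l t (y * uᴴ) * kᴴ)) := by
  have hkk : k * kᴴ = 1 := Matrix.mem_unitaryGroup_iff.1 hk
  have huu : u * uᴴ = 1 := Matrix.mem_unitaryGroup_iff.1 hu
  set Dm := Matrix.diagonal fun a => (Real.exp (m a) : ℂ) with hDm
  set Dm' := Matrix.diagonal fun a => (Real.exp (-m a) : ℂ) with hDm'
  set Dl := Matrix.diagonal fun a => (Real.exp (l a) : ℂ) with hDl
  set Dl' := Matrix.diagonal fun a => (Real.exp (-l a) : ℂ) with hDl'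
  have e1 : Dm * Dm' = 1 := diagonal_exp_mul_neg m
  have e2 : Dl * Dl' = 1 := diagonal_exp_mul_neg l
  have hgh : (Dm * k * Dl * u) * (uᴴ * Dl' * kᴴ * Dm') = 1 := by
    calc _ = Dm * k * Dl * (u * uᴴ) * Dl' * kᴴ * Dm' := by simp only [Matrix.mul_assoc]
      _ = Dm * k * (Dl * Dl') * kᴴ * Dm' := by rw [huu]; simp only [Matrix.mul_assoc, Matrix.one_mul]
      _ = Dm * (k * kᴴ) * Dm' := by rw [e2]; simp only [Matrix.mul_assoc, Matrix.one_mul]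
      _ = 1 := by rw [hkk, Matrix.mul_one, e1]
  obtain ⟨k', hk', u', hu', l', h1, h2⟩ := exists_cartan hgh
  have hdet : ∑ a, l' a = ∑ a, m a + ∑ a, l a := by
    have := congrArg (fun A => ‖Matrix.det A‖) h1
    simp only [Matrix.det_mul, norm_mul, norm_det_unitary hk, norm_det_unitary hu,
      norm_det_unitary hk', norm_det_unitary hu', mul_one, one_mul] at this
    rw [hDm, hDl, norm_det_diagonal_exp, norm_det_diagonal_exp, norm_det_diagonal_exp,
      ← Real.exp_add] at this
    exact (Real.exp_injective this).symm
  have z0 : (Matrix.diagonal fun i : ι => (Real.exp (-(0 : ι → ℝ) i) : ℂ)) = 1 := by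
    simp
  have z0' : (Matrix.diagonal fun i : ι => (Real.exp ((0 : ι → ℝ) i) : ℂ)) = 1 := by
    simp
  have hX : scaleIn m 0 (k * scaleIn l t (u * x)) = k' * scaleIn l' t (u' * x) := by
    rw [scaleIn_eq m, z0, Matrix.mul_one, scaleIn_eq l, scaleIn_eq l']
    calc _ = (Dm * k * Dl * u) * x * Matrix.diagonal (fun i => (Real.exp (-t i) : ℂ)) := by
          simp only [hDm, hDl, Matrix.mul_assoc]
      _ = _ := by rw [h1]; simp only [Matrix.mul_assoc]
  have hY : scaleOut m 0 (scaleOut l t (y * uᴴ) * kᴴ) = scaleOut l' t (y * u'ᴴ) * k'ᴴ := by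
    rw [scaleOut_eq m, z0', Matrix.one_mul, scaleOut_eq l, scaleOut_eq l']
    calc _ = Matrix.diagonal (fun i => (Real.exp (t i) : ℂ)) * y * (uᴴ * Dl' * kᴴ * Dm') := by
          simp only [hDm', hDl', Matrix.mul_assoc]
      _ = _ := by rw [h2]; simp only [Matrix.mul_assoc]
  rw [hX, hY, energy_unitary hk']
  have := hmin u' hu' l' t
  simp only [kempfNess, charWeight, hdet] at this
  linarith

/-- The orbit of a stable point contains a balanced point. -/
theorem MatrixStable.exists_balanced {c : ℝ} {α : ι → ℝ} {x : Matrix κ ι ℂ} {y : Matrix ι κ ℂ}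
    (hst : MatrixStable c α x y) (hc : 0 ≤ c) (hα : ∀ i, 0 < α i)
    (hcα : c * Fintype.card κ = ∑ i, α i) :
    ∃ x' y', ComplexEquiv x y x' y' ∧ IsBalanced c α x' y' := by
  obtain ⟨u, hu, l, t, hmin⟩ := hst.exists_min hc hα hcα
  have huu : u * uᴴ = 1 := Matrix.mem_unitaryGroup_iff.1 hu
  refine ⟨scaleIn l t (u * x), scaleOut l t (y * uᴴ), ?_, ?_, fun i => ?_⟩
  · refine ⟨(Matrix.diagonal fun a => (Real.exp (l a) : ℂ)) * u,
      uᴴ * (Matrix.diagonal fun a => (Real.exp (-l a) : ℂ)), fun i => (Real.exp (t i) : ℂ), ?_,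
      fun i => Complex.ofReal_ne_zero.2 (Real.exp_ne_zero _), ?_, ?_⟩
    · rw [Matrix.mul_assoc, ← Matrix.mul_assoc u, huu, Matrix.one_mul, diagonal_exp_mul_neg]
    · rw [scaleIn_eq]
      simp only [Real.exp_neg, Complex.ofReal_inv, Matrix.mul_assoc]
    · rw [scaleOut_eq]
      simp only [Matrix.mul_assoc]
  · set X := scaleIn l t (u * x)
    set Y := scaleOut l t (y * uᴴ)
    have hM : (X * Xᴴ - Yᴴ * Y).IsHermitian :=
      (Matrix.isHermitian_mul_conjTranspose_self X).sub (Matrix.isHermitian_conjTranspose_mul_self Y)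
    -- Varying `l` detects only diagonal entries of the moment map, so the frame is first rotated to
    -- one in which there are no others.
    obtain ⟨k, hk, d, hd⟩ := exists_unitary_diagonal hM
    have hkk : k * kᴴ = 1 := Matrix.mem_unitaryGroup_iff.1 hk
    have hkk' : kᴴ * k = 1 := Matrix.mem_unitaryGroup_iff'.1 hk
    have hD : (k * X) * (k * X)ᴴ - (Y * kᴴ)ᴴ * (Y * kᴴ) = Matrix.diagonal fun a => (d a : ℂ) := by
      calc _ = k * (X * Xᴴ - Yᴴ * Y) * kᴴ := by
            simp only [Matrix.conjTranspose_mul, Matrix.conjTranspose_conjTranspose,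
              Matrix.mul_sub, Matrix.sub_mul, Matrix.mul_assoc]
        _ = (k * kᴴ) * Matrix.diagonal (fun a => (d a : ℂ)) * (k * kᴴ) := by
            rw [hd]; simp only [Matrix.mul_assoc]
        _ = _ := by rw [hkk, Matrix.one_mul, Matrix.mul_one]
    have hda : ∀ a, d a = c := fun a => by
      have h1 := congrFun (congrFun hD a) a
      rw [Matrix.sub_apply, mul_conjTranspose_diag, conjTranspose_mul_diag,
        Matrix.diagonal_apply_eq] at h1
      rw [← Complex.ofReal_injective ((Complex.ofReal_sub _ _).trans h1)]
      refine eq_of_exp_variation fun s => ?_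
      have h2 := le_energy_of_min hu hmin hk (Pi.single a s)
      rw [energy_scale_center, energy_unitary hk, Finset.sum_pi_single', if_pos (Finset.mem_univ a)]
        at h2
      linarith
    rw [hd]
    simp only [hda]
    rw [← Matrix.smul_one_eq_diagonal, Matrix.mul_smul, Matrix.mul_one, Matrix.smul_mul, hkk']
  -- Increasing `t i` enlarges `y i` and shrinks `x i`, hence the exchanged roles and the sign of `α
  -- i`.
  · have := eq_of_exp_variation (A := ∑ a, ‖scaleOut l t (y * uᴴ) i a‖ ^ 2)
      (B := ∑ a, ‖scaleIn l t (u * x) a i‖ ^ 2) (m := -α i) fun s => by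
        have h1 := hmin u hu l (t + Pi.single i s)
        have h2 := energy_scale_leg (scaleIn l t (u * x)) (scaleOut l t (y * uᴴ)) i s
        rw [scaleIn_scaleIn, scaleOut_scaleOut, add_zero] at h2
        simp only [kempfNess, charWeight] at h1
        have h3 : ∑ j, α j * (t + Pi.single i s : ι → ℝ) j = ∑ j, α j * t j + α i * s := by
          simp only [Pi.add_apply, mul_add, Finset.sum_add_distrib]
          congr 1
          rw [Finset.sum_eq_single i (fun j _ hj => by rw [Pi.single_eq_of_ne hj, mul_zero])
            (by simp), Pi.single_eq_same]
        rw [h2, h3] at h1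
        linarith
    linarith

end Minimise

-- From stable to polystable representations by splitting off summands.

section Polystable

variable {ι : Type*} [Fintype ι] [DecidableEq ι]

open Classical in
/-- Polystability of a representation of the doubled star quiver with legs `s`. -/
def StarPolystable {V : Type*} [AddCommGroup V] [Module ℂ V] (c : ℝ) (α : ι → ℝ) (s : Finset ι)
    (x : ι → V) (y : ι → Module.Dual ℂ V) : Prop :=
  ∀ W : Submodule ℂ V, (∀ i ∈ s, x i ∈ W ∨ ∀ v ∈ W, y i v = 0) →
    (∑ i ∈ s with x i ∈ W, α i) ≤ c * Module.finrank ℂ W ∧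
    ((∑ i ∈ s with x i ∈ W, α i) = c * Module.finrank ℂ W →
      ∃ W' : Submodule ℂ V, IsCompl W W' ∧ (∀ i ∈ s, x i ∈ W' ∨ ∀ v ∈ W', y i v = 0) ∧
        ∀ i ∈ s, x i ∈ W ∨ x i ∈ W')

/-- The real moment map equations in a basis, regarded as orthonormal, after rescaling the legs. -/
structure BalancedBasis {V κ : Type*} [AddCommGroup V] [Module ℂ V] [Fintype κ] [DecidableEq κ]
    (c : ℝ) (α : ι → ℝ) (s : Finset ι) (x : ι → V) (y : ι → Module.Dual ℂ V)
    (e : Module.Basis κ ℂ V) (t : ι → ℂ) : Prop where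
  ne : ∀ i, t i ≠ 0
  center : ∀ a b, ∑ i ∈ s, (((t i)⁻¹ * e.repr (x i) a) * star ((t i)⁻¹ * e.repr (x i) b) -
    star (t i * y i (e a)) * (t i * y i (e b))) = if a = b then (c : ℂ) else 0
  leg : ∀ i ∈ s, ∑ a, ‖(t i)⁻¹ * e.repr (x i) a‖ ^ 2 - ∑ a, ‖t i * y i (e a)‖ ^ 2 = α i

variable {V : Type*} [AddCommGroup V] [Module ℂ V] {c : ℝ} {α : ι → ℝ} {s : Finset ι}
  {x : ι → V} {y : ι → Module.Dual ℂ V}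

/-- A vanishing `x i` would give the zero subspace positive weight. -/
lemma StarPolystable.ne_zero (h : StarPolystable c α s x y) (hα : ∀ i, 0 < α i) {i : ι}
    (hi : i ∈ s) : x i ≠ 0 := by
  classical
  intro h0
  have h1 := (h ⊥ fun j _ => Or.inr fun v hv => by rw [(Submodule.mem_bot ℂ).1 hv, map_zero]).1
  rw [finrank_bot, Nat.cast_zero, mul_zero] at h1
  have h2 : 0 < ∑ j ∈ s with x j ∈ (⊥ : Submodule ℂ V), α j :=
    Finset.sum_pos (fun j _ => hα j) ⟨i, Finset.mem_filter.2 ⟨hi, h0⟩⟩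
  exact absurd h1 (not_le.2 h2)

/-- Polystability passes to an invariant subspace on which the remaining legs vanish. -/
lemma StarPolystable.restrict (h : StarPolystable c α s x y) {W : Submodule ℂ V} {s₁ : Finset ι}
    (hs : s₁ ⊆ s) {x₁ : ι → W} (hx₁ : ∀ i ∈ s₁, (x₁ i : V) = x i)
    (hout : ∀ i ∈ s, i ∉ s₁ → x i ∉ W ∧ ∀ v ∈ W, y i v = 0) :
    StarPolystable c α s₁ x₁ (fun i => (y i).comp W.subtype) := by
  classical
  intro U hU
  have hmem : ∀ i ∈ s₁, (x i ∈ U.map W.subtype ↔ x₁ i ∈ U) := fun i hi => by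
    rw [← hx₁ i hi]
    exact ⟨fun ⟨u, hu, hux⟩ => Subtype.ext hux ▸ hu, fun hu => ⟨_, hu, rfl⟩⟩
  have hle : U.map W.subtype ≤ W := Submodule.map_subtype_le _ _
  have hfilter : (s.filter fun i => x i ∈ U.map W.subtype) = s₁.filter fun i => x₁ i ∈ U := by
    ext i
    simp only [Finset.mem_filter]
    constructor
    · rintro ⟨hi, hxi⟩
      have hi₁ : i ∈ s₁ := by
        by_contra hn
        exact (hout i hi hn).1 (hle hxi)
      exact ⟨hi₁, (hmem i hi₁).1 hxi⟩
    · rintro ⟨hi, hxi⟩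
      exact ⟨hs hi, (hmem i hi).2 hxi⟩
  have hfin : Module.finrank ℂ (U.map W.subtype) = Module.finrank ℂ U :=
    Submodule.finrank_map_subtype_eq W U
  obtain ⟨h1, h2⟩ := h (U.map W.subtype) fun i hi => by
    by_cases hi₁ : i ∈ s₁
    · rcases hU i hi₁ with hx | hy
      · exact Or.inl ((hmem i hi₁).2 hx)
      · refine Or.inr ?_
        rintro _ ⟨u, hu, rfl⟩
        exact hy u hu
    · exact Or.inr fun v hv => (hout i hi hi₁).2 v (hle hv)
  rw [hfilter, hfin] at h1 h2
  refine ⟨h1, fun he => ?_⟩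
  obtain ⟨T, hT, hTinv, hTx⟩ := h2 he
  -- By the modular law, a complement in `V` of a subspace of `W` cuts out a complement inside `W`.
  refine ⟨T.comap W.subtype, ⟨?_, ?_⟩, fun i hi => ?_, fun i hi => ?_⟩
  · rw [Submodule.disjoint_def]
    intro u hu huT
    exact Subtype.ext (Submodule.disjoint_def.1 hT.1 u ⟨u, hu, rfl⟩ huT)
  · rw [codisjoint_iff, eq_top_iff]
    intro w _
    have : (w : V) ∈ U.map W.subtype ⊔ T := by rw [hT.sup_eq_top]; exact Submodule.mem_top
    obtain ⟨_, ⟨u, hu, rfl⟩, z, hz, huz⟩ := Submodule.mem_sup.1 this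
    refine Submodule.mem_sup.2 ⟨u, hu, w - u, ?_, add_sub_cancel _ _⟩
    rw [Submodule.mem_comap]
    convert hz using 1
    simp only [map_sub, Submodule.subtype_apply, ← huz, add_sub_cancel_left]
  · rcases hTinv i (hs hi) with hx | hy
    · left
      rw [Submodule.mem_comap, Submodule.subtype_apply, hx₁ i hi]
      exact hx
    · exact Or.inr fun v hv => hy _ hv
  · rcases hTx i (hs hi) with hx | hx
    · exact Or.inl ((hmem i hi).1 hx)
    · right
      rw [Submodule.mem_comap, Submodule.subtype_apply, hx₁ i hi]
      exact hx

lemma BalancedBasis.reindex {κ κ' : Type*} [Fintype κ] [DecidableEq κ] [Fintype κ']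
    [DecidableEq κ'] {e : Module.Basis κ ℂ V} {t : ι → ℂ} (h : BalancedBasis c α s x y e t)
    (σ : κ ≃ κ') : BalancedBasis c α s x y (e.reindex σ) t := by
  refine ⟨h.ne, fun a b => ?_, fun i hi => ?_⟩
  · simp only [Module.Basis.repr_reindex_apply, Module.Basis.reindex_apply, h.center,
      EmbeddingLike.apply_eq_iff_eq]
  · simp only [Module.Basis.repr_reindex_apply, Module.Basis.reindex_apply]
    rw [σ.symm.sum_comp (fun a => ‖(t i)⁻¹ * e.repr (x i) a‖ ^ 2),
      σ.symm.sum_comp (fun a => ‖t i * y i (e a)‖ ^ 2), h.leg i hi]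

/-- Balanced bases of complementary subrepresentations combine to a balanced basis. -/
lemma BalancedBasis.prod {κ₁ κ₂ : Type*} [Fintype κ₁] [Fintype κ₂] [DecidableEq κ₁]
    [DecidableEq κ₂] {W W' : Submodule ℂ V} (hW : IsCompl W W') {s₁ s₂ : Finset ι}
    (hd : Disjoint s₁ s₂)
    (hx₁ : ∀ i ∈ s₁, x i ∈ W) (hy₁ : ∀ i ∈ s₁, ∀ v ∈ W', y i v = 0)
    (hx₂ : ∀ i ∈ s₂, x i ∈ W') (hy₂ : ∀ i ∈ s₂, ∀ v ∈ W, y i v = 0)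
    {e₁ : Module.Basis κ₁ ℂ W} {e₂ : Module.Basis κ₂ ℂ W'} {t₁ t₂ : ι → ℂ}
    (h₁ : BalancedBasis c α s₁ (fun i => W.projectionOnto W' hW (x i))
      (fun i => (y i).comp W.subtype) e₁ t₁)
    (h₂ : BalancedBasis c α s₂ (fun i => W'.projectionOnto W hW.symm (x i))
      (fun i => (y i).comp W'.subtype) e₂ t₂) :
    BalancedBasis c α (s₁ ∪ s₂) x y ((e₁.prod e₂).map (Submodule.prodEquivOfIsCompl W W' hW))
      (fun i => if i ∈ s₁ then t₁ i else t₂ i) := by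
  set e := (e₁.prod e₂).map (Submodule.prodEquivOfIsCompl W W' hW)
  have hr1 : ∀ i a, e.repr (x i) (Sum.inl a) = e₁.repr (W.projectionOnto W' hW (x i)) a :=
    fun i a => by
      simp only [e, Module.Basis.map_repr, LinearEquiv.trans_apply, Module.Basis.prod_repr_inl]
      rw [Submodule.prodEquivOfIsCompl_symm_apply]
  have hr2 : ∀ i a, e.repr (x i) (Sum.inr a) = e₂.repr (W'.projectionOnto W hW.symm (x i)) a :=
    fun i a => by
      simp only [e, Module.Basis.map_repr, LinearEquiv.trans_apply, Module.Basis.prod_repr_inr]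
      rw [Submodule.prodEquivOfIsCompl_symm_apply]
  have he1 : ∀ a, e (Sum.inl a) = (e₁ a : V) := fun a => by
    simp [e, Module.Basis.map_apply]
  have he2 : ∀ a, e (Sum.inr a) = (e₂ a : V) := fun a => by
    simp [e, Module.Basis.map_apply]
  have hz1 : ∀ i ∈ s₁, W'.projectionOnto W hW.symm (x i) = 0 := fun i hi =>
    (Submodule.projectionOnto_apply_eq_zero_iff hW.symm).2 (hx₁ i hi)
  have hz2 : ∀ i ∈ s₂, W.projectionOnto W' hW (x i) = 0 := fun i hi =>
    (Submodule.projectionOnto_apply_eq_zero_iff hW).2 (hx₂ i hi)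
  have hn : ∀ i ∈ s₂, i ∉ s₁ := fun i hi hi' => Finset.disjoint_left.1 hd hi' hi
  have c1 := h₁.center
  have c2 := h₂.center
  have l1 := h₁.leg
  have l2 := h₂.leg
  simp only [LinearMap.comp_apply, Submodule.subtype_apply] at c1 c2 l1 l2
  refine ⟨fun i => ?_, ?_, fun i hi => ?_⟩
  · split_ifs
    exacts [h₁.ne i, h₂.ne i]
  · rintro (a | a) (b | b)
    · rw [Finset.sum_union hd]
      simp only [hr1, he1]
      rw [Finset.sum_eq_zero (s := s₂), add_zero, Finset.sum_congr rfl
        fun i hi => by rw [if_pos hi], c1]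
      · simp only [Sum.inl.injEq]
      · intro i hi
        simp [hz2 i hi, hy₂ i hi _ (e₁ a).2]
    -- In a mixed block every term vanishes: both `x i` and `y i` are supported on a single summand.
    · rw [if_neg (by simp)]
      refine Finset.sum_eq_zero fun i hi => ?_
      simp only [hr1, he1, hr2, he2]
      rcases Finset.mem_union.1 hi with hi | hi
      · simp [hz1 i hi, hy₁ i hi _ (e₂ b).2]
      · simp [hz2 i hi, hy₂ i hi _ (e₁ a).2]
    · rw [if_neg (by simp)]
      refine Finset.sum_eq_zero fun i hi => ?_
      simp only [hr1, he1, hr2, he2]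
      rcases Finset.mem_union.1 hi with hi | hi
      · simp [hz1 i hi, hy₁ i hi _ (e₂ a).2]
      · simp [hz2 i hi, hy₂ i hi _ (e₁ b).2]
    · rw [Finset.sum_union hd]
      simp only [hr2, he2]
      rw [Finset.sum_eq_zero (s := s₁), zero_add, Finset.sum_congr rfl
        fun i hi => by rw [if_neg (hn i hi)], c2]
      · simp only [Sum.inr.injEq]
      · intro i hi
        simp [hz1 i hi, hy₁ i hi _ (e₂ a).2]
  · simp only [Fintype.sum_sum_type, hr1, he1, hr2, he2]
    rcases Finset.mem_union.1 hi with hi | hi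
    · have e1 : ∀ a, y i (e₂ a : V) = 0 := fun a => hy₁ i hi _ (e₂ a).2
      simp only [hz1 i hi, e1, if_pos hi, map_zero, Finsupp.coe_zero, Pi.zero_apply, mul_zero,
        norm_zero, ne_eq, OfNat.ofNat_ne_zero, not_false_eq_true, zero_pow, Finset.sum_const_zero,
        add_zero]
      exact l1 i hi
    · have e1 : ∀ a, y i (e₁ a : V) = 0 := fun a => hy₂ i hi _ (e₁ a).2
      simp only [hz2 i hi, e1, if_neg (hn i hi), map_zero, Finsupp.coe_zero, Pi.zero_apply,
        mul_zero, norm_zero, ne_eq, OfNat.ofNat_ne_zero, not_false_eq_true, zero_pow,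
        Finset.sum_const_zero, zero_add]
      exact l2 i hi

open Classical in
/-- A stable representation has a balanced basis. -/
lemma exists_balancedBasis_of_stable [FiniteDimensional ℂ V] (hc : 0 ≤ c) (hα : ∀ i, 0 < α i)
    (hcα : c * Module.finrank ℂ V = ∑ i ∈ s, α i) (h : StarPolystable c α s x y)
    (hst : ∀ W : Submodule ℂ V, (∀ i ∈ s, x i ∈ W ∨ ∀ v ∈ W, y i v = 0) →
      (∑ i ∈ s with x i ∈ W, α i) = c * Module.finrank ℂ W → W = ⊥ ∨ W = ⊤) :
    ∃ (κ : Type) (_ : Fintype κ) (_ : DecidableEq κ) (e : Module.Basis κ ℂ V) (t : ι → ℂ),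
      BalancedBasis c α s x y e t := by
  classical
  set b := Module.finBasis ℂ V
  set X : Matrix (Fin (Module.finrank ℂ V)) s ℂ := Matrix.of fun a i => b.repr (x i) a with hX
  set Y : Matrix s (Fin (Module.finrank ℂ V)) ℂ := Matrix.of fun i a => y i (b a) with hY
  have hY' : ∀ (i : s) (v : V), Y i ⬝ᵥ b.equivFun v = y i v := fun i v => by
    conv_rhs => rw [← b.sum_equivFun v]
    simp only [dotProduct, hY, Matrix.of_apply, map_sum, map_smul, smul_eq_mul]
    exact Finset.sum_congr rfl fun a _ => mul_comm _ _
  have hX' : ∀ i : s, Xᵀ i = b.equivFun (x i) := fun i => by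
    funext a
    simp [hX]
  have hstab : MatrixStable c (fun i : s => α i) X Y := by
    intro W hW
    set W₁ : Submodule ℂ V := W.comap b.equivFun.toLinearMap with hW₁
    have hfin : Module.finrank ℂ W₁ = Module.finrank ℂ W := by
      have : W₁.map b.equivFun.toLinearMap = W :=
        Submodule.map_comap_eq_of_surjective b.equivFun.surjective _
      rw [← this]
      exact (LinearEquiv.finrank_map_eq b.equivFun W₁).symm
    have hmem : ∀ i : s, Xᵀ i ∈ W ↔ x i ∈ W₁ := fun i => by rw [hX']; rfl
    have hsum : (∑ i : s with Xᵀ i ∈ W, α i) = ∑ i ∈ s with x i ∈ W₁, α i := by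
      rw [Finset.sum_filter, Finset.sum_filter, ← Finset.sum_coe_sort s]
      exact Finset.sum_congr rfl fun i _ => by simp only [hmem]
    have hinv : ∀ i ∈ s, x i ∈ W₁ ∨ ∀ v ∈ W₁, y i v = 0 := fun i hi => by
      rcases hW ⟨i, hi⟩ with h1 | h1
      · exact Or.inl ((hmem ⟨i, hi⟩).1 h1)
      · exact Or.inr fun v hv => by rw [← hY' ⟨i, hi⟩]; exact h1 _ hv
    rw [hsum, ← hfin]
    refine ⟨(h W₁ hinv).1, fun he => ?_⟩
    rcases hst W₁ hinv he with h0 | h0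
    · left
      rw [eq_bot_iff]
      intro w hw
      have : b.equivFun.symm w ∈ W₁ := by
        rw [hW₁, Submodule.mem_comap, LinearEquiv.coe_coe, LinearEquiv.apply_symm_apply]
        exact hw
      rw [h0, Submodule.mem_bot, LinearEquiv.map_eq_zero_iff] at this
      exact this
    · right
      rw [eq_top_iff]
      intro w _
      have : b.equivFun.symm w ∈ W₁ := h0 ▸ Submodule.mem_top
      rwa [hW₁, Submodule.mem_comap, LinearEquiv.coe_coe, LinearEquiv.apply_symm_apply] at this
  obtain ⟨X', Y', ⟨g, k, t, hgk, ht, rfl, rfl⟩, hb⟩ := hstab.exists_balanced hc (fun i => hα i)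
    (by rw [Fintype.card_fin, hcα, Finset.sum_coe_sort])
  have hkg : k * g = 1 := mul_eq_one_comm.1 hgk
  set e : Module.Basis (Fin (Module.finrank ℂ V)) ℂ V :=
    Module.Basis.ofEquivFun (b.equivFun.trans (Matrix.toLin'OfInv hkg hgk)) with he
  have hrepr : ∀ v a, e.repr v a = (g *ᵥ b.equivFun v) a := fun v a => by
    rw [← e.equivFun_apply, he, Module.Basis.equivFun_ofEquivFun]
    rfl
  have happ : ∀ a, b.equivFun (e a) = k *ᵥ Pi.single a 1 := fun a => by
    rw [he, Module.Basis.coe_ofEquivFun]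
    simp only [LinearEquiv.trans_symm, LinearEquiv.trans_apply, LinearEquiv.apply_symm_apply]
    rfl
  -- Legs outside `s` do not enter the equations; the value `1` only keeps `t'` nowhere zero.
  set t' : ι → ℂ := fun i => if hi : i ∈ s then t ⟨i, hi⟩ else 1 with ht'
  have ht'' : ∀ i : s, t' i = t i := fun i => by simp [ht']
  have hXe : ∀ (i : s) a, (t' i)⁻¹ * e.repr (x i) a =
      (g * X * Matrix.diagonal (fun i => (t i)⁻¹)) a i := fun i a => by
    rw [Matrix.mul_diagonal, hrepr, ht'', mul_comm, ← hX']
    rfl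
  have hYe : ∀ (i : s) a, t' i * y i (e a) = (Matrix.diagonal t * Y * k) i a := fun i a => by
    rw [Matrix.mul_assoc, Matrix.diagonal_mul, ht'', ← hY', happ, Matrix.mulVec_single_one]
    rfl
  refine ⟨_, inferInstance, inferInstance, e, t', fun i => ?_, fun a a' => ?_, fun i hi => ?_⟩
  · by_cases hi : i ∈ s
    · simpa [ht', hi] using ht ⟨i, hi⟩
    · simp [ht', hi]
  · have h1 := congrFun (congrFun hb.center a) a'
    rw [Matrix.sub_apply, Matrix.mul_apply, Matrix.mul_apply, ← Finset.sum_sub_distrib,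
      Matrix.smul_apply, Matrix.one_apply] at h1
    rw [← Finset.sum_coe_sort s]
    simp only [hXe, hYe]
    rw [show (if a = a' then (c : ℂ) else 0) = (c : ℂ) • (if a = a' then (1 : ℂ) else 0) by
      simp]
    exact h1
  · have h1 := hb.leg ⟨i, hi⟩
    simp only [← hXe, ← hYe] at h1
    exact h1

/-- The existence part of the Kempf–Ness theorem: a polystable representation has a balanced
basis. -/
theorem StarPolystable.exists_balancedBasis (hc : 0 ≤ c) (hα : ∀ i, 0 < α i) (d : ℕ) :
    ∀ {V : Type u} [AddCommGroup V] [Module ℂ V] [FiniteDimensional ℂ V] {s : Finset ι}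
      {x : ι → V} {y : ι → Module.Dual ℂ V}, Module.finrank ℂ V = d →
      c * Module.finrank ℂ V = ∑ i ∈ s, α i → StarPolystable c α s x y →
      ∃ (κ : Type) (_ : Fintype κ) (_ : DecidableEq κ) (e : Module.Basis κ ℂ V) (t : ι → ℂ),
        BalancedBasis c α s x y e t := by
  classical
  induction d using Nat.strong_induction_on with
  | _ d ih =>
  intro V _ _ _ s x y hd hcα h
  by_cases hst : ∀ W : Submodule ℂ V, (∀ i ∈ s, x i ∈ W ∨ ∀ v ∈ W, y i v = 0) →
      (∑ i ∈ s with x i ∈ W, α i) = c * Module.finrank ℂ W → W = ⊥ ∨ W = ⊤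
  · exact exists_balancedBasis_of_stable hc hα hcα h fun W hW he => hst W hW (by convert he)
  push Not at hst
  obtain ⟨W, hWinv, hWeq, hbot, htop⟩ := hst
  -- A proper nonzero `W` of equal slope splits the representation. Each `x i` is nonzero, so it
  -- lies in exactly one of `W`, `W'`, and invariance of the other makes `y i` vanish there. Both
  -- summands inherit polystability and the slope `c`.
  obtain ⟨W', hW, hW'inv, hsplit⟩ := (h W hWinv).2 (by convert hWeq)
  have hx0 : ∀ i ∈ s, x i ≠ 0 := fun i hi => h.ne_zero hα hi
  have hnot : ∀ i ∈ s, x i ∈ W → x i ∉ W' := fun i hi h1 h2 =>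
    hx0 i hi (Submodule.disjoint_def.1 hW.1 _ h1 h2)
  have hx₂ : ∀ i ∈ s.filter (fun i => ¬ x i ∈ W), x i ∈ W' := fun i hi =>
    (hsplit i (Finset.mem_filter.1 hi).1).resolve_left (Finset.mem_filter.1 hi).2
  have hy₁ : ∀ i ∈ s.filter (fun i => x i ∈ W), ∀ v ∈ W', y i v = 0 := fun i hi =>
    (hW'inv i (Finset.mem_filter.1 hi).1).resolve_left
      (hnot i (Finset.mem_filter.1 hi).1 (Finset.mem_filter.1 hi).2)
  have hy₂ : ∀ i ∈ s.filter (fun i => ¬ x i ∈ W), ∀ v ∈ W, y i v = 0 := fun i hi =>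
    (hWinv i (Finset.mem_filter.1 hi).1).resolve_left (Finset.mem_filter.1 hi).2
  have hfr : Module.finrank ℂ W + Module.finrank ℂ W' = Module.finrank ℂ V :=
    Submodule.finrank_add_eq_of_isCompl hW
  have hW1 : Module.finrank ℂ W < d := hd ▸ Submodule.finrank_lt htop
  have hW0 : Module.finrank ℂ W ≠ 0 := fun h0 => hbot (Submodule.finrank_eq_zero.1 h0)
  have hp1 : StarPolystable c α (s.filter fun i => x i ∈ W)
      (fun i => W.projectionOnto W' hW (x i)) (fun i => (y i).comp W.subtype) :=
    h.restrict (Finset.filter_subset _ _)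
      (fun i hi => by
        rw [Submodule.projectionOnto_apply_of_mem_left hW (Finset.mem_filter.1 hi).2])
      (fun i hi hni => by
        have hi' : i ∈ s.filter (fun i => ¬ x i ∈ W) :=
          Finset.mem_filter.2 ⟨hi, fun hx => hni (Finset.mem_filter.2 ⟨hi, hx⟩)⟩
        exact ⟨(Finset.mem_filter.1 hi').2, hy₂ i hi'⟩)
  have hp2 : StarPolystable c α (s.filter fun i => ¬ x i ∈ W)
      (fun i => W'.projectionOnto W hW.symm (x i)) (fun i => (y i).comp W'.subtype) :=
    h.restrict (Finset.filter_subset _ _)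
      (fun i hi => by
        rw [Submodule.projectionOnto_apply_of_mem_left hW.symm (hx₂ i hi)])
      (fun i hi hni => by
        have hi' : x i ∈ W := by
          by_contra hx
          exact hni (Finset.mem_filter.2 ⟨hi, hx⟩)
        exact ⟨hnot i hi hi', hy₁ i (Finset.mem_filter.2 ⟨hi, hi'⟩)⟩)
  have htot := Finset.sum_filter_add_sum_filter_not s (fun i => x i ∈ W) α
  have hWeq' : c * Module.finrank ℂ W = ∑ i ∈ s with x i ∈ W, α i := hWeq.symm
  obtain ⟨κ₁, _, _, e₁, t₁, hb₁⟩ := ih _ hW1 rfl hWeq' hp1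
  obtain ⟨κ₂, _, _, e₂, t₂, hb₂⟩ := ih (Module.finrank ℂ W') (by omega) rfl
    (by rw [← hfr, Nat.cast_add, mul_add] at hcα; linarith) hp2
  have := BalancedBasis.prod hW (Finset.disjoint_filter_filter_not s s fun i => x i ∈ W)
    (fun i hi => (Finset.mem_filter.1 hi).2) hy₁ hx₂ hy₂ hb₁ hb₂
  rw [Finset.filter_union_filter_not_eq] at this
  exact ⟨_, _, _, _, _, this⟩

/-- A polystable representation in coordinates is complex equivalent to a balanced one. -/
theorem exists_balanced_of_polystable {κ : Type*} [Fintype κ] [DecidableEq κ] (hc : 0 ≤ c)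
    (hα : ∀ i, 0 < α i) (hcα : c * Fintype.card κ = ∑ i, α i) {X : Matrix κ ι ℂ}
    {Y : Matrix ι κ ℂ} (h : StarPolystable c α Finset.univ Xᵀ
      (fun i => dotProductBilin ℂ ℂ (Y i))) :
    ∃ X' Y', ComplexEquiv X Y X' Y' ∧ IsBalanced c α X' Y' := by
  obtain ⟨κ', _, _, e₀, t, hb₀⟩ := StarPolystable.exists_balancedBasis hc hα _ rfl
    (by rw [Module.finrank_fintype_fun_eq_card, hcα]) h
  have hcard : Fintype.card κ' = Fintype.card κ := by
    rw [← Module.finrank_eq_card_basis e₀, Module.finrank_fintype_fun_eq_card]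
  have hb := hb₀.reindex (Fintype.equivOfCardEq hcard)
  set e := e₀.reindex (Fintype.equivOfCardEq hcard)
  set g : Matrix κ κ ℂ := Matrix.of fun a b => e.repr (Pi.single b 1) a
  set k : Matrix κ κ ℂ := Matrix.of fun a b => e b a
  have hg : ∀ v a, (g *ᵥ v) a = e.repr v a := fun v a => by
    conv_rhs => rw [← Finset.univ_sum_single v]
    simp only [map_sum, Finsupp.coe_finsetSum, Finset.sum_apply]
    refine Finset.sum_congr rfl fun b _ => ?_
    rw [← mul_one (v b), ← smul_eq_mul (v b), Pi.single_smul, map_smul, Finsupp.smul_apply,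
      smul_eq_mul, smul_eq_mul, mul_one, mul_comm]
    rfl
  have hgk : g * k = 1 := by
    ext a b
    have : (g * k) a b = (g *ᵥ e b) a := rfl
    rw [this, hg, e.repr_self, Finsupp.single_apply, Matrix.one_apply]
    simp only [eq_comm]
  refine ⟨g * X * Matrix.diagonal (fun i => (t i)⁻¹), Matrix.diagonal t * Y * k,
    ⟨g, k, t, hgk, hb.ne, rfl, rfl⟩, ?_⟩
  have hX : ∀ a i, (g * X * Matrix.diagonal (fun i => (t i)⁻¹)) a i =
      (t i)⁻¹ * e.repr (Xᵀ i) a := fun a i => by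
    rw [Matrix.mul_diagonal, mul_comm, ← hg]
    rfl
  have hY : ∀ a i, (Matrix.diagonal t * Y * k) i a =
      t i * dotProductBilin ℂ ℂ (Y i) (e a) := fun a i => by
    rw [Matrix.mul_assoc, Matrix.diagonal_mul]
    rfl
  refine ⟨?_, fun i => ?_⟩
  · ext a b
    rw [Matrix.sub_apply, Matrix.mul_apply, Matrix.mul_apply, ← Finset.sum_sub_distrib,
      Matrix.smul_apply, Matrix.one_apply]
    simp only [Matrix.conjTranspose_apply, hX, hY]
    rw [hb.center, smul_eq_mul, mul_ite, mul_one, mul_zero]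
  · simp only [hX, hY]
    exact hb.leg i (Finset.mem_univ i)

end Polystable

-- Balanced representations are polystable.

section BalancedPolystable

variable {κ ι : Type*} [Fintype κ] [Fintype ι] [DecidableEq κ] [DecidableEq ι]

lemma exists_orthogonal_projection_matrix (W : Submodule ℂ (κ → ℂ)) :
    ∃ P : Matrix κ κ ℂ, Pᴴ = P ∧ P * P = P ∧ LinearMap.IsProj W P.mulVecLin := by
  set e := (WithLp.linearEquiv 2 ℂ (κ → ℂ)).symm
  set W' : Submodule ℂ (EuclideanSpace ℂ κ) := W.map e.toLinearMap
  set P : Matrix κ κ ℂ := (Matrix.toEuclideanCLM (n := κ) (𝕜 := ℂ)).symm W'.starProjection with hP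
  have hPe : Matrix.toEuclideanCLM (n := κ) (𝕜 := ℂ) P = W'.starProjection := by simp [hP]
  have hmul : ∀ v, e (P *ᵥ v) = W'.starProjection (e v) := fun v => by
    rw [← hPe]
    rfl
  refine ⟨P, ?_, ?_, ?_, ?_⟩
  · refine EquivLike.injective (Matrix.toEuclideanCLM (n := κ) (𝕜 := ℂ)) ?_
    rw [← Matrix.star_eq_conjTranspose, map_star, hPe]
    exact isSelfAdjoint_starProjection W'
  · refine EquivLike.injective (Matrix.toEuclideanCLM (n := κ) (𝕜 := ℂ)) ?_
    rw [map_mul, hPe]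
    exact W'.isIdempotentElem_starProjection
  · intro v
    have h1 : e (P *ᵥ v) ∈ W' := by rw [hmul]; exact Submodule.starProjection_apply_mem _ _
    obtain ⟨w, hw, hwe⟩ := h1
    rw [Matrix.mulVecLin_apply, ← e.injective hwe]
    exact hw
  · intro v hv
    refine e.injective ?_
    rw [Matrix.mulVecLin_apply, hmul]
    exact Submodule.starProjection_eq_self_iff.2 ⟨v, hv, rfl⟩

lemma sum_sq_norm_eq_zero {β : Type*} [Fintype β] {f : β → ℂ} (h : ∑ a, ‖f a‖ ^ 2 = 0) :
    f = 0 := by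
  funext a
  have := (Finset.sum_eq_zero_iff_of_nonneg fun a _ => sq_nonneg ‖f a‖).1 h a (Finset.mem_univ a)
  simpa using this

/-- A balanced representation is polystable. -/
theorem IsBalanced.starPolystable {c : ℝ} {α : ι → ℝ} {X : Matrix κ ι ℂ} {Y : Matrix ι κ ℂ}
    (h : IsBalanced c α X Y) :
    StarPolystable c α Finset.univ Xᵀ (fun i => dotProductBilin ℂ ℂ (Y i)) := by
  classical
  intro W hW
  obtain ⟨P, hPs, hPP, hproj⟩ := exists_orthogonal_projection_matrix W
  have htr : P.trace = Module.finrank ℂ W := by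
    have h1 := hproj.trace
    rw [← Matrix.toLin'_apply', LinearMap.trace_eq_matrix_trace ℂ (Pi.basisFun ℂ κ)] at h1
    rw [← h1]
    congr 1
    exact (LinearMap.toMatrix'_toLin' P).symm
  set Q : Matrix κ κ ℂ := 1 - P with hQ
  set n1 : ι → ℝ := fun i => ∑ a, ‖(P * X) a i‖ ^ 2
  set n2 : ι → ℝ := fun i => ∑ a, ‖(Y * P) i a‖ ^ 2
  set n3 : ι → ℝ := fun i => ∑ a, ‖(Y * Q) i a‖ ^ 2
  have hn1 : ∀ i, 0 ≤ n1 i := fun i => Finset.sum_nonneg fun a _ => sq_nonneg _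
  have hn3 : ∀ i, 0 ≤ n3 i := fun i => Finset.sum_nonneg fun a _ => sq_nonneg _
  -- This is the trace of the central equation multiplied by the orthogonal projection to `W`.
  have hdim : c * Module.finrank ℂ W = ∑ i, (n1 i - n2 i) := by
    have e1 : (P * X * (P * X)ᴴ).trace = (P * (X * Xᴴ)).trace := by
      rw [Matrix.conjTranspose_mul, hPs, ← Matrix.mul_assoc, Matrix.trace_mul_comm,
        ← Matrix.mul_assoc, ← Matrix.mul_assoc, hPP, Matrix.mul_assoc]
    have e2 : ((Y * P)ᴴ * (Y * P)).trace = (P * (Yᴴ * Y)).trace := by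
      rw [Matrix.conjTranspose_mul, hPs, ← Matrix.mul_assoc, Matrix.trace_mul_comm,
        ← Matrix.mul_assoc, ← Matrix.mul_assoc, hPP, Matrix.mul_assoc]
    have e3 : (P * X * (P * X)ᴴ).trace - ((Y * P)ᴴ * (Y * P)).trace =
        (c : ℂ) * Module.finrank ℂ W := by
      rw [e1, e2, ← Matrix.trace_sub, ← Matrix.mul_sub, h.center, Matrix.mul_smul, Matrix.mul_one,
        Matrix.trace_smul, htr, smul_eq_mul]
    have e4 : (P * X * (P * X)ᴴ).trace = ((∑ i, n1 i : ℝ) : ℂ) := by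
      rw [Finset.sum_comm, Complex.ofReal_sum]
      exact Finset.sum_congr rfl fun a _ => mul_conjTranspose_diag _ _
    have e5 : ((Y * P)ᴴ * (Y * P)).trace = ((∑ i, n2 i : ℝ) : ℂ) := by
      rw [Finset.sum_comm, Complex.ofReal_sum]
      exact Finset.sum_congr rfl fun a _ => conjTranspose_mul_diag _ _
    rw [e4, e5] at e3
    rw [Finset.sum_sub_distrib]
    exact_mod_cast e3.symm
  have hin : ∀ i, Xᵀ i ∈ W → n1 i - n2 i = α i + n3 i := fun i hi => by
    have e1 : n1 i = ∑ a, ‖X a i‖ ^ 2 := by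
      refine Finset.sum_congr rfl fun a _ => ?_
      have : (P * X) a i = (P.mulVecLin (Xᵀ i)) a := rfl
      rw [this, hproj.map_id _ hi]
      rfl
    have e2 : ∑ a, ‖Y i a‖ ^ 2 = n2 i + n3 i := by
      have : Y * Yᴴ = (Y * P) * (Y * P)ᴴ + (Y * Q) * (Y * Q)ᴴ := by
        have hQQ : Q * Q = Q := by
          rw [hQ, Matrix.sub_mul, Matrix.one_mul, Matrix.mul_sub, Matrix.mul_one, hPP, sub_self,
            sub_zero]
        have hQs : Qᴴ = Q := by
          rw [hQ, Matrix.conjTranspose_sub, hPs, Matrix.conjTranspose_one]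
        rw [Matrix.conjTranspose_mul, Matrix.conjTranspose_mul, hQs, hPs, Matrix.mul_assoc,
          ← Matrix.mul_assoc P, hPP,
          Matrix.mul_assoc Y, ← Matrix.mul_assoc Q, hQQ, ← Matrix.mul_add, ← Matrix.add_mul, hQ,
          add_sub_cancel, Matrix.one_mul]
      have := congrFun (congrFun this i) i
      rw [Matrix.add_apply, mul_conjTranspose_diag, mul_conjTranspose_diag,
        mul_conjTranspose_diag, ← Complex.ofReal_add] at this
      exact Complex.ofReal_injective this
    have e3 := h.leg i
    linarith
  have hout : ∀ i, Xᵀ i ∉ W → n1 i - n2 i = n1 i := fun i hi => by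
    have e1 : (Y * P) i = 0 := by
      funext a
      have : (Y * P) i a = Y i ⬝ᵥ (P.mulVecLin (Pi.single a 1)) := by
        rw [Matrix.mulVecLin_apply, Matrix.mulVec_single_one]
        rfl
      rw [this]
      exact (hW i (Finset.mem_univ i)).resolve_left hi _ (hproj.map_mem _)
    have e2 : n2 i = 0 := by
      simp only [n2, e1]
      simp
    rw [e2, sub_zero]
  -- The defect in the slope inequality is a sum of squares: the part of `y i` off `W` when `x i`
  -- lies in `W`, and the part of `x i` in `W` otherwise. In case of equality all of these vanish,
  -- so the orthogonal complement of `W`, the kernel of the projection, is the required complement.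
  have htot : c * Module.finrank ℂ W = (∑ i with Xᵀ i ∈ W, α i) +
      ∑ i, (if Xᵀ i ∈ W then n3 i else n1 i) := by
    rw [hdim, Finset.sum_filter, ← Finset.sum_add_distrib]
    refine Finset.sum_congr rfl fun i _ => ?_
    split_ifs with hi
    · exact hin i hi
    · rw [hout i hi, zero_add]
  have hnn : ∀ i, 0 ≤ (if Xᵀ i ∈ W then n3 i else n1 i) := fun i => by
    split_ifs
    exacts [hn3 i, hn1 i]
  have hnn' := Finset.sum_nonneg fun i (_ : i ∈ Finset.univ) => hnn i
  refine ⟨by linarith, fun he => ?_⟩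
  have hz : ∑ i, (if Xᵀ i ∈ W then n3 i else n1 i) = 0 := by linarith
  have hz' := fun i => (Finset.sum_eq_zero_iff_of_nonneg fun i _ => hnn i).1 hz i (Finset.mem_univ i)
  have hker : ∀ i, Xᵀ i ∉ W → Xᵀ i ∈ LinearMap.ker P.mulVecLin := fun i hi => by
    have := hz' i
    rw [if_neg hi] at this
    rw [LinearMap.mem_ker]
    exact sum_sq_norm_eq_zero (f := fun a => (P * X) a i) this
  refine ⟨LinearMap.ker P.mulVecLin, hproj.isCompl, fun i _ => ?_, fun i _ => ?_⟩
  · by_cases hi : Xᵀ i ∈ W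
    · right
      intro v hv
      have := hz' i
      rw [if_pos hi] at this
      have h1 := sum_sq_norm_eq_zero (f := (Y * Q) i) this
      have h2 : P *ᵥ v = 0 := hv
      have h3 : ((Y * Q) *ᵥ v) i = (Y *ᵥ v) i := by
        rw [← Matrix.mulVec_mulVec, hQ, Matrix.sub_mulVec, Matrix.one_mulVec, h2, sub_zero]
      have h4 : ((Y * Q) *ᵥ v) i = 0 := by
        rw [Matrix.mulVec, h1, zero_dotProduct]
      rw [h4] at h3
      exact h3.symm
    · exact Or.inl (hker i hi)
  · by_cases hi : Xᵀ i ∈ W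
    · exact Or.inl hi
    · exact Or.inr (hker i hi)

end BalancedPolystable

-- Logarithmic differentials on the projective line.

section PolarSum

/-- Riemann's theorem on removable singularities, applied to one point after another. -/
lemma exists_entire_extension (D : Finset ℂ) : ∀ F : ℂ → ℂ,
    DifferentiableOn ℂ F (D : Set ℂ)ᶜ → (∀ q ∈ D, Tendsto (fun z => (z - q) * F z) (𝓝[≠] q) (𝓝 0)) →
    ∃ G : ℂ → ℂ, Differentiable ℂ G ∧ ∀ z ∉ D, G z = F z := by
  induction D using Finset.induction_on with
  | empty =>
    intro F hF _
    exact ⟨F, by simpa [differentiableOn_univ] using hF, fun _ _ => rfl⟩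
  | insert q D hq ih =>
    intro F hF hlim
    set F' := Function.update F q (limUnder (𝓝[≠] q) F) with hF'
    have hopen : (D : Set ℂ)ᶜ ∈ 𝓝 q :=
      D.finite_toSet.isClosed.isOpen_compl.mem_nhds (by simpa using hq)
    have hd : DifferentiableOn ℂ F' (D : Set ℂ)ᶜ := by
      refine Complex.differentiableOn_update_limUnder_of_isLittleO hopen (hF.mono ?_) ?_
      · intro z hz
        simp only [Finset.coe_insert, Set.mem_compl_iff, Set.mem_insert_iff, not_or]
        exact ⟨hz.2, hz.1⟩
      · rw [Asymptotics.isLittleO_iff_tendsto']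
        · have h1 := hlim q (Finset.mem_insert_self _ _)
          have h2 : Tendsto (fun z => (z - q) * F q) (𝓝[≠] q) (𝓝 0) := by
            have : Tendsto (fun z => (z - q) * F q) (𝓝 q) (𝓝 ((q - q) * F q)) :=
              ((continuous_id.sub continuous_const).mul continuous_const).tendsto q
            rw [sub_self, zero_mul] at this
            exact this.mono_left nhdsWithin_le_nhds
          have h3 := h1.sub h2
          rw [sub_zero] at h3
          refine h3.congr fun z => ?_
          rw [div_inv_eq_mul]
          ring
        · filter_upwards [self_mem_nhdsWithin] with z hz h0
          exact absurd (inv_eq_zero.1 h0) (sub_ne_zero.2 hz)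
    obtain ⟨G, hG, hGF⟩ := ih F' hd fun q' hq' => by
      have hne : q' ≠ q := fun h => hq (h ▸ hq')
      refine (hlim q' (Finset.mem_insert_of_mem hq')).congr' ?_
      filter_upwards [mem_nhdsWithin_of_mem_nhds (isOpen_ne.mem_nhds hne)] with z hz
      rw [hF', Function.update_of_ne hz]
    refine ⟨G, hG, fun z hz => ?_⟩
    rw [Finset.mem_insert, not_or] at hz
    rw [hGF z hz.2, hF', Function.update_of_ne hz.1]

variable {n : ℕ} {p : Fin n → ℂ}

/-- The rational function with simple poles at `p` and residues `c`. -/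
def polarSum (p c : Fin n → ℂ) (z : ℂ) : ℂ := ∑ i, (z - p i)⁻¹ * c i

lemma tendsto_mul_polarSum (hp : Function.Injective p) (c : Fin n → ℂ) (j : Fin n) :
    Tendsto (fun z => (z - p j) * polarSum p c z) (𝓝[≠] (p j)) (𝓝 (c j)) := by
  have h1 : ∀ i ∈ Finset.univ, Tendsto (fun z => (z - p j) * ((z - p i)⁻¹ * c i)) (𝓝[≠] (p j))
      (𝓝 (if i = j then c i else 0)) := fun i _ => by
    split_ifs with h
    · subst h
      refine tendsto_const_nhds.congr' ?_
      filter_upwards [self_mem_nhdsWithin] with z hz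
      rw [mul_inv_cancel_left₀ (sub_ne_zero.2 hz)]
    · have h2 : ContinuousAt (fun z => (z - p j) * ((z - p i)⁻¹ * c i)) (p j) := by
        have : p j - p i ≠ 0 := sub_ne_zero.2 fun e => h (hp e.symm)
        fun_prop (disch := assumption)
      have h3 := h2.tendsto
      simp only [sub_self, zero_mul] at h3
      exact h3.mono_left nhdsWithin_le_nhds
  have h2 := tendsto_finsetSum _ h1
  simp only [polarSum, Finset.mul_sum]
  simpa using h2

lemma tendsto_sub_inv_cobounded (q : ℂ) :
    Tendsto (fun z => (z - q)⁻¹) (Bornology.cobounded ℂ) (𝓝 0) := by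
  refine tendsto_inv₀_cobounded.comp ?_
  rw [← tendsto_norm_atTop_iff_cobounded]
  refine tendsto_atTop_mono (fun z => norm_sub_norm_le z q) ?_
  exact tendsto_atTop_add_const_right _ (-‖q‖) tendsto_norm_cobounded_atTop

lemma eventually_cobounded_ne (q : ℂ) : ∀ᶠ z in Bornology.cobounded ℂ, z ≠ q :=
  Bornology.isBounded_def.1 (Bornology.isBounded_singleton (x := q))

lemma tendsto_mul_polarSum_cobounded (p c : Fin n → ℂ) :
    Tendsto (fun z => z * polarSum p c z) (Bornology.cobounded ℂ) (𝓝 (∑ i, c i)) := by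
  simp only [polarSum, Finset.mul_sum]
  refine tendsto_finsetSum _ fun i _ => ?_
  have h1 := (((tendsto_sub_inv_cobounded (p i)).const_mul (p i)).const_add 1).mul_const (c i)
  rw [mul_zero, add_zero, one_mul] at h1
  refine h1.congr' ?_
  filter_upwards [eventually_cobounded_ne (p i)] with z hz
  have := sub_ne_zero.2 hz
  field_simp
  ring

lemma meromorphicAt_polarSum (p c : Fin n → ℂ) (q : ℂ) : MeromorphicAt (polarSum p c) q := by
  unfold polarSum
  fun_prop

lemma order_polarSum (hp : Function.Injective p) (c : Fin n → ℂ) (j : Fin n) :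
    -1 ≤ meromorphicOrderAt (polarSum p c) (p j) := by
  have hm := meromorphicAt_polarSum p c (p j)
  have hm1 : MeromorphicAt (fun z : ℂ => z - p j) (p j) := by fun_prop
  have h1 : 0 ≤ meromorphicOrderAt ((fun z => z - p j) * polarSum p c) (p j) :=
    (tendsto_nhds_iff_meromorphicOrderAt_nonneg (hm1.mul hm)).1 ⟨_, tendsto_mul_polarSum hp c j⟩
  rw [meromorphicOrderAt_mul hm1 hm] at h1
  have h2 : meromorphicOrderAt (fun z : ℂ => z - p j) (p j) = 1 := meromorphicOrderAt_id_sub_const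
  rw [h2] at h1
  generalize meromorphicOrderAt (polarSum p c) (p j) = o at h1
  induction o using WithTop.recTopCoe with
  | top => exact le_top
  | coe o =>
    have h3 : (0 : ℤ) ≤ 1 + o := WithTop.coe_le_coe.1 h1
    exact WithTop.coe_le_coe.2 (show (-1 : ℤ) ≤ o by omega)

/-- In `w = 1 / z` each term is `w c_i + w² p_i c_i / (1 - p_i w)`. The linear parts cancel by `hc`,
and the factor `w²` absorbs the pole of `dz = -w⁻² dw`. -/
lemma polarSum_infty (p : Fin n → ℂ) {c : Fin n → ℂ} (hc : ∑ i, c i = 0) :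
    ∃ g : ℂ → ℂ, AnalyticAt ℂ g 0 ∧
      (fun w : ℂ => -(w ^ 2)⁻¹ * polarSum p c w⁻¹) =ᶠ[𝓝[≠] 0] g := by
  refine ⟨fun w => -∑ i, p i * c i * (1 - p i * w)⁻¹, ?_, ?_⟩
  · have : ∀ i, (1 : ℂ) - p i * 0 ≠ 0 := fun i => by simp
    refine AnalyticAt.fun_neg (Finset.analyticAt_fun_sum _ fun i _ => ?_)
    exact analyticAt_const.mul ((analyticAt_const.sub (analyticAt_const.mul analyticAt_id)).inv
      (this i))
  · have h1 : ∀ i, ∀ᶠ w in 𝓝[≠] (0 : ℂ), 1 - p i * w ≠ 0 := fun i => by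
      have : ContinuousAt (fun w => 1 - p i * w) 0 := by fun_prop
      exact (this.eventually_ne (by simp)).filter_mono nhdsWithin_le_nhds
    filter_upwards [eventually_all.2 h1, self_mem_nhdsWithin] with w hw hw0
    have hw0 : w ≠ 0 := hw0
    have h2 : polarSum p c w⁻¹ = w ^ 2 * ∑ i, p i * c i * (1 - p i * w)⁻¹ := by
      have h3 : ∀ i, (w⁻¹ - p i)⁻¹ * c i = w * c i + w ^ 2 * (p i * c i * (1 - p i * w)⁻¹) :=
        fun i => by
          have h4 : w⁻¹ - p i = (1 - p i * w) / w := by field_simp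
          have := hw i
          rw [h4]
          field_simp
          ring
      simp only [polarSum, h3, Finset.sum_add_distrib, ← Finset.mul_sum, hc, mul_zero, zero_add]
    rw [h2, ← mul_assoc, neg_mul, inv_mul_cancel₀ (pow_ne_zero 2 hw0), neg_one_mul]

/-- A meromorphic differential on the projective line with simple poles is determined by its
residues, and their sum vanishes. -/
lemma eq_polarSum (hp : Function.Injective p) {f : ℂ → ℂ} {c : Fin n → ℂ}
    (hf : DifferentiableOn ℂ f (Set.range p)ᶜ)
    (hc : ∀ i, Tendsto (fun z => (z - p i) * f z) (𝓝[≠] (p i)) (𝓝 (c i)))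
    (hm : MeromorphicAt (fun w : ℂ => -(w ^ 2)⁻¹ * f w⁻¹) 0)
    (ho : 0 ≤ meromorphicOrderAt (fun w : ℂ => -(w ^ 2)⁻¹ * f w⁻¹) 0) :
    (∀ z ∉ Set.range p, f z = polarSum p c z) ∧ ∑ i, c i = 0 := by
  have hD : ((Finset.univ.image p : Finset ℂ) : Set ℂ) = Set.range p := by simp
  obtain ⟨k, hk⟩ := tendsto_nhds_of_meromorphicOrderAt_nonneg hm ho
  -- Here `z f(z)` is `-w` times the coefficient of the form at infinity, which has a finite limit.
  have hinf : Tendsto (fun z => z * f z) (Bornology.cobounded ℂ) (𝓝 0) := by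
    have h1 : Tendsto (fun w : ℂ => w⁻¹ * f w⁻¹) (𝓝[≠] 0) (𝓝 0) := by
      have h2 : Tendsto (fun w : ℂ => -w) (𝓝[≠] 0) (𝓝 0) := by
        simpa using (continuous_neg.tendsto (0 : ℂ)).mono_left nhdsWithin_le_nhds
      have h3 := h2.mul hk
      rw [zero_mul] at h3
      refine h3.congr' ?_
      filter_upwards [self_mem_nhdsWithin] with w hw
      have : w ≠ 0 := hw
      field_simp
    refine (h1.comp tendsto_inv₀_cobounded').congr fun z => ?_
    simp
  have hinf' : ∀ {h : ℂ → ℂ} {b : ℂ}, Tendsto (fun z => z * h z) (Bornology.cobounded ℂ) (𝓝 b) →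
      Tendsto h (Bornology.cobounded ℂ) (𝓝 0) := fun {h b} hb => by
    have h1 := (tendsto_inv₀_cobounded (α := ℂ)).mul hb
    rw [zero_mul] at h1
    refine h1.congr' ?_
    filter_upwards [eventually_cobounded_ne 0] with z hz
    rw [inv_mul_cancel_left₀ hz]
  have hpd : DifferentiableOn ℂ (polarSum p c) (Set.range p)ᶜ := by
    intro z hz
    refine DifferentiableAt.differentiableWithinAt ?_
    unfold polarSum
    refine DifferentiableAt.fun_sum fun i _ => ?_
    have : z - p i ≠ 0 := sub_ne_zero.2 fun e => hz ⟨i, e.symm⟩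
    fun_prop (disch := assumption)
  -- The difference from the polar sum extends to an entire function vanishing at infinity, which is
  -- zero by Liouville. The sum of the residues is then the limit of `z f(z)`.
  obtain ⟨G, hG, hGF⟩ := exists_entire_extension (Finset.univ.image p)
    (fun z => f z - polarSum p c z) (by rw [hD]; exact hf.sub hpd) (by
      intro q hq
      obtain ⟨i, -, rfl⟩ := Finset.mem_image.1 hq
      have := (hc i).sub (tendsto_mul_polarSum hp c i)
      rw [sub_self] at this
      exact this.congr fun z => (mul_sub _ _ _).symm)
  have hev : ∀ᶠ z in Bornology.cobounded ℂ, z ∉ Set.range p :=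
    Bornology.isBounded_def.1 (Set.finite_range p).isBounded
  have hG0 : Tendsto G (cocompact ℂ) (𝓝 0) := by
    rw [← Metric.cobounded_eq_cocompact]
    have := (hinf' hinf).sub (hinf' (tendsto_mul_polarSum_cobounded p c))
    rw [sub_zero] at this
    refine this.congr' ?_
    filter_upwards [hev] with z hz
    rw [hGF z (by simpa using hz)]
  have heq : ∀ z ∉ Set.range p, f z = polarSum p c z := fun z hz => by
    have h1 := hGF z (by simpa using hz)
    rw [hG.apply_eq_of_tendsto_cocompact z hG0] at h1
    exact sub_eq_zero.1 h1.symm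
  refine ⟨heq, tendsto_nhds_unique (tendsto_mul_polarSum_cobounded p c) (hinf.congr' ?_)⟩
  filter_upwards [hev] with z hz
  rw [heq z hz]

/-- Continuity in the chart at infinity gives the limit that Liouville's theorem requires. Thus
endomorphisms of the trivial bundle are constant. -/
lemma HolomorphicOnP1.eq_infty {f : OnePoint ℂ → ℂ} (hf : HolomorphicOnP1 f) (q : OnePoint ℂ) :
    f q = f OnePoint.infty := by
  induction q using OnePoint.rec with
  | infty => rfl
  | coe z =>
    refine hf.1.apply_eq_of_tendsto_cocompact z ?_
    rw [← Metric.cobounded_eq_cocompact]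
    have h1 := (hf.2.continuous.tendsto 0).comp (tendsto_inv₀_cobounded (α := ℂ))
    simp only at h1
    refine h1.congr' ?_
    filter_upwards [eventually_cobounded_ne 0] with w hw
    simp [hw]

end PolarSum

-- Rank-one nilpotents and the minimal nilpotent orbit.

section Orbit

/-- A nonzero matrix `x y` of rank one with `y x = 0` is conjugate to an elementary matrix. -/
lemma exists_conj_vecMulVec {κ : Type*} [Fintype κ] [DecidableEq κ] {x y : κ → ℂ} (hx : x ≠ 0)
    (hy : y ≠ 0) (hyx : y ⬝ᵥ x = 0) :
    ∃ k l : κ, k ≠ l ∧ ∃ g : GL κ ℂ, Matrix.vecMulVec x y = (g : Matrix κ κ ℂ) *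
      Matrix.single k l 1 * ((g⁻¹ : GL κ ℂ) : Matrix κ κ ℂ) := by
  obtain ⟨k, hk⟩ := Function.ne_iff.1 hx
  -- `B` has determinant `x k` and sends the `k`-th basis vector to `x`, so conjugation by it
  -- reduces to the case where `x` is a basis vector.
  set B : Matrix κ κ ℂ := (1 : Matrix κ κ ℂ).updateCol k x with hB
  have hBdet : B.det ≠ 0 := by
    rw [hB, ← Matrix.cramer_apply, Matrix.cramer_one]
    exact hk
  set η : κ → ℂ := y ᵥ* B with hη
  have hBu : IsUnit B.det := isUnit_iff_ne_zero.2 hBdet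
  have hη0 : η ≠ 0 := fun h => hy (by
    have : (y ᵥ* B) ᵥ* B⁻¹ = 0 := by rw [← hη, h, Matrix.zero_vecMul]
    rwa [Matrix.vecMul_vecMul, Matrix.mul_nonsing_inv _ hBu, Matrix.vecMul_one] at this)
  have hBk : B *ᵥ Pi.single k 1 = x := by
    rw [Matrix.mulVec_single_one]
    funext a
    simp [hB]
  have hηk : η k = 0 := by
    have : η ⬝ᵥ Pi.single k 1 = 0 := by
      rw [hη, ← Matrix.dotProduct_mulVec, hBk, hyx]
    simpa using this
  obtain ⟨l, hl⟩ := Function.ne_iff.1 hη0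
  have hkl : k ≠ l := fun h => hl (by rw [← h]; exact hηk)
  -- `C` carries the `l`-th basis covector to `η`, and since `η k = 0` it fixes the `k`-th basis
  -- vector: the covector is normalised without disturbing the vector.
  set C : Matrix κ κ ℂ := (1 : Matrix κ κ ℂ).updateRow l η with hC
  have hCdet : C.det ≠ 0 := by
    rw [hC, ← Matrix.det_transpose, ← Matrix.updateCol_transpose, Matrix.transpose_one,
      ← Matrix.cramer_apply, Matrix.cramer_one]
    exact hl
  have hCu : IsUnit C.det := isUnit_iff_ne_zero.2 hCdet
  have hCk : C *ᵥ Pi.single k 1 = Pi.single k 1 := by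
    rw [Matrix.mulVec_single_one]
    funext a
    by_cases ha : a = l
    · subst ha
      simp [hC, hηk, Pi.single_eq_of_ne hkl.symm]
    · simp [hC, Matrix.updateRow_ne ha, Matrix.one_apply, Pi.single_apply]
  have hCl : Pi.single l 1 ᵥ* C = η := by
    rw [Matrix.single_one_vecMul]
    funext a
    simp [hC]
  refine ⟨k, l, hkl, Matrix.GeneralLinearGroup.mkOfDetNeZero B hBdet *
    (Matrix.GeneralLinearGroup.mkOfDetNeZero C hCdet)⁻¹, ?_⟩
  have e1 : ((Matrix.GeneralLinearGroup.mkOfDetNeZero B hBdet)⁻¹ : GL κ ℂ).1 = B⁻¹ :=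
    Matrix.coe_units_inv _
  have e2 : ((Matrix.GeneralLinearGroup.mkOfDetNeZero C hCdet)⁻¹ : GL κ ℂ).1 = C⁻¹ :=
    Matrix.coe_units_inv _
  have hs : Matrix.single k l (1 : ℂ) = Matrix.vecMulVec (Pi.single k 1) (Pi.single l 1) := by
    rw [Matrix.single_eq_single_vecMulVec_single]
  rw [mul_inv_rev, inv_inv, Units.val_mul, Units.val_mul, e1, e2, hs]
  change _ = B * C⁻¹ * _ * (C * B⁻¹)
  rw [Matrix.mul_vecMulVec, Matrix.vecMulVec_mul, ← Matrix.vecMul_vecMul, hCl, hη,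
    Matrix.vecMul_vecMul, Matrix.mul_nonsing_inv _ hBu, Matrix.vecMul_one]
  congr 1
  have hCk' : C⁻¹ *ᵥ Pi.single k 1 = Pi.single k 1 := by
    conv_lhs => rw [← hCk]
    rw [Matrix.mulVec_mulVec, Matrix.nonsing_inv_mul _ hCu, Matrix.one_mulVec]
  rw [← Matrix.mulVec_mulVec, hCk', hBk]

end Orbit

section Orbit

lemma single_mem_minNilpotentOrbit {r : ℕ} (hr : 2 ≤ r) {k l : Fin r} (hkl : k ≠ l)
    (g : GL (Fin r) ℂ) :
    (g : Matrix (Fin r) (Fin r) ℂ) * Matrix.single k l 1 *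
      ((g⁻¹ : GL (Fin r) ℂ) : Matrix (Fin r) (Fin r) ℂ) ∈ minNilpotentOrbit r := by
  set o : Fin r := ⟨0, by omega⟩
  set e : Fin r := ⟨1, by omega⟩
  have hoe : o ≠ e := by simp [o, e]
  obtain ⟨τ, hτo, hτe⟩ : ∃ τ : Equiv.Perm (Fin r), τ o = k ∧ τ e = l := by
    -- The first swap sends `o` to `k`; the second corrects the image of `e` to `l` and leaves `k`
    -- in place.
    refine ⟨Equiv.swap (Equiv.swap o k e) l * Equiv.swap o k, ?_, ?_⟩
    · rw [Equiv.Perm.mul_apply, Equiv.swap_apply_left]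
      refine Equiv.swap_apply_of_ne_of_ne (fun h => hoe ?_) hkl
      exact (Equiv.swap o k).injective ((Equiv.swap_apply_left o k).trans h)
    · rw [Equiv.Perm.mul_apply, Equiv.swap_apply_left]
  have hdet : (τ.permMatrix ℂ).det ≠ 0 := by
    rw [Matrix.det_permutation]
    exact_mod_cast Units.ne_zero _
  set P : GL (Fin r) ℂ := Matrix.GeneralLinearGroup.mkOfDetNeZero (τ.permMatrix ℂ) hdet with hP
  have hPc : (P : Matrix (Fin r) (Fin r) ℂ) = τ.permMatrix ℂ := rfl
  have hstd : (Matrix.of fun a b : Fin r => if (a : ℕ) = 0 ∧ (b : ℕ) = 1 then (1 : ℂ) else 0) =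
      Matrix.single o e 1 := by
    ext a b
    simp only [Matrix.of_apply, Matrix.single_apply, o, e, Fin.ext_iff, eq_comm]
  have hcomm : Matrix.single o e (1 : ℂ) * (P : Matrix (Fin r) (Fin r) ℂ) =
      (P : Matrix (Fin r) (Fin r) ℂ) * Matrix.single k l 1 := by
    rw [hPc, Equiv.Perm.permMatrix, PEquiv.mul_toMatrix_toPEquiv, PEquiv.toMatrix_toPEquiv_mul]
    ext a b
    simp only [Matrix.submatrix_apply, Matrix.single_apply, id]
    have h1 : k = τ a ↔ o = a := by rw [← hτo, τ.apply_eq_iff_eq]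
    have h2 : e = τ.symm b ↔ l = b := by rw [Equiv.eq_symm_apply, hτe]
    simp only [h1, h2]
  refine ⟨g * P⁻¹, ?_⟩
  rw [hstd, mul_inv_rev, inv_inv, Units.val_mul, Units.val_mul]
  simp only [Matrix.mul_assoc]
  rw [← Matrix.mul_assoc (Matrix.single o e 1), hcomm, ← Matrix.mul_assoc _ (_ * _),
    ← Matrix.mul_assoc _ (P : Matrix (Fin r) (Fin r) ℂ), Units.inv_mul, Matrix.one_mul]

/-- Nilpotent matrices of rank at most one lie in the closure of the minimal nilpotent orbit. -/
lemma vecMulVec_mem_closure_minNilpotentOrbit {r : ℕ} (hr : 2 ≤ r) {x y : Fin r → ℂ}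
    (hyx : y ⬝ᵥ x = 0) : Matrix.vecMulVec x y ∈ closure (minNilpotentOrbit r) := by
  have key : ∀ {x y : Fin r → ℂ}, x ≠ 0 → y ≠ 0 → y ⬝ᵥ x = 0 →
      Matrix.vecMulVec x y ∈ minNilpotentOrbit r := fun hx hy h => by
    obtain ⟨k, l, hkl, g, hg⟩ := exists_conj_vecMulVec hx hy h
    rw [hg]
    exact single_mem_minNilpotentOrbit hr hkl g
  by_cases hxy : x ≠ 0 ∧ y ≠ 0
  · exact subset_closure (key hxy.1 hxy.2 hyx)
  · have h0 : Matrix.vecMulVec x y = 0 := by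
      rw [not_and_or, not_not, not_not] at hxy
      rcases hxy with rfl | rfl
      · exact Matrix.zero_vecMulVec _
      · exact Matrix.vecMulVec_zero _
    rw [h0]
    set o : Fin r := ⟨0, by omega⟩
    set e : Fin r := ⟨1, by omega⟩
    have hoe : e ≠ o := by simp [o, e]
    -- The orbit is stable under nonzero scalars, so shrinking one of its elements reaches zero.
    have hlim : Tendsto (fun m : ℕ => ((1 / ((m : ℂ) + 1)) : ℂ) •
        Matrix.vecMulVec (Pi.single o (1 : ℂ)) (Pi.single e (1 : ℂ))) atTop (𝓝 0) := by
      have h1 := (tendsto_one_div_add_atTop_nhds_zero_nat (𝕜 := ℂ)).smul_const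
        (Matrix.vecMulVec (Pi.single o (1 : ℂ)) (Pi.single e (1 : ℂ)))
      rwa [zero_smul] at h1
    refine mem_closure_of_tendsto hlim (Eventually.of_forall fun m => ?_)
    rw [← Matrix.smul_vecMulVec]
    refine key (smul_ne_zero ?_ (by simp)) (by simp) ?_
    · exact one_div_ne_zero (Nat.cast_add_one_ne_zero m)
    · rw [dotProduct_smul]
      simp [hoe]

end Orbit

-- Parabolic Higgs bundles as quiver representations.

namespace ParabolicHiggs

variable {r n : ℕ} {p : Fin n → ℂ}

lemma form_apply_eq (hp : Function.Injective p) (B : ParabolicHiggs r n p) (a b : Fin r) :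
    (∀ z ∉ Set.range p, B.form z a b = polarSum p (fun i => B.residue i a b) z) ∧
      ∑ i, B.residue i a b = 0 :=
  eq_polarSum hp (B.holo a b)
    (fun i => tendsto_pi_nhds.1 (tendsto_pi_nhds.1 (B.tendsto_residue i) a) b)
    (B.holo_infty a b).1 (B.holo_infty a b).2

lemma form_eq (hp : Function.Injective p) (B : ParabolicHiggs r n p) {z : ℂ}
    (hz : z ∉ Set.range p) : B.form z = ∑ i, (z - p i)⁻¹ • B.residue i := by
  ext a b
  rw [(B.form_apply_eq hp a b).1 z hz, Matrix.sum_apply]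
  rfl

lemma eventually_notMem_range (p : Fin n → ℂ) (i : Fin n) :
    ∀ᶠ z in 𝓝[≠] (p i), z ∉ Set.range p := by
  have h : (Set.range p \ {p i})ᶜ ∈ 𝓝 (p i) :=
    ((Set.finite_range p).subset Set.sdiff_subset).isClosed.isOpen_compl.mem_nhds (by simp)
  filter_upwards [mem_nhdsWithin_of_mem_nhds h, self_mem_nhdsWithin] with z hz hne hmem
  exact hz ⟨hmem, hne⟩

/-- The Higgs bundle `B` is given by the vectors `x` and the covectors `y`. -/
structure Represents (B : ParabolicHiggs r n p) (x : Matrix (Fin r) (Fin n) ℂ)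
    (y : Matrix (Fin n) (Fin r) ℂ) : Prop where
  line : ∀ i, (B.line i).submodule = Submodule.span ℂ {xᵀ i}
  residue : ∀ i, B.residue i = Matrix.vecMulVec (xᵀ i) (y i)

lemma Represents.ne_zero {B : ParabolicHiggs r n p} {x : Matrix (Fin r) (Fin n) ℂ}
    {y : Matrix (Fin n) (Fin r) ℂ} (h : B.Represents x y) (i : Fin n) : xᵀ i ≠ 0 := by
  intro h0
  have h1 := h.line i
  rw [h0, Submodule.span_zero_singleton, Projectivization.submodule_eq,
    Submodule.span_singleton_eq_bot] at h1
  exact (B.line i).rep_nonzero h1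

lemma Represents.dotProduct_eq_zero {B : ParabolicHiggs r n p} {x : Matrix (Fin r) (Fin n) ℂ}
    {y : Matrix (Fin n) (Fin r) ℂ} (h : B.Represents x y) (i : Fin n) : y i ⬝ᵥ xᵀ i = 0 := by
  have h1 := B.residue_line i (xᵀ i) (by rw [h.line]; exact Submodule.mem_span_singleton_self _)
  rw [h.residue, Matrix.vecMulVec_mulVec] at h1
  simpa [h.ne_zero i] using h1

/-- Coordinates of a parabolic Higgs bundle in which the `a i`-th coordinate of the `i`-th vector
is normalised to one. -/
def chartVec (a : Fin n → Fin r) (B : ParabolicHiggs r n p) : Matrix (Fin r) (Fin n) ℂ :=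
  Matrix.of fun c i => (B.line i).rep c / (B.line i).rep (a i)

/-- The covectors belonging to the vectors `chartVec a B`. -/
def chartCovec (a : Fin n → Fin r) (B : ParabolicHiggs r n p) : Matrix (Fin n) (Fin r) ℂ :=
  Matrix.of fun i b => B.residue i (a i) b

/-- Each column of the residue is a multiple of the vector spanning `L_i`, and the multiple is read
off in the coordinate normalised to one. So the covector is a row of the residue. -/
lemma represents_chart {a : Fin n → Fin r} {B : ParabolicHiggs r n p}
    (ha : ∀ i, (B.line i).rep (a i) ≠ 0) : B.Represents (chartVec a B) (chartCovec a B) := by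
  have h1 : ∀ i, (chartVec a B)ᵀ i = ((B.line i).rep (a i))⁻¹ • (B.line i).rep := fun i => by
    funext c
    simp [chartVec, div_eq_inv_mul]
  have hline : ∀ i, (B.line i).submodule = Submodule.span ℂ {(chartVec a B)ᵀ i} := fun i => by
    rw [h1, Projectivization.submodule_eq]
    exact (Submodule.span_singleton_smul_eq (IsUnit.mk0 _ (inv_ne_zero (ha i))) _).symm
  refine ⟨hline, fun i => ?_⟩
  ext c b
  have h2 := B.residue_mem i (Pi.single b 1)
  rw [hline, Matrix.mulVec_single_one, Submodule.mem_span_singleton] at h2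
  obtain ⟨s, hs⟩ := h2
  have h3 : ∀ c, B.residue i c b = s * chartVec a B c i := fun c => (congrFun hs c).symm
  have h4 : chartVec a B (a i) i = 1 := div_self (ha i)
  rw [Matrix.vecMulVec_apply]
  change _ = chartVec a B c i * B.residue i (a i) b
  rw [h3, h3, h4, mul_one, mul_comm]

lemma exists_represents (B : ParabolicHiggs r n p) : ∃ a : Fin n → Fin r,
    (∀ i, (B.line i).rep (a i) ≠ 0) ∧ B.Represents (chartVec a B) (chartCovec a B) := by
  have h : ∀ i, ∃ a, (B.line i).rep a ≠ 0 := fun i => Function.ne_iff.1 (B.line i).rep_nonzero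
  choose a ha using h
  exact ⟨a, ha, represents_chart ha⟩

/-- The residue sends `v` to `(y_i v) x_i`. Residues are limits of multiples of the Higgs field and
`W` is closed; conversely the field is a combination of residues. -/
lemma invariant_iff (hp : Function.Injective p) {B : ParabolicHiggs r n p}
    {x : Matrix (Fin r) (Fin n) ℂ} {y : Matrix (Fin n) (Fin r) ℂ} (h : B.Represents x y)
    (W : Submodule ℂ (Fin r → ℂ)) :
    B.Invariant W ↔ ∀ i ∈ Finset.univ, xᵀ i ∈ W ∨ ∀ v ∈ W, dotProductBilin ℂ ℂ (y i) v = 0 := by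
  have hres : ∀ i v, B.residue i *ᵥ v = (y i ⬝ᵥ v) • xᵀ i := fun i v => by
    rw [h.residue, Matrix.vecMulVec_mulVec]
    simp
  constructor
  · intro hW i _
    by_contra! hcon
    obtain ⟨hx, v, hv, hyv⟩ := hcon
    have hclosed : IsClosed (W : Set (Fin r → ℂ)) := W.closed_of_finiteDimensional
    have hlim : Tendsto (fun z => ((z - p i) • B.form z) *ᵥ v) (𝓝[≠] (p i))
        (𝓝 (B.residue i *ᵥ v)) :=
      ((continuous_id.matrix_mulVec continuous_const).tendsto _).comp (B.tendsto_residue i)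
    have hmem : B.residue i *ᵥ v ∈ W := by
      refine hclosed.mem_of_tendsto hlim ?_
      filter_upwards [eventually_notMem_range p i] with z hz
      rw [Matrix.smul_mulVec]
      exact W.smul_mem _ (hW z hz v hv)
    rw [hres] at hmem
    exact hx ((W.smul_mem_iff hyv).1 hmem)
  · intro hW z hz v hv
    rw [B.form_eq hp hz, Matrix.sum_mulVec]
    refine W.sum_mem fun i _ => ?_
    rw [Matrix.smul_mulVec, hres]
    refine W.smul_mem _ ?_
    rcases hW i (Finset.mem_univ i) with h1 | h1
    · exact W.smul_mem _ h1
    · have h2 : y i ⬝ᵥ v = 0 := h1 v hv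
      rw [h2, zero_smul]
      exact W.zero_mem

lemma polystable_iff (hr : 0 < r) (hp : Function.Injective p) {B : ParabolicHiggs r n p}
    {x : Matrix (Fin r) (Fin n) ℂ} {y : Matrix (Fin n) (Fin r) ℂ} (h : B.Represents x y)
    (α : Fin n → ℝ) :
    B.Polystable α ↔ StarPolystable ((∑ i, α i) / r) α Finset.univ xᵀ
      (fun i => dotProductBilin ℂ ℂ (y i)) := by
  classical
  have hle : ∀ i (W : Submodule ℂ (Fin r → ℂ)), (B.line i).submodule ≤ W ↔ xᵀ i ∈ W := fun i W => by
    rw [h.line, Submodule.span_singleton_le_iff_mem]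
  have hw : ∀ W, B.weight α W = ∑ i with xᵀ i ∈ W, α i := fun W => by
    rw [weight, Finset.sum_filter]
    exact Finset.sum_congr rfl fun i _ => by simp only [hle]
  have hr0 : (0 : ℝ) < r := Nat.cast_pos.2 hr
  have h1 : ∀ (q : ℝ) (d : ℝ), (r : ℝ) * q ≤ d * ∑ i, α i ↔ q ≤ (∑ i, α i) / r * d := fun q d => by
    rw [div_mul_eq_mul_div, le_div_iff₀ hr0, mul_comm q, mul_comm d]
  have h2 : ∀ (q : ℝ) (d : ℝ), (r : ℝ) * q = d * ∑ i, α i ↔ q = (∑ i, α i) / r * d := fun q d => by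
    rw [div_mul_eq_mul_div, eq_div_iff hr0.ne', mul_comm q, mul_comm d]
  unfold Polystable StarPolystable
  simp only [invariant_iff hp h, hle, hw, h1, h2]
  simp only [Finset.mem_univ, true_imp_iff]

lemma mul_residue_eq_residue_mul {B B' : ParabolicHiggs r n p} {g : Matrix (Fin r) (Fin r) ℂ}
    (h : ∀ z ∉ Set.range p, g * B.form z = B'.form z * g) (i : Fin n) :
    g * B.residue i = B'.residue i * g := by
  have h1 := tendsto_matrix_mul (tendsto_const_nhds (x := g)) (B.tendsto_residue i)
  have h2 := tendsto_matrix_mul (B'.tendsto_residue i) (tendsto_const_nhds (x := g))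
  refine tendsto_nhds_unique h1 (h2.congr' ?_)
  filter_upwards [eventually_notMem_range p i] with z hz
  rw [Matrix.smul_mul, ← h z hz, Matrix.mul_smul]

/-- Isomorphism of parabolic Higgs bundles is equivalence under the complex group. -/
lemma iso_iff (hp : Function.Injective p) {B B' : ParabolicHiggs r n p}
    {x x' : Matrix (Fin r) (Fin n) ℂ} {y y' : Matrix (Fin n) (Fin r) ℂ} (h : B.Represents x y)
    (h' : B'.Represents x' y') : B.Iso B' ↔ ComplexEquiv x y x' y' := by
  constructor
  · rintro ⟨g, k, H⟩
    set G := g OnePoint.infty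
    set K := k OnePoint.infty
    have hg : ∀ q, g q = G := fun q => by
      ext a b
      exact (H.holo a b).eq_infty q
    have hGK : G * K = 1 := H.mul_inv _
    have hKG : K * G = 1 := H.inv_mul _
    have hres := mul_residue_eq_residue_mul (B := B) (B' := B') (g := G) fun z hz => by
      rw [← hg (z : OnePoint ℂ)]
      exact H.map_form z hz
    have hGx : ∀ i, G *ᵥ xᵀ i ≠ 0 := fun i h0 => h.ne_zero i (by
      have := congrArg (K *ᵥ ·) h0
      simpa only [Matrix.mulVec_mulVec, hKG, Matrix.one_mulVec, Matrix.mulVec_zero] using this)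
    have hs : ∀ i, ∃ s : ℂ, s • (G *ᵥ xᵀ i) = x'ᵀ i := fun i => by
      have h1 := H.map_line i
      rw [hg, h.line, h'.line, Submodule.map_span, Set.image_singleton, Matrix.toLin'_apply] at h1
      exact Submodule.mem_span_singleton.1 (h1 ▸ Submodule.mem_span_singleton_self _)
    choose s hs using hs
    have hs0 : ∀ i, s i ≠ 0 := fun i h0 => h'.ne_zero i (by rw [← hs i, h0, zero_smul])
    -- Equality of the rank-one matrices determines the covector, because the vector `G x_i` is
    -- nonzero.
    have hy : ∀ i, y i = s i • (y' i ᵥ* G) := fun i => by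
      have h1 := hres i
      rw [h.residue, h'.residue, Matrix.mul_vecMulVec, Matrix.vecMulVec_mul, ← hs i,
        Matrix.smul_vecMulVec] at h1
      obtain ⟨a, ha⟩ := Function.ne_iff.1 (hGx i)
      funext b
      have h2 := congrFun (congrFun h1 a) b
      simp only [Matrix.vecMulVec_apply, Matrix.smul_apply, smul_eq_mul] at h2
      have ha : (G *ᵥ xᵀ i) a ≠ 0 := ha
      refine mul_left_cancel₀ ha (h2.trans ?_)
      simp only [Pi.smul_apply, smul_eq_mul]
      ring
    refine ⟨G, K, fun i => (s i)⁻¹, hGK, fun i => inv_ne_zero (hs0 i), ?_, ?_⟩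
    · ext a i
      rw [Matrix.mul_diagonal, inv_inv, mul_comm]
      exact (congrFun (hs i) a).symm
    · ext i a
      rw [Matrix.mul_assoc, Matrix.diagonal_mul]
      have h1 : (y * K) i = s i • y' i := by
        have : (y * K) i = y i ᵥ* K := rfl
        rw [this, hy, Matrix.smul_vecMul, Matrix.vecMul_vecMul, hGK, Matrix.vecMul_one]
      rw [h1, Pi.smul_apply, smul_eq_mul, inv_mul_cancel_left₀ (hs0 i)]
  · rintro ⟨G, K, t, hGK, ht, rfl, rfl⟩
    have hKG : K * G = 1 := mul_eq_one_comm.1 hGK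
    have hx' : ∀ i, (G * x * Matrix.diagonal (fun i => (t i)⁻¹))ᵀ i = (t i)⁻¹ • (G *ᵥ xᵀ i) :=
      fun i => by
        funext a
        rw [Matrix.transpose_apply, Matrix.mul_diagonal, mul_comm]
        rfl
    have hy' : ∀ i, (Matrix.diagonal t * y * K) i = t i • (y i ᵥ* K) := fun i => by
      funext a
      rw [Matrix.mul_assoc, Matrix.diagonal_mul]
      rfl
    refine ⟨fun _ => G, fun _ => K, fun _ _ => ⟨differentiable_const _, differentiable_const _⟩,
      fun _ _ => ⟨differentiable_const _, differentiable_const _⟩, fun _ => hGK, fun _ => hKG,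
      fun i => ?_, fun z hz => ?_⟩
    · rw [h.line, h'.line, Submodule.map_span, Set.image_singleton, Matrix.toLin'_apply, hx']
      exact (Submodule.span_singleton_smul_eq (IsUnit.mk0 _ (inv_ne_zero (ht i))) _).symm
    · rw [B.form_eq hp hz, B'.form_eq hp hz, Matrix.mul_sum, Matrix.sum_mul]
      refine Finset.sum_congr rfl fun i _ => ?_
      rw [Matrix.mul_smul, Matrix.smul_mul, h.residue, h'.residue, hx', hy', Matrix.mul_vecMulVec,
        Matrix.vecMulVec_mul, Matrix.smul_vecMul, Matrix.vecMul_vecMul, hKG, Matrix.vecMul_one,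
        Matrix.smul_vecMulVec, Matrix.vecMulVec_smul, smul_smul, smul_smul,
        mul_assoc, inv_mul_cancel₀ (ht i), mul_one]

/-- The parabolic Higgs bundle given by vectors `x` and covectors `y`. -/
def ofData (hp : Function.Injective p) (x : Matrix (Fin r) (Fin n) ℂ)
    (y : Matrix (Fin n) (Fin r) ℂ) (hx : ∀ i, xᵀ i ≠ 0) (hyx : ∀ i, y i ⬝ᵥ xᵀ i = 0)
    (hxy : x * y = 0) : ParabolicHiggs r n p where
  line i := Projectivization.mk ℂ (xᵀ i) (hx i)
  form z := open Classical in if z ∈ Set.range p then 0 else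
    Matrix.of fun a b => polarSum p (fun i => x a i * y i b) z
  form_at i := if_pos ⟨i, rfl⟩
  holo a b := by
    have h : DifferentiableOn ℂ (polarSum p fun i => x a i * y i b) (Set.range p)ᶜ := by
      intro z hz
      refine DifferentiableAt.differentiableWithinAt ?_
      unfold polarSum
      refine DifferentiableAt.fun_sum fun i _ => ?_
      have : z - p i ≠ 0 := sub_ne_zero.2 fun e => hz ⟨i, e.symm⟩
      fun_prop (disch := assumption)
    refine h.congr fun z hz => ?_
    rw [if_neg hz]
    rfl
  pole i a b := by
    have h : polarSum p (fun i => x a i * y i b) =ᶠ[𝓝[≠] (p i)] fun z =>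
        (open Classical in if z ∈ Set.range p then (0 : Matrix (Fin r) (Fin r) ℂ) else
          Matrix.of fun a b => polarSum p (fun i => x a i * y i b) z) a b := by
      filter_upwards [eventually_notMem_range p i] with z hz
      rw [if_neg hz]
      rfl
    exact ⟨(meromorphicAt_polarSum p _ _).congr h,
      (order_polarSum hp _ i).trans_eq (meromorphicOrderAt_congr h)⟩
  holo_infty a b := by
    -- The central complex moment map equation is what removes the pole at infinity.
    have hc : ∑ i, x a i * y i b = 0 := by
      rw [← Matrix.mul_apply, hxy, Matrix.zero_apply]
    obtain ⟨g, hg, he⟩ := polarSum_infty p hc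
    have hev : ∀ᶠ w in 𝓝[≠] (0 : ℂ), w⁻¹ ∉ Set.range p := by
      have h1 : ∀ᶠ z in Bornology.cobounded ℂ, z ∉ Set.range p :=
        Bornology.isBounded_def.1 (Set.finite_range p).isBounded
      exact (tendsto_inv₀_nhdsNE_zero (α := ℂ)).eventually h1
    have h : g =ᶠ[𝓝[≠] 0] fun w : ℂ => -(w ^ 2)⁻¹ *
        (open Classical in if w⁻¹ ∈ Set.range p then (0 : Matrix (Fin r) (Fin r) ℂ) else
          Matrix.of fun a b => polarSum p (fun i => x a i * y i b) w⁻¹) a b := by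
      filter_upwards [he, hev] with w hw hw'
      rw [if_neg hw', ← hw]
      rfl
    exact ⟨hg.meromorphicAt.congr h, hg.meromorphicOrderAt_nonneg.trans_eq
      (meromorphicOrderAt_congr h)⟩
  residue i := Matrix.vecMulVec (xᵀ i) (y i)
  tendsto_residue i := by
    refine tendsto_pi_nhds.2 fun a => tendsto_pi_nhds.2 fun b => ?_
    refine (tendsto_mul_polarSum hp (fun i => x a i * y i b) i).congr' ?_
    filter_upwards [eventually_notMem_range p i] with z hz
    rw [if_neg hz]
    rfl
  residue_mem i v := by
    rw [Matrix.vecMulVec_mulVec, Projectivization.submodule_mk]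
    exact Submodule.mem_span_singleton.2 ⟨y i ⬝ᵥ v, by simp⟩
  residue_line i v hv := by
    rw [Projectivization.submodule_mk, Submodule.mem_span_singleton] at hv
    obtain ⟨s, rfl⟩ := hv
    rw [Matrix.vecMulVec_mulVec, dotProduct_smul, hyx i]
    simp

lemma represents_ofData (hp : Function.Injective p) (x : Matrix (Fin r) (Fin n) ℂ)
    (y : Matrix (Fin n) (Fin r) ℂ) (hx : ∀ i, xᵀ i ≠ 0) (hyx : ∀ i, y i ⬝ᵥ xᵀ i = 0)
    (hxy : x * y = 0) : (ofData hp x y hx hyx hxy).Represents x y :=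
  ⟨fun i => Projectivization.submodule_mk _ _, fun _ => rfl⟩

end ParabolicHiggs

-- The moment map level set.

section Level

lemma traceFree_eq_zero_iff {r : ℕ} {A : Matrix (Fin r) (Fin r) ℂ} :
    traceFree A = 0 ↔ A = (A.trace / (r : ℂ)) • (1 : Matrix (Fin r) (Fin r) ℂ) :=
  sub_eq_zero

/-- A vanishing trace-free part leaves a scalar matrix, and the leg equations force its trace to be
`∑ α_i`. -/
lemma realMoment_eq_iff {r n : ℕ} (hr : 0 < r) {α : Fin n → ℝ} (v : DoubledRep r n) :
    realMoment v = (0, α) ↔ IsBalanced ((∑ i, α i) / r) α v.1 v.2 := by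
  have hr0 : (r : ℂ) ≠ 0 := Nat.cast_ne_zero.2 hr.ne'
  rw [realMoment, Prod.mk.injEq, traceFree_eq_zero_iff]
  have htr : ∀ β : Fin n → ℝ, (∀ i, ∑ a, ‖v.1 a i‖ ^ 2 - ∑ a, ‖v.2 i a‖ ^ 2 = β i) →
      (v.1 * v.1ᴴ - v.2ᴴ * v.2).trace = ((∑ i, β i : ℝ) : ℂ) := fun β h => by
    simp only [Matrix.trace, Matrix.diag_apply, Matrix.sub_apply, mul_conjTranspose_diag,
      conjTranspose_mul_diag]
    rw [Finset.sum_sub_distrib, ← Complex.ofReal_sum, ← Complex.ofReal_sum, Finset.sum_comm,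
      Finset.sum_comm (f := fun a i => ‖v.2 i a‖ ^ 2), ← Complex.ofReal_sub,
      ← Finset.sum_sub_distrib]
    simp only [h]
  constructor
  · rintro ⟨h1, h2⟩
    refine ⟨?_, congrFun h2⟩
    rw [h1, htr α (congrFun h2), Complex.ofReal_div, Complex.ofReal_natCast]
  · intro h
    refine ⟨?_, funext h.leg⟩
    rw [htr α h.leg, h.center, Complex.ofReal_div, Complex.ofReal_natCast]

/-- The trace of `x y` is the sum of the leg terms `y_i x_i`, so the trace-free condition already
gives `x y = 0`. -/
lemma complexMoment_eq_zero_iff {r n : ℕ} (v : DoubledRep r n) :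
    complexMoment v = 0 ↔ (∀ i, v.2 i ⬝ᵥ v.1ᵀ i = 0) ∧ v.1 * v.2 = 0 := by
  have htr : (∀ i, v.2 i ⬝ᵥ v.1ᵀ i = 0) → (v.1 * v.2).trace = 0 := fun h => by
    rw [Matrix.trace_mul_comm]
    exact Finset.sum_eq_zero fun i _ => h i
  rw [complexMoment, Prod.mk_eq_zero, traceFree_eq_zero_iff]
  constructor
  · rintro ⟨h1, h2⟩
    have h3 : ∀ i, v.2 i ⬝ᵥ v.1ᵀ i = 0 := congrFun h2
    refine ⟨h3, ?_⟩
    rw [h1, htr h3, zero_div, zero_smul]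
  · rintro ⟨h1, h2⟩
    refine ⟨?_, funext h1⟩
    rw [h2, Matrix.trace_zero, zero_div, zero_smul]

lemma ComplexEquiv.complexMoment_eq_zero {r n : ℕ} {v w : DoubledRep r n}
    (h : ComplexEquiv v.1 v.2 w.1 w.2) (hv : complexMoment v = 0) : complexMoment w = 0 := by
  rw [complexMoment_eq_zero_iff] at hv ⊢
  obtain ⟨hv1, hv2⟩ := hv
  obtain ⟨g, k, t, hgk, ht, h1, h2⟩ := h
  have hkg : k * g = 1 := mul_eq_one_comm.1 hgk
  have hdiag : (Matrix.diagonal fun i => (t i)⁻¹) * Matrix.diagonal t = 1 := by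
    rw [Matrix.diagonal_mul_diagonal]
    simp only [inv_mul_cancel₀ (ht _), Matrix.diagonal_one]
  constructor
  · intro i
    have h3 : w.2 * w.1 = Matrix.diagonal t * (v.2 * v.1) * Matrix.diagonal fun i => (t i)⁻¹ := by
      rw [h1, h2]
      simp only [Matrix.mul_assoc]
      rw [← Matrix.mul_assoc k, hkg, Matrix.one_mul]
    have h4 : (w.2 * w.1) i i = 0 := by
      rw [h3, Matrix.mul_diagonal, Matrix.diagonal_mul]
      have : (v.2 * v.1) i i = 0 := hv1 i
      rw [this, mul_zero, zero_mul]
    exact h4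
  · rw [h1, h2]
    simp only [Matrix.mul_assoc]
    rw [← Matrix.mul_assoc (Matrix.diagonal _) (Matrix.diagonal t), hdiag, Matrix.one_mul,
      ← Matrix.mul_assoc v.1, hv2, Matrix.zero_mul, Matrix.mul_zero]

lemma unitaryAct_mk {r n : ℕ} {k : Matrix (Fin r) (Fin r) ℂ}
    (hk : k ∈ Matrix.unitaryGroup (Fin r) ℂ)
    (θ : Fin n → Circle) (v : DoubledRep r n) :
    unitaryAct ⟨k, hk⟩ θ v = (k * v.1 * Matrix.diagonal (fun i => ((θ i)⁻¹ : ℂ)),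
      Matrix.diagonal (fun i => (θ i : ℂ)) * v.2 * kᴴ) := by
  simp only [unitaryAct, Circle.coe_inv]
  rfl

lemma complexEquiv_unitaryAct {r n : ℕ} (u : Matrix.unitaryGroup (Fin r) ℂ) (t : Fin n → Circle)
    (v : DoubledRep r n) :
    ComplexEquiv v.1 v.2 (unitaryAct u t v).1 (unitaryAct u t v).2 := by
  refine ⟨u, (u⁻¹ : Matrix.unitaryGroup (Fin r) ℂ), fun i => t i, ?_, fun i => (t i).coe_ne_zero,
    ?_, rfl⟩
  · rw [← Submonoid.coe_mul, mul_inv_cancel, Submonoid.coe_one]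
  · simp only [unitaryAct, Circle.coe_inv]

variable {r n : ℕ} {α : Fin n → ℝ}

lemma HyperLevel.isBalanced (hr : 0 < r) (v : HyperLevel r n α) :
    IsBalanced ((∑ i, α i) / r) α v.1.1 v.1.2 :=
  (realMoment_eq_iff hr _).1 v.2.1

lemma HyperLevel.ne_zero (hα : ∀ i, 0 < α i) (v : HyperLevel r n α) (i : Fin n) :
    v.1.1ᵀ i ≠ 0 := by
  intro h0
  have h1 : ∑ a, ‖v.1.1 a i‖ ^ 2 - ∑ a, ‖v.1.2 i a‖ ^ 2 = α i :=
    congrFun (Prod.ext_iff.1 v.2.1).2 i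
  have h2 : ∀ a, v.1.1 a i = 0 := congrFun h0
  have h3 : 0 ≤ ∑ a, ‖v.1.2 i a‖ ^ 2 := Finset.sum_nonneg fun _ _ => by positivity
  simp only [h2, norm_zero, ne_eq, OfNat.ofNat_ne_zero, not_false_eq_true, zero_pow,
    Finset.sum_const_zero] at h1
  linarith [hα i]

/-- The unitary group acts on the level set. -/
def HyperLevel.act (hr : 0 < r) (u : Matrix.unitaryGroup (Fin r) ℂ) (t : Fin n → Circle)
    (v : HyperLevel r n α) : HyperLevel r n α :=
  ⟨unitaryAct u t v.1, by
    refine ⟨(realMoment_eq_iff hr _).2 ?_,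
      (complexEquiv_unitaryAct u t v.1).complexMoment_eq_zero v.2.2⟩
    rw [unitaryAct_mk u.2]
    exact (v.isBalanced hr).unitary u.2 t⟩

/-- Kempf–Ness uniqueness: on the level set, complex orbits and unitary orbits coincide. -/
lemma HyperLevel.equiv_iff (hr : 0 < r) (v w : HyperLevel r n α) :
    v ≈ w ↔ ComplexEquiv v.1.1 v.1.2 w.1.1 w.1.2 := by
  constructor
  · rintro ⟨u, t, h⟩
    rw [h]
    exact complexEquiv_unitaryAct u t v.1
  · intro h
    obtain ⟨k, hk, θ, h1, h2⟩ :=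
      (w.isBalanced hr).exists_unitary_of_complexEquiv (v.isBalanced hr) h.symm
    refine ⟨⟨k, hk⟩, θ, ?_⟩
    rw [unitaryAct_mk, h1, h2]

end Level

-- The bijection and its continuity.

section Moduli

variable {r n : ℕ} {α : Fin n → ℝ} {p : Fin n → ℂ}

/-- The parabolic Higgs bundle of a point of the level set. -/
def HyperLevel.higgs (hα : ∀ i, 0 < α i) (hp : Function.Injective p) (v : HyperLevel r n α) :
    ParabolicHiggs r n p :=
  .ofData hp v.1.1 v.1.2 (v.ne_zero hα) ((complexMoment_eq_zero_iff v.1).1 v.2.2).1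
    ((complexMoment_eq_zero_iff v.1).1 v.2.2).2

lemma HyperLevel.represents (hα : ∀ i, 0 < α i) (hp : Function.Injective p)
    (v : HyperLevel r n α) : (v.higgs hα hp).Represents v.1.1 v.1.2 :=
  ParabolicHiggs.represents_ofData ..

lemma HyperLevel.polystable (hr : 0 < r) (hα : ∀ i, 0 < α i) (hp : Function.Injective p)
    (v : HyperLevel r n α) : (v.higgs hα hp).Polystable α :=
  (ParabolicHiggs.polystable_iff hr hp (v.represents hα hp) α).2 (v.isBalanced hr).starPolystable

/-- Every polystable parabolic Higgs bundle comes from the level set. -/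
lemma ParabolicHiggs.Polystable.exists_level (hr : 0 < r) (hα : ∀ i, 0 < α i)
    (hp : Function.Injective p) {B : ParabolicHiggs r n p} (hB : B.Polystable α)
    {x : Matrix (Fin r) (Fin n) ℂ} {y : Matrix (Fin n) (Fin r) ℂ} (h : B.Represents x y) :
    ∃ v : HyperLevel r n α, ComplexEquiv x y v.1.1 v.1.2 := by
  have hr0 : (r : ℝ) ≠ 0 := Nat.cast_ne_zero.2 hr.ne'
  obtain ⟨x', y', he, hb⟩ := exists_balanced_of_polystable
    (div_nonneg (Finset.sum_nonneg fun i _ => (hα i).le) (Nat.cast_nonneg r)) hα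
    (by rw [Fintype.card_fin, div_mul_cancel₀ _ hr0]) ((polystable_iff hr hp h α).1 hB)
  refine ⟨⟨(x', y'), (realMoment_eq_iff hr _).2 hb,
    ComplexEquiv.complexMoment_eq_zero (v := (x, y)) he ?_⟩, he⟩
  refine (complexMoment_eq_zero_iff (x, y)).2 ⟨h.dotProduct_eq_zero, ?_⟩
  ext a b
  have h1 := (B.form_apply_eq hp a b).2
  simp only [h.residue, Matrix.vecMulVec_apply] at h1
  exact h1

/-- The map from the hyperpolygon space to the moduli space of parabolic Higgs bundles. -/
def hyperToHiggs (hr : 0 < r) (hα : ∀ i, 0 < α i) (hp : Function.Injective p) :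
    HyperpolygonSpace r n α → HiggsModuli r n α p :=
  Quotient.map (fun v => ⟨v.higgs hα hp, v.polystable hr hα hp⟩) fun v w h =>
    (ParabolicHiggs.iso_iff hp (v.represents hα hp) (w.represents hα hp)).2
      ((HyperLevel.equiv_iff hr v w).1 h)

lemma hyperToHiggs_bijective (hr : 0 < r) (hα : ∀ i, 0 < α i) (hp : Function.Injective p) :
    Function.Bijective (hyperToHiggs hr hα hp) := by
  constructor
  · intro q q'
    induction q using Quotient.inductionOn with | _ v
    induction q' using Quotient.inductionOn with | _ w
    intro h
    refine Quotient.sound ((HyperLevel.equiv_iff hr v w).2 ?_)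
    exact (ParabolicHiggs.iso_iff hp (v.represents hα hp) (w.represents hα hp)).1
      (Quotient.exact h)
  · intro q
    induction q using Quotient.inductionOn with | _ B
    obtain ⟨a, -, hB⟩ := B.1.exists_represents
    obtain ⟨v, hv⟩ := B.2.exists_level hr hα hp hB
    exact ⟨⟦v⟧, Quotient.sound
      ((ParabolicHiggs.iso_iff hp (v.represents hα hp) hB).2 hv.symm)⟩

lemma continuous_higgs (hα : ∀ i, 0 < α i) (hp : Function.Injective p) :
    Continuous fun v : HyperLevel r n α => v.higgs hα hp := by
  have hx : Continuous fun v : HyperLevel r n α => v.1.1 := continuous_fst.comp continuous_subtype_val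
  have hy : Continuous fun v : HyperLevel r n α => v.1.2 := continuous_snd.comp continuous_subtype_val
  refine continuous_induced_rng.2 (Continuous.prodMk ?_ ?_)
  · refine continuous_pi fun i => ?_
    have h1 : Continuous fun v : HyperLevel r n α =>
        (⟨v.1.1ᵀ i, v.ne_zero hα i⟩ : {v : Fin r → ℂ // v ≠ 0}) :=
      Continuous.subtype_mk (continuous_pi fun a => hx.matrix_elem a i) _
    exact continuous_coinduced_rng.comp h1
  · refine continuous_pi fun z => continuous_matrix fun a b => ?_
    change Continuous fun v : HyperLevel r n α => (open Classical in if z ∈ Set.range p then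
      (0 : Matrix (Fin r) (Fin r) ℂ) else
        Matrix.of fun a b => polarSum p (fun i => v.1.1 a i * v.1.2 i b) z) a b
    split_ifs
    · exact continuous_const
    · simp only [Matrix.of_apply, polarSum]
      exact continuous_finsetSum _ fun i _ =>
        continuous_const.mul ((hx.matrix_elem a i).mul (hy.matrix_elem i b))

lemma continuous_hyperToHiggs (hr : 0 < r) (hα : ∀ i, 0 < α i) (hp : Function.Injective p) :
    Continuous (hyperToHiggs hr hα hp) :=
  Continuous.quotient_map' (Continuous.subtype_mk (continuous_higgs hα hp) _) _

end Moduli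

-- Local continuous coordinates on the space of Higgs bundles.

section Charts

lemma isQuotientMap_mk (r : ℕ) : IsQuotientMap
    (fun v : {v : Fin r → ℂ // v ≠ 0} => Projectivization.mk ℂ v.1 v.2) :=
  ⟨⟨rfl⟩, fun L => ⟨⟨L.rep, L.rep_nonzero⟩, L.mk_rep⟩⟩

lemma exists_rep_mk_eq_smul {r : ℕ} (v : {v : Fin r → ℂ // v ≠ 0}) : ∃ u : ℂ, u ≠ 0 ∧
    (Projectivization.mk ℂ v.1 v.2).rep = u • v.1 := by
  obtain ⟨u, hu⟩ := Projectivization.exists_smul_eq_mk_rep ℂ v.1 v.2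
  exact ⟨u, u.ne_zero, hu.symm⟩

lemma preimage_rep_ne_zero {r : ℕ} (a : Fin r) :
    (fun v : {v : Fin r → ℂ // v ≠ 0} => Projectivization.mk ℂ v.1 v.2) ⁻¹' {L | L.rep a ≠ 0} =
      {v | v.1 a ≠ 0} := by
  ext v
  obtain ⟨u, hu, h⟩ := exists_rep_mk_eq_smul v
  simp [h, hu]

lemma continuous_subtype_apply {r : ℕ} (b : Fin r) :
    Continuous fun v : {v : Fin r → ℂ // v ≠ 0} => v.1 b :=
  (continuous_apply b).comp continuous_subtype_val

/-- The chosen representative need not vary continuously, but the vanishing of a coordinate is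
independent of the choice and can be tested on nonzero vectors. -/
lemma isOpen_rep_ne_zero {r : ℕ} (a : Fin r) :
    IsOpen {L : ℙ ℂ (Fin r → ℂ) | L.rep a ≠ 0} := by
  rw [← (isQuotientMap_mk r).isOpen_preimage, preimage_rep_ne_zero]
  exact isOpen_ne_fun (continuous_subtype_apply a) continuous_const

/-- The affine coordinates of projective space are continuous. -/
lemma continuousOn_rep_div {r : ℕ} (a c : Fin r) :
    ContinuousOn (fun L : ℙ ℂ (Fin r → ℂ) => L.rep c / L.rep a) {L | L.rep a ≠ 0} := by
  refine ((isQuotientMap_mk r).continuousOn_isOpen_iff (isOpen_rep_ne_zero a)).2 ?_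
  rw [preimage_rep_ne_zero]
  refine ((continuous_subtype_apply c).continuousOn.div
    (continuous_subtype_apply a).continuousOn fun v hv => hv).congr fun v _ => ?_
  obtain ⟨u, hu, h⟩ := exists_rep_mk_eq_smul v
  simp [h, mul_div_mul_left _ _ hu]

namespace ParabolicHiggs

variable {r n : ℕ} {p : Fin n → ℂ}

lemma continuous_line_form :
    Continuous fun B : ParabolicHiggs r n p => (B.line, B.form) :=
  continuous_induced_dom

lemma continuous_line (i : Fin n) : Continuous fun B : ParabolicHiggs r n p => B.line i :=
  (continuous_apply i).comp (continuous_fst.comp continuous_line_form)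

lemma continuous_form (z : ℂ) : Continuous fun B : ParabolicHiggs r n p => B.form z :=
  (continuous_apply z).comp (continuous_snd.comp continuous_line_form)

/-- The residues depend continuously on the Higgs field. -/
lemma continuous_residue (hp : Function.Injective p) (i : Fin n) :
    Continuous fun B : ParabolicHiggs r n p => B.residue i := by
  classical
  let T : (Fin n → ℂ) →ₗ[ℂ] (ℂ → ℂ) :=
    { toFun := fun c z => if z ∈ Set.range p then 0 else polarSum p c z
      map_add' := fun c d => by
        funext z
        by_cases hz : z ∈ Set.range p
        · simp only [hz, if_true, Pi.add_apply, add_zero]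
        · simp only [hz, if_false, Pi.add_apply, polarSum, mul_add, Finset.sum_add_distrib]
      map_smul' := fun s c => by
        funext z
        by_cases hz : z ∈ Set.range p
        · simp only [hz, if_true, Pi.smul_apply, smul_zero]
        · simp only [hz, if_false, Pi.smul_apply, polarSum, smul_eq_mul, RingHom.id_apply,
            Finset.mul_sum, mul_left_comm] }
  have hT : Function.Injective T := by
    intro c d h
    funext j
    refine tendsto_nhds_unique (tendsto_mul_polarSum hp c j)
      ((tendsto_mul_polarSum hp d j).congr' ?_)
    filter_upwards [eventually_notMem_range p j] with z hz
    have h1 := congrFun h z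
    simp only [T, LinearMap.coe_mk, AddHom.coe_mk, if_neg hz] at h1
    rw [h1]
  -- An injective linear map from a finite-dimensional space is an embedding, so pointwise
  -- convergence of the fields forces convergence of the residues.
  have hind := (LinearMap.isClosedEmbedding_of_injective (LinearMap.ker_eq_bot.2 hT)).isInducing
  refine continuous_matrix fun a b => ?_
  have h1 : Continuous fun B : ParabolicHiggs r n p => fun j => B.residue j a b := by
    refine hind.continuous_iff.2 (continuous_pi fun z => ?_)
    refine ((continuous_form z).matrix_elem a b).congr fun B => ?_
    simp only [Function.comp_apply, T, LinearMap.coe_mk, AddHom.coe_mk]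
    split_ifs with hz
    · obtain ⟨j, rfl⟩ := hz
      rw [B.form_at, Matrix.zero_apply]
    · exact (B.form_apply_eq hp a b).1 z hz
  exact (continuous_apply i).comp h1

variable {a : Fin n → Fin r} {B₀ : ParabolicHiggs r n p}

lemma eventually_rep_ne_zero (ha : ∀ i, (B₀.line i).rep (a i) ≠ 0) :
    ∀ᶠ B in 𝓝 B₀, ∀ i, (B.line i).rep (a i) ≠ 0 :=
  eventually_all.2 fun i => (continuous_line i).continuousAt.eventually
    ((isOpen_rep_ne_zero (a i)).mem_nhds (ha i))

lemma continuousAt_chartVec (ha : ∀ i, (B₀.line i).rep (a i) ≠ 0) :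
    ContinuousAt (chartVec a) B₀ := by
  refine continuousAt_pi.2 fun c => continuousAt_pi.2 fun i => ?_
  exact ContinuousAt.comp (f := fun B : ParabolicHiggs r n p => B.line i)
    ((continuousOn_rep_div (a i) c).continuousAt
      ((isOpen_rep_ne_zero (a i)).mem_nhds (ha i))) (continuous_line i).continuousAt

lemma continuous_chartCovec (hp : Function.Injective p) :
    Continuous (chartCovec (p := p) a) :=
  continuous_matrix fun i b => (continuous_residue hp i).matrix_elem (a i) b

end ParabolicHiggs

end Charts

-- Continuity of the inverse map.

section Homeomorph

variable {r n : ℕ} {α : Fin n → ℝ} {p : Fin n → ℂ}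

/-- The orbit of the balanced representatives depends continuously on the bundle. -/
lemma continuous_mk_level (hr : 0 < r) (hα : ∀ i, 0 < α i) (hp : Function.Injective p)
    {V : {B : ParabolicHiggs r n p // B.Polystable α} → HyperLevel r n α}
    (hV : ∀ B, ((V B).higgs hα hp).Iso B.1) :
    Continuous fun B => (⟦V B⟧ : HyperpolygonSpace r n α) := by
  refine continuous_iff_continuousAt.2 fun B₀ => tendsto_iff_ultrafilter _ _ _ |>.2 fun F hF => ?_
  obtain ⟨a, ha, hB₀⟩ := B₀.1.exists_represents
  have hval : Tendsto Subtype.val (F : Filter {B : ParabolicHiggs r n p // B.Polystable α})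
      (𝓝 B₀.1) := continuous_subtype_val.continuousAt.tendsto.mono_left hF
  -- A fixed complex group element carries the chart data of `B₀` to the balanced point `V B₀`.
  -- Applied to the chart data of all `B`, it yields a family converging to `V B₀` which, near `B₀`,
  -- stays in the complex orbits of the `V B`.
  obtain ⟨g, h, t, hgh, ht, hx₀, hy₀⟩ :=
    ((ParabolicHiggs.iso_iff hp ((V B₀).represents hα hp) hB₀).1 (hV B₀)).symm
  have hx := tendsto_matrix_mul (tendsto_matrix_mul (tendsto_const_nhds (x := g))
    ((ParabolicHiggs.continuousAt_chartVec ha).tendsto.comp hval))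
    (tendsto_const_nhds (x := Matrix.diagonal fun i => (t i)⁻¹))
  have hy := tendsto_matrix_mul (tendsto_matrix_mul (tendsto_const_nhds (x := Matrix.diagonal t))
    (((ParabolicHiggs.continuous_chartCovec (a := a) hp).tendsto B₀.1).comp hval))
    (tendsto_const_nhds (x := h))
  rw [← hx₀] at hx
  rw [← hy₀] at hy
  obtain ⟨k, θ, hk, h1, h2⟩ := ((V B₀).isBalanced hr).exists_tendsto_unitary F hx hy
    (fun B => (V B).isBalanced hr) (by
      filter_upwards [hval.eventually (ParabolicHiggs.eventually_rep_ne_zero ha)] with B hB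
      refine (ComplexEquiv.symm ⟨g, h, t, hgh, ht, rfl, rfl⟩).trans ?_
      exact ((ParabolicHiggs.iso_iff hp ((V B).represents hα hp)
        (ParabolicHiggs.represents_chart hB)).1 (hV B)).symm)
  have hw : Tendsto (fun B => (V B).act hr ⟨k B, hk B⟩ (θ B)) F (𝓝 (V B₀)) := by
    refine tendsto_subtype_rng.2 ?_
    simp only [HyperLevel.act, unitaryAct_mk]
    exact h1.prodMk_nhds h2
  -- `V` itself may be discontinuous; only its unitary translates converge, and they have the same
  -- class.
  refine ((continuous_quotient_mk'.tendsto (V B₀)).comp hw).congr fun B => ?_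
  exact Quotient.sound (Setoid.symm ⟨⟨k B, hk B⟩, θ B, rfl⟩)

/-- The hyperpolygon space is homeomorphic to the moduli space of parabolic Higgs bundles. -/
def hyperHomeoHiggs (hr : 0 < r) (hα : ∀ i, 0 < α i) (hp : Function.Injective p) :
    HyperpolygonSpace r n α ≃ₜ HiggsModuli r n α p where
  toEquiv := Equiv.ofBijective _ (hyperToHiggs_bijective hr hα hp)
  continuous_toFun := continuous_hyperToHiggs hr hα hp
  continuous_invFun := by
    have hV : ∀ B : {B : ParabolicHiggs r n p // B.Polystable α},
        ∃ v : HyperLevel r n α, (v.higgs hα hp).Iso B.1 := fun B => by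
      obtain ⟨a, -, hB⟩ := B.1.exists_represents
      obtain ⟨v, hv⟩ := B.2.exists_level hr hα hp hB
      exact ⟨v, (ParabolicHiggs.iso_iff hp (v.represents hα hp) hB).2 hv.symm⟩
    choose V hV using hV
    refine isQuotientMap_quotient_mk'.continuous_iff.2 ((continuous_mk_level hr hα hp hV).congr ?_)
    intro B
    refine (Equiv.ofBijective _ (hyperToHiggs_bijective hr hα hp)).injective ?_
    refine Eq.trans ?_ (Equiv.apply_symm_apply _ _).symm
    exact Quotient.sound (hV B)

end Homeomorph

end

theorem theorem4p2 (r n : ℕ) (hr : 2 ≤ r) (hn : r + 1 ≤ n) (α : Fin n → ℝ) (hα : ∀ i, 0 < α i)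
    (p : Fin n → ℂ) (hp : Function.Injective p) :
    (∀ (B : ParabolicHiggs r n p) (i : Fin n), B.residue i ∈ closure (minNilpotentOrbit r)) ∧
    ∃ Φ : HyperpolygonSpace r n α ≃ₜ HiggsModuli r n α p,
      ∀ v : HyperLevel r n α, ∃ B : {B : ParabolicHiggs r n p // B.Polystable α},
        Φ (Quotient.mk _ v) = Quotient.mk _ B ∧
        (∀ i, (B.1.line i).submodule = Submodule.span ℂ {fun a => v.1.1 a i}) ∧
        (∀ z : ℂ, z ∉ Set.range p →
          B.1.form z =
            ∑ i, (z - p i)⁻¹ • Matrix.vecMulVec (fun a => v.1.1 a i) (fun b => v.1.2 i b)) := by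
  have hr0 : 0 < r := by omega
  refine ⟨fun B i => ?_, hyperHomeoHiggs hr0 hα hp, fun v =>
    ⟨⟨v.higgs hα hp, v.polystable hr0 hα hp⟩, rfl, (v.represents hα hp).line, fun z hz => ?_⟩⟩
  · obtain ⟨a, -, hB⟩ := B.exists_represents
    rw [hB.residue]
    exact vecMulVec_mem_closure_minNilpotentOrbit hr (hB.dotProduct_eq_zero i)
  · rw [ParabolicHiggs.form_eq hp _ hz]
    rfl
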